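/- **Setting.** Let $d\in\mathbb N$, $p\in(1,\infty)$, $q=p/(p-1)$. Let $\phi:(0,\infty)\times\mathbb R^d\to[0,\infty)$ be (jointly) convex, with $\phi(\rho,\lambda w)=|\lambda|^p\phi(\rho,w)$ for all $\rho>0$, $\lambda\in\mathbb R$, $w\in\mathbb R^d$, and such that for some $\rho_0>0$ one has $\phi(\rho_0,w)>0$ for every $w\ne0$. Extend $\phi$ by $\phi(0,w)=\sup_{\rho>0}\phi(\rho,w)$ and let $\phi^\infty(\rho,w)=\sup_{\lambda>0}\lambda^{-1}\phi(\lambda\rho,\lambda w)$ be its recession function. We say that $\phi$ is $\theta$-homogeneous, $1\le\theta\le p$, if $\phi(\lambda\rho,\lambda w)=\lambda^\theta\phi(\rho,w)$ for all $\lambda,\rho>0$, $w\in\mathbb R^d$. For nonnegative Radon measures $\gamma,\mu$ and an $\mathbb R^d$-valued Radon measure $\boldsymbol\nu$ on $\mathbb R^d$ with $\operatorname{supp}\mu,\operatorname{supp}\boldsymbol\nu\subset\operatorname{supp}\gamma$, write the Lebesgue decompositions $\mu=\rho\gamma+\mu^\perp$, $\boldsymbol\nu=w\gamma+\boldsymbol\nu^\perp$,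 set $\varsigma=\mu^\perp+|\boldsymbol\nu^\perp|$, $\mu^\perp=\rho^\perp\varsigma$, $\boldsymbol\nu^\perp=w^\perp\varsigma$, and $$\Phi(\mu,\boldsymbol\nu|\gamma)=\int\phi(\rho,w)\,d\gamma+\int\phi^\infty(\rho^\perp,w^\perp)\,d\varsigma ;$$ $\Phi=+\infty$ if one of the supports is not contained in $\operatorname{supp}\gamma$. For nonnegative Radon measures $\sigma,\eta$ let $$\mathcal W_{\phi,\gamma}(\sigma,\eta)=\Big(\inf\int_0^1\Phi(\mu_t,\boldsymbol\nu_t|\gamma)\,dt\Big)^{1/p},$$ the infimum being over all weakly$^*$ continuous curves $(\mu_t)_{t\in[0,1]}$ of nonnegative Radon measures with $\mu_0=\sigma$, $\mu_1=\eta$ and all Borel families $(\boldsymbol\nu_t)_{t\in(0,1)}$ of $\mathbb R^d$-valued Radon measures with $\int_0^1|\boldsymbol\nu_t|(B_R)\,dt<\infty$ for all $R>0$ such that $\partial_t\mu_t+\nabla\cdot\boldsymbol\nu_t=0$ in the sense of distributions in $\mathbb R^d\times(0,1)$. Let $\mathcal M_{\phi,\gamma}[\sigma]$ be the set of nonnegative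 Radon measures $\eta$ with $\mathcal W_{\phi,\gamma}(\sigma,\eta)<\infty$. For $r\in\mathbb R$ put $\tilde{\mathsf m}_r(\mu)=\int(1\vee|x|)^r\,d\mu(x)$. For $\delta\ge1$ let $W_\delta(\mu,\eta)$ be the infimum of $\big(\int|x-y|^\delta\,d\Sigma\big)^{1/\delta}$ over all couplings $\Sigma$ of $\mu$ and $\eta$ (nonnegative measures on $\mathbb R^d\times\mathbb R^d$ with marginals $\mu,\eta$). **Theorem (Moment estimates).** For every $\delta\in\mathbb R$ there is a constant $C>0$ depending only on $\phi$ and $\delta$ (hence also on the $d$, $p$ attached to $\phi$) such that the following holds for every $r\in\mathbb R$ and all nonnegative Radon measures $\gamma,\sigma$ with $\tilde{\mathsf m}_r(\gamma)<\infty$ and $\tilde{\mathsf m}_\delta(\sigma)<\infty$. 1. (General case.) If $\delta\le\min(1+r/q,\,p)$, then for every $\eta\in\mathcal M_{\phi,\gamma}[\sigma]$ the moment $\tilde{\mathsf m}_\delta(\eta)$ is finite and $$\tilde{\mathsf m}_\delta(\eta)\le C\big(\tilde{\mathsf m}_\delta(\sigma)+\tilde{\mathsf m}_r(\gamma)+\mathcal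 W_{\phi,\gamma}^p(\sigma,\eta)\big).\qquad(*)$$ 2. (Homogeneous case.) If $\phi$ is $\theta$-homogeneous for some $\theta\in[1,p]$ and $\delta\le\frac1\theta p+(1-\frac1\theta)r$, then for every $\eta\in\mathcal M_{\phi,\gamma}[\sigma]$ the moment $\tilde{\mathsf m}_\delta(\eta)$ is finite, $(*)$ holds, and $$\tilde{\mathsf m}_\delta(\eta)\le C\big(\tilde{\mathsf m}_\delta(\sigma)+\tilde{\mathsf m}_r(\gamma)^{1-1/\theta}\,\mathcal W_{\phi,\gamma}^{p/\theta}(\sigma,\eta)\big)$$ (with the convention $0^0=1$ when $\theta=1$). 3. In either case, if moreover $\delta\ge1$, then $W_\delta$ is finite on $\mathcal M_{\phi,\gamma}[\sigma]$ and the topology induced by $\mathcal W_{\phi,\gamma}$ on $\mathcal M_{\phi,\gamma}[\sigma]$ is stronger than the one induced by $W_\delta$; in particular, for sequences in $\mathcal M_{\phi,\gamma}[\sigma]$ with limit in $\mathcal M_{\phi,\gamma}[\sigma]$, convergence in $\mathcal W_{\phi,\gamma}$ implies convergence in $W_\delta$. -/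

import Mathlib

open MeasureTheory Set Filter Topology
open scoped ENNReal

namespace WeightedTransport

noncomputable section

/-- Euclidean space of dimension `d`. -/
abbrev E (d : ℕ) : Type := EuclideanSpace ℝ (Fin d)

/-! ### Action densities -/

/-- Admissible action densities `φ : (0,∞) × ℝᵈ → [0,∞)` of exponent `p`; the values of `φ` at
`ρ ≤ 0` are irrelevant and never used. -/
structure IsActionDensity {d : ℕ} (p : ℝ) (φ : ℝ → E d → ℝ) : Prop where
  nonneg : ∀ ρ, 0 < ρ → ∀ w, 0 ≤ φ ρ w
  convex : ConvexOn ℝ (Ioi (0 : ℝ) ×ˢ (univ : Set (E d))) (fun z : ℝ × E d => φ z.1 z.2)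
  homogeneous : ∀ ρ, 0 < ρ → ∀ (c : ℝ) (w : E d), φ ρ (c • w) = |c| ^ p * φ ρ w
  nondegenerate : ∃ ρ₀, 0 < ρ₀ ∧ ∀ w : E d, w ≠ 0 → 0 < φ ρ₀ w

/-- Joint positive `θ`-homogeneity: `φ (c ρ, c w) = c ^ θ φ (ρ, w)` for `c, ρ > 0`. -/
def IsJointlyHomogeneous {d : ℕ} (θ : ℝ) (φ : ℝ → E d → ℝ) : Prop :=
  ∀ c ρ : ℝ, 0 < c → 0 < ρ → ∀ w : E d, φ (c * ρ) (c • w) = c ^ θ * φ ρ w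

/-- The lower semicontinuous extension of `φ` to `ℝ × ℝᵈ`: `φ (0, w) = sup_{s > 0} φ (s, w)`,
and `+∞` for `ρ < 0`. -/
def extDensity {d : ℕ} (φ : ℝ → E d → ℝ) (ρ : ℝ) (w : E d) : ℝ≥0∞ :=
  if 0 < ρ then ENNReal.ofReal (φ ρ w)
  else if ρ = 0 then ⨆ (s : ℝ) (_ : 0 < s), ENNReal.ofReal (φ s w)
  else ⊤

/-- The recession function `φ^∞ (ρ, w) = sup_{c > 0} c⁻¹ φ (c ρ, c w)`. -/
def recession {d : ℕ} (φ : ℝ → E d → ℝ) (ρ : ℝ) (w : E d) : ℝ≥0∞ :=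
  ⨆ (c : ℝ) (_ : 0 < c), ENNReal.ofReal c⁻¹ * extDensity φ (c * ρ) (c • w)

/-! ### Vector Radon measures -/

/-- An `ℝᵈ`-valued Radon measure on `ℝᵈ`, given by its polar decomposition `𝛎 = u |𝛎|`: the total
variation `|𝛎|` is a nonnegative Radon measure and `u` is a Borel field with `|u| = 1`
`|𝛎|`-almost everywhere. -/
structure VectorRadonMeasure (d : ℕ) where
  variation : Measure (E d)
  direction : E d → E d
  locallyFinite : IsLocallyFiniteMeasure variation
  measurable_direction : Measurable direction
  norm_direction : ∀ᵐ x ∂variation, ‖direction x‖ = 1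

/-- The value `𝛎(B) ∈ ℝᵈ` on a bounded Borel set `B`. -/
def VectorRadonMeasure.value {d : ℕ} (n : VectorRadonMeasure d) (B : Set (E d)) : E d :=
  ∫ x in B, n.direction x ∂n.variation

/-! ### The action functional -/

/-- `Φ(μ, 𝛎 | γ) = ∫ φ(ρ, w) dγ + ∫ φ^∞(ρ^⊥, w^⊥) dσ`, where `μ = ρ γ + μ^⊥`, `𝛎 = w γ + 𝛎^⊥` are
the Lebesgue decompositions, `σ = μ^⊥ + |𝛎^⊥|`, `μ^⊥ = ρ^⊥ σ` and `𝛎^⊥ = w^⊥ σ`. It is `+∞` unless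
the supports of `μ` and `𝛎` are contained in the support of `γ`. -/
def action {d : ℕ} (φ : ℝ → E d → ℝ) (μ : Measure (E d)) (n : VectorRadonMeasure d)
    (γ : Measure (E d)) : ℝ≥0∞ :=
  open Classical in
  if μ.support ⊆ γ.support ∧ n.variation.support ⊆ γ.support then
    let μs := μ.singularPart γ
    let ns := n.variation.singularPart γ
    let σ := μs + ns
    (∫⁻ x, extDensity φ (μ.rnDeriv γ x).toReal
        ((n.variation.rnDeriv γ x).toReal • n.direction x) ∂γ) +
      ∫⁻ x, recession φ (μs.rnDeriv σ x).toReal ((ns.rnDeriv σ x).toReal • n.direction x) ∂σ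
  else ⊤

/-! ### The continuity equation -/

/-- `(μ, 𝛎)` solves `∂ₜ μₜ + ∇ · 𝛎ₜ = 0` in `ℝᵈ × (0, 1)` with `μ₀ = σ` and `μ₁ = η`: `t ↦ μₜ` is a
weakly-* continuous curve of Radon measures on `[0, 1]`, `𝛎` is a Borel family of vector Radon
measures on `(0, 1)` with `∫₀¹ |𝛎ₜ|(B_R) dt < ∞`, and the equation holds in the sense of
distributions. -/
structure SolvesContinuity {d : ℕ} (μ : ℝ → Measure (E d)) (n : ℝ → VectorRadonMeasure d)
    (σ η : Measure (E d)) : Prop where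
  initial : μ 0 = σ
  final : μ 1 = η
  locallyFinite : ∀ t ∈ Icc (0 : ℝ) 1, IsLocallyFiniteMeasure (μ t)
  weakStar_continuous : ∀ ζ : E d → ℝ, Continuous ζ → HasCompactSupport ζ →
    ContinuousOn (fun t => ∫ x, ζ x ∂(μ t)) (Icc 0 1)
  borel_family : ∀ B : Set (E d), MeasurableSet B → Bornology.IsBounded B →
    Measurable (fun t : Ioo (0 : ℝ) 1 => (n t).value B)
  integrable_variation : ∀ R : ℝ, 0 < R →
    ∫⁻ t in Ioo (0 : ℝ) 1, (n t).variation (Metric.ball 0 R) < ⊤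
  equation : ∀ ζ : ℝ × E d → ℝ, ContDiff ℝ 1 ζ → HasCompactSupport ζ →
    tsupport ζ ⊆ Ioo (0 : ℝ) 1 ×ˢ univ →
    (∫ t in Ioo (0 : ℝ) 1, ∫ x, fderiv ℝ ζ (t, x) (1, 0) ∂(μ t)) +
      (∫ t in Ioo (0 : ℝ) 1, ∫ x, fderiv ℝ ζ (t, x) (0, (n t).direction x) ∂(n t).variation) = 0

/-! ### The weighted Wasserstein distance -/

/-- The `(φ, γ)`-weighted Wasserstein (extended pseudo-)distance `W_{φ,γ}`; its `p`-th power is the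
infimum of `∫₀¹ Φ(μₜ, 𝛎ₜ | γ) dt` over the solutions of the continuity equation joining the two
measures. -/
def weightedDist {d : ℕ} (p : ℝ) (φ : ℝ → E d → ℝ) (γ σ η : Measure (E d)) : ℝ≥0∞ :=
  (⨅ (μ : ℝ → Measure (E d)) (n : ℝ → VectorRadonMeasure d) (_ : SolvesContinuity μ n σ η),
    ∫⁻ t in Ioo (0 : ℝ) 1, action φ (μ t) (n t) γ) ^ (1 / p)

/-- `M_{φ,γ}[σ]`: the nonnegative Radon measures at finite `W_{φ,γ}`-distance from `σ`. -/
def finiteDistClass {d : ℕ} (p : ℝ) (φ : ℝ → E d → ℝ) (γ σ : Measure (E d)) :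
    Set (Measure (E d)) :=
  {η | IsLocallyFiniteMeasure η ∧ weightedDist p φ γ σ η < ⊤}

/-! ### Moments and Wasserstein distances -/

/-- The generalized moment `m̃_r(μ) = ∫ (1 ∨ |x|) ^ r dμ`, `r ∈ ℝ`. -/
def moment {d : ℕ} (r : ℝ) (μ : Measure (E d)) : ℝ≥0∞ :=
  ∫⁻ x, ENNReal.ofReal ((max 1 ‖x‖) ^ r) ∂μ

/-- The Kantorovich-Rubinstein-Wasserstein distance of order `s` between two measures: the infimum
over all couplings, i.e. measures on the product with the two given marginals (it is `+∞` if there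
is no coupling, that is, if the masses differ). -/
def wassersteinDist {d : ℕ} (s : ℝ) (μ η : Measure (E d)) : ℝ≥0∞ :=
  ⨅ (π : Measure (E d × E d)) (_ : π.map Prod.fst = μ ∧ π.map Prod.snd = η),
    (∫⁻ z, edist z.1 z.2 ^ s ∂π) ^ (1 / s)

/-- The topology induced by a distance function: a set is open iff it contains a ball around each
of its points. -/
abbrev distTopology {X : Type*} (D : X → X → ℝ≥0∞) : TopologicalSpace X where
  IsOpen U := ∀ x ∈ U, ∃ ε : ℝ≥0∞, 0 < ε ∧ ∀ y, D x y < ε → y ∈ U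
  isOpen_univ := fun _ _ => ⟨1, one_pos, fun _ _ => mem_univ _⟩
  isOpen_inter := by
    intro U V hU hV x hx
    obtain ⟨a, ha, ha'⟩ := hU x hx.1
    obtain ⟨b, hb, hb'⟩ := hV x hx.2
    exact ⟨min a b, lt_min ha hb, fun y hy =>
      ⟨ha' y (hy.trans_le (min_le_left _ _)), hb' y (hy.trans_le (min_le_right _ _))⟩⟩
  isOpen_sUnion := by
    intro S hS x hx
    obtain ⟨U, hU, hxU⟩ := hx
    obtain ⟨a, ha, ha'⟩ := hS U hU x hxU
    exact ⟨a, ha, fun y hy => ⟨U, hU, ha' y hy⟩⟩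

/-- On `M_{φ,γ}[σ]` the distance `W_s` is finite, the topology induced by `W_{φ,γ}` is stronger than
the one induced by `W_s`, and sequences converging in `W_{φ,γ}` converge in `W_s`. -/
def WeightedStrongerThanWasserstein {d : ℕ} (p : ℝ) (φ : ℝ → E d → ℝ) (γ σ : Measure (E d))
    (s : ℝ) : Prop :=
  (∀ η ∈ finiteDistClass p φ γ σ, ∀ η' ∈ finiteDistClass p φ γ σ, wassersteinDist s η η' < ⊤) ∧
  distTopology (fun η η' : finiteDistClass p φ γ σ => weightedDist p φ γ η.1 η'.1) ≤
    distTopology (fun η η' : finiteDistClass p φ γ σ => wassersteinDist s η.1 η'.1) ∧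
  ∀ (η : ℕ → Measure (E d)) (η' : Measure (E d)), (∀ k, η k ∈ finiteDistClass p φ γ σ) →
    η' ∈ finiteDistClass p φ γ σ →
    Tendsto (fun k => weightedDist p φ γ (η k) η') atTop (𝓝 0) →
    Tendsto (fun k => wassersteinDist s (η k) η') atTop (𝓝 0)

end

end WeightedTransport

/-!
The moment `m(μₜ) = ∫ J ^ δ dμₜ`, with the smooth weight `J = √(1 + |x|²)` in place of `1 ∨ |x|`,
changes along a solution of the continuity equation at the rate `∫ ⟨∇ J ^ δ, d𝛎ₜ⟩`, which is at
most `C ∫ J ^ (δ - 1) d|𝛎ₜ|`. The whole argument rests on bounding this flux by the action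
(`FluxBound`): `∫ J ^ (δ - 1) d|𝛎| ≤ a Φ(μ, 𝛎 | γ) ^ (1 / p) (∫ J ^ δ dμ + L) ^ (1 - α)`.

Convexity and homogeneity force `φ(ρ, w) ≥ c |w| ^ p (1 + ρ) ^ (1 - p)`, and
`φ(ρ, w) ≥ c |w| ^ p ρ ^ (θ - p)` in the `θ`-homogeneous case
(`IsActionDensity.exists_lower_bound`), with
corresponding bounds for the recession function. Hölder's inequality with the exponents `1 / p`,
`1 - θ / p`, `(θ - 1) / p` turns them into the flux bound, with `α = 1 / p` and `L` a multiple of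
the moment of `γ` in the general case (`fluxBound_general`), and with `α = θ / p`, `L = 0` and `a`
proportional to `m_r(γ) ^ ((θ - 1) / p)` in the homogeneous case (`fluxBound_homogeneous`).

The two cases are then treated together. If `M` is the supremum over time of the moments, plus
`L`, integrating the flux bound gives `M ≤ m(μₛ) + L + C a A ^ (1 / p) M ^ (1 - α)`, where `A` is
the action of the curve, and hence `M ≤ 2 (m(μₛ) + L) + (2 C a A ^ (1 / p)) ^ (1 / α)`
(`SolvesContinuity.smoothMoment_add_le`). To know beforehand that the supremum is finite, the
weight is truncated by a cut-off function that is a high power, so that the flux bound closes on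
the truncated moments. The action enters only through its lower integral in time, which suffices
because the bound on the moments is uniform in time.

For `δ ≥ 1` the same estimate, applied to test functions whose gradient is at most a multiple of
`J ^ (δ - 1)`, shows that the mass is preserved and that integrals of test functions and moments
of order `δ` converge when the action tends to zero (`exists_const_linked`). This implies
convergence in `W_δ` (`tendsto_wassersteinDist`): a smooth partition of unity cuts the measures
into small pieces, equal amounts of mass are matched within each piece, and the small rest is
coupled arbitrarily at a cost bounded by its moments.
-/

namespace WeightedTransport

/-! ### Lower bounds for action densities -/

lemma IsActionDensity.apply_zero {d : ℕ} {p : ℝ} {φ : ℝ → E d → ℝ} (hφ : IsActionDensity p φ)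
    (hp : 1 < p) {ρ : ℝ} (hρ : 0 < ρ) : φ ρ 0 = 0 := by
  have h := hφ.homogeneous ρ hρ 0 0
  rwa [smul_zero, abs_zero, Real.zero_rpow (by linarith), zero_mul] at h

/-- A density can decay in `ρ` at most like `ρ ^ (1 - p)`: the point `(ρ₀, w)` is a convex
combination of `(ρ, w / l)`, with weight `l`, and a point `(e, 0)`, at which `φ` vanishes. -/
lemma IsActionDensity.scaling_le {d : ℕ} {p : ℝ} {φ : ℝ → E d → ℝ} (hφ : IsActionDensity p φ)
    (hp : 1 < p) {ρ₀ ρ : ℝ} (hρ₀ : 0 < ρ₀) (hρ : 0 < ρ) (w : E d) :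
    (ρ₀ / (ρ₀ + ρ)) ^ (p - 1) * φ ρ₀ w ≤ φ ρ w := by
  set l := ρ₀ / (ρ₀ + ρ) with hl
  have hs : 0 < ρ₀ + ρ := by positivity
  have hl0 : 0 < l := by positivity
  have hl1 : 1 - l = ρ / (ρ₀ + ρ) := by rw [hl]; field_simp; ring
  have hl1' : 0 < 1 - l := by rw [hl1]; positivity
  have he : 0 < ρ₀ ^ 2 / ρ := by positivity
  have hc := hφ.convex.2 (x := (ρ, l⁻¹ • w)) (y := (ρ₀ ^ 2 / ρ, (0 : E d)))
    ⟨hρ, mem_univ _⟩ ⟨he, mem_univ _⟩ hl0.le hl1'.le (by ring)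
  have h1 : l * ρ + (1 - l) * (ρ₀ ^ 2 / ρ) = ρ₀ := by
    rw [hl1, hl]; field_simp; ring
  simp only [Prod.smul_mk, Prod.mk_add_mk, smul_eq_mul, smul_zero, add_zero, h1,
    hφ.apply_zero hp he, mul_zero, smul_smul, mul_inv_cancel₀ hl0.ne', one_smul,
    hφ.homogeneous ρ hρ, abs_of_pos (inv_pos.2 hl0)] at hc
  have h2 : l ^ (p - 1) * (l * (l⁻¹ ^ p * φ ρ w)) = φ ρ w := by
    rw [Real.rpow_sub_one hl0.ne', Real.inv_rpow hl0.le]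
    have := (Real.rpow_pos_of_pos hl0 p).ne'
    field_simp
  calc l ^ (p - 1) * φ ρ₀ w ≤ l ^ (p - 1) * (l * (l⁻¹ ^ p * φ ρ w)) := by gcongr
    _ = φ ρ w := h2

lemma IsActionDensity.exists_norm_rpow_le {d : ℕ} {p : ℝ} {φ : ℝ → E d → ℝ}
    (hφ : IsActionDensity p φ) (hp : 1 < p) :
    ∃ ρ₀ c : ℝ, 0 < ρ₀ ∧ 0 < c ∧ ∀ w : E d, c * ‖w‖ ^ p ≤ φ ρ₀ w := by
  obtain ⟨ρ₀, hρ₀, hpos⟩ := hφ.nondegenerate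
  have hcont : Continuous (fun w : E d => φ ρ₀ w) := by
    have h1 := hφ.convex.continuousOn (isOpen_Ioi.prod isOpen_univ)
    exact h1.comp_continuous (f := fun w : E d => (ρ₀, w)) (by fun_prop)
      (fun w => ⟨hρ₀, mem_univ _⟩)
  obtain ⟨c, hc, hcb⟩ := (isCompact_sphere (0 : E d) 1).exists_forall_le' hcont.continuousOn
    (a := 0) (fun w hw => hpos w (by rintro rfl; simp at hw))
  refine ⟨ρ₀, c, hρ₀, hc, fun w => ?_⟩
  by_cases hw : w = 0
  · rw [hw, hφ.apply_zero hp hρ₀, norm_zero, Real.zero_rpow (by linarith), mul_zero]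
  · have hn : 0 < ‖w‖ := norm_pos_iff.2 hw
    have h1 := hcb (‖w‖⁻¹ • w) (by simp [norm_smul, hn.ne'])
    rw [hφ.homogeneous ρ₀ hρ₀, abs_of_pos (inv_pos.2 hn), Real.inv_rpow hn.le] at h1
    have h2 := Real.rpow_pos_of_pos hn p
    calc c * ‖w‖ ^ p ≤ ((‖w‖ ^ p)⁻¹ * φ ρ₀ w) * ‖w‖ ^ p := by gcongr
      _ = φ ρ₀ w := by field_simp

/-- The two power lower bounds for an action density, with a constant that does not depend on the
degree `θ` of joint homogeneity. -/
lemma IsActionDensity.exists_lower_bound {d : ℕ} {p : ℝ} {φ : ℝ → E d → ℝ}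
    (hφ : IsActionDensity p φ) (hp : 1 < p) :
    ∃ c : ℝ, 0 < c ∧ (∀ ρ, 0 < ρ → ∀ w : E d, c * ‖w‖ ^ p * (1 + ρ) ^ (-(p - 1)) ≤ φ ρ w) ∧
      ∀ θ, IsJointlyHomogeneous θ φ → ∀ ρ, 0 < ρ → ∀ w : E d,
        c * ‖w‖ ^ p * ρ ^ (-(p - θ)) ≤ φ ρ w := by
  obtain ⟨ρ₀, c, hρ₀, hc, hb⟩ := hφ.exists_norm_rpow_le hp
  set k := (ρ₀ / (1 + ρ₀)) ^ (p - 1) with hk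
  have hk0 : 0 < k := by positivity
  have hG : ∀ ρ, 0 < ρ → ∀ w : E d, k * c * ‖w‖ ^ p * (1 + ρ) ^ (-(p - 1)) ≤ φ ρ w := by
    intro ρ hρ w
    have h1 : ρ₀ / (1 + ρ₀) * (1 + ρ)⁻¹ ≤ ρ₀ / (ρ₀ + ρ) := by
      rw [← div_eq_mul_inv, div_div]
      gcongr
      nlinarith
    have h2 : k * (1 + ρ) ^ (-(p - 1)) ≤ (ρ₀ / (ρ₀ + ρ)) ^ (p - 1) := by
      rw [hk, Real.rpow_neg (by positivity), ← Real.inv_rpow (by positivity),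
        ← Real.mul_rpow (by positivity) (by positivity)]
      exact Real.rpow_le_rpow (by positivity) h1 (by linarith)
    calc k * c * ‖w‖ ^ p * (1 + ρ) ^ (-(p - 1))
        = (k * (1 + ρ) ^ (-(p - 1))) * (c * ‖w‖ ^ p) := by ring
      _ ≤ (ρ₀ / (ρ₀ + ρ)) ^ (p - 1) * φ ρ₀ w := by
          gcongr
          exact hb w
      _ ≤ φ ρ w := hφ.scaling_le hp hρ₀ hρ w
  set m : ℝ := (1 + 1) ^ (-(p - 1)) with hm
  have hm0 : 0 < m := by positivity
  have hm1 : m ≤ 1 := Real.rpow_le_one_of_one_le_of_nonpos (by norm_num) (by linarith)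
  refine ⟨m * (k * c), by positivity, fun ρ hρ w => le_trans ?_ (hG ρ hρ w),
    fun θ hθ ρ hρ w => ?_⟩
  · have h1 : m * (k * c) ≤ k * c := mul_le_of_le_one_left (by positivity) hm1
    gcongr
  · have h1 := hθ ρ 1 hρ one_pos (ρ⁻¹ • w)
    rw [mul_one, smul_smul, mul_inv_cancel₀ hρ.ne', one_smul] at h1
    have h2 := hG 1 one_pos (ρ⁻¹ • w)
    rw [norm_smul, Real.norm_of_nonneg (inv_pos.2 hρ).le, Real.mul_rpow (by positivity)
      (by positivity), Real.inv_rpow hρ.le] at h2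
    have h3 : ρ ^ (-(p - θ)) = ρ ^ θ * (ρ ^ p)⁻¹ := by
      rw [neg_sub, Real.rpow_sub hρ, div_eq_mul_inv]
    rw [h1, h3]
    calc m * (k * c) * ‖w‖ ^ p * (ρ ^ θ * (ρ ^ p)⁻¹)
        = ρ ^ θ * (k * c * ((ρ ^ p)⁻¹ * ‖w‖ ^ p) * m) := by ring
      _ ≤ _ := by gcongr

/-- A power bound for `φ` passes to the extension to `ρ = 0`, where both sides may be `∞`. -/
lemma le_extDensity {d : ℕ} {p c e b : ℝ} {φ : ℝ → E d → ℝ} (hp : 0 ≤ p) (hc : 0 ≤ c) (hb : 0 ≤ b)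
    (h : ∀ ρ, 0 < ρ → ∀ w : E d, c * ‖w‖ ^ p * (b + ρ) ^ e ≤ φ ρ w) {ρ : ℝ} (hρ : 0 ≤ ρ)
    (w : E d) :
    ENNReal.ofReal c * ‖w‖ₑ ^ p * (ENNReal.ofReal (b + ρ)) ^ e ≤ extDensity φ ρ w := by
  have key : ∀ s, 0 < s → ENNReal.ofReal c * ‖w‖ₑ ^ p * (ENNReal.ofReal (b + s)) ^ e ≤
      ENNReal.ofReal (φ s w) := by
    intro s hs
    rw [← ofReal_norm, ENNReal.ofReal_rpow_of_nonneg (norm_nonneg _) hp,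
      ENNReal.ofReal_rpow_of_pos (by positivity), ← ENNReal.ofReal_mul hc,
      ← ENNReal.ofReal_mul (by positivity)]
    exact ENNReal.ofReal_le_ofReal (h s hs w)
  unfold extDensity
  split_ifs with h1 h2
  · exact key ρ h1
  · subst h2
    have hne : ENNReal.ofReal c * ‖w‖ₑ ^ p ≠ ⊤ :=
      ENNReal.mul_ne_top ENNReal.ofReal_ne_top
        (ENNReal.rpow_ne_top_of_nonneg hp enorm_ne_top)
    have hlim : Tendsto (fun s : ℝ => ENNReal.ofReal c * ‖w‖ₑ ^ p * (ENNReal.ofReal (b + s)) ^ e)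
        (𝓝[>] 0) (𝓝 (ENNReal.ofReal c * ‖w‖ₑ ^ p * (ENNReal.ofReal (b + 0)) ^ e)) := by
      refine ENNReal.Tendsto.const_mul ?_ (Or.inr hne)
      have h3 : Continuous (fun s : ℝ => (ENNReal.ofReal (b + s)) ^ e) :=
        ENNReal.continuous_rpow_const.comp (ENNReal.continuous_ofReal.comp (by fun_prop))
      exact (h3.tendsto 0).mono_left nhdsWithin_le_nhds
    refine le_of_tendsto hlim ?_
    filter_upwards [self_mem_nhdsWithin] with s hs
    exact (key s hs).trans (le_iSup₂_of_le s hs le_rfl)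
  · exact le_top

lemma le_recession {d : ℕ} {p c : ℝ} {φ : ℝ → E d → ℝ} (hp : 0 ≤ p) (hc : 0 ≤ c)
    (h : ∀ ρ, 0 < ρ → ∀ w : E d, c * ‖w‖ ^ p * (1 + ρ) ^ (-(p - 1)) ≤ φ ρ w) {ρ : ℝ} (hρ : 0 ≤ ρ)
    (w : E d) :
    ENNReal.ofReal c * ‖w‖ₑ ^ p * (ENNReal.ofReal ρ) ^ (-(p - 1)) ≤ recession φ ρ w := by
  have hne : ENNReal.ofReal c * ‖w‖ₑ ^ p ≠ ⊤ :=
    ENNReal.mul_ne_top ENNReal.ofReal_ne_top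
      (ENNReal.rpow_ne_top_of_nonneg hp enorm_ne_top)
  have hlim : Tendsto (fun s : ℝ => ENNReal.ofReal c * ‖w‖ₑ ^ p *
      (ENNReal.ofReal (s⁻¹ + ρ)) ^ (-(p - 1))) atTop
      (𝓝 (ENNReal.ofReal c * ‖w‖ₑ ^ p * (ENNReal.ofReal (0 + ρ)) ^ (-(p - 1)))) := by
    refine ENNReal.Tendsto.const_mul ?_ (Or.inr hne)
    have h3 : Continuous (fun s : ℝ => (ENNReal.ofReal (s + ρ)) ^ (-(p - 1))) :=
      ENNReal.continuous_rpow_const.comp (ENNReal.continuous_ofReal.comp (by fun_prop))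
    exact (h3.tendsto 0).comp tendsto_inv_atTop_zero
  rw [zero_add] at hlim
  refine le_of_tendsto hlim ?_
  filter_upwards [eventually_gt_atTop 0] with s hs
  refine le_trans ?_ (le_iSup₂_of_le s hs le_rfl)
  refine le_trans (le_of_eq ?_)
    (mul_le_mul_right (le_extDensity hp hc zero_le_one h (mul_nonneg hs.le hρ) (s • w)) _)
  have h1 : 0 < s⁻¹ + ρ := by positivity
  have h2 : 0 < 1 + s * ρ := by positivity
  rw [← ofReal_norm, ← ofReal_norm,
    ENNReal.ofReal_rpow_of_nonneg (norm_nonneg _) hp,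
    ENNReal.ofReal_rpow_of_nonneg (norm_nonneg _) hp, ENNReal.ofReal_rpow_of_pos h1,
    ENNReal.ofReal_rpow_of_pos h2, ← ENNReal.ofReal_mul hc, ← ENNReal.ofReal_mul hc,
    ← ENNReal.ofReal_mul (by positivity), ← ENNReal.ofReal_mul (by positivity),
    ← ENNReal.ofReal_mul (by positivity)]
  congr 1
  have h3 : 1 + s * ρ = s * (s⁻¹ + ρ) := by field_simp
  rw [h3, norm_smul, Real.norm_of_nonneg hs.le, Real.mul_rpow hs.le (norm_nonneg _),
    Real.mul_rpow hs.le h1.le, Real.rpow_neg hs.le, Real.rpow_sub_one hs.ne']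
  have := (Real.rpow_pos_of_pos hs p).ne'
  field_simp

/-- For a degree of homogeneity `θ > 1` the recession function is infinite off `w = 0`, so the
singular part of the flux has to vanish. -/
lemma top_le_recession {d : ℕ} {p c θ : ℝ} {φ : ℝ → E d → ℝ} (hp : 0 ≤ p) (hc : 0 < c)
    (hθ : 1 < θ) (hθp : θ ≤ p)
    (h : ∀ ρ, 0 < ρ → ∀ w : E d, c * ‖w‖ ^ p * ρ ^ (-(p - θ)) ≤ φ ρ w)
    {ρ : ℝ} (hρ : 0 ≤ ρ) (w : E d) : ⊤ * ‖w‖ₑ ≤ recession φ ρ w := by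
  rcases eq_or_ne w 0 with rfl | hw
  · simp
  have hw0 : ‖w‖ₑ ≠ 0 := by simpa using hw
  rw [ENNReal.top_mul hw0, top_le_iff]
  have hb : ENNReal.ofReal c * ‖w‖ₑ ^ p * ENNReal.ofReal ρ ^ (-(p - θ)) ≠ 0 := by
    refine mul_ne_zero (mul_ne_zero (by simpa using hc) ?_) ?_
    · simp [ENNReal.rpow_eq_zero_iff, hw, enorm_ne_top]
    · rw [Ne, ENNReal.rpow_eq_zero_iff]
      rintro (⟨_, h2⟩ | ⟨h1, _⟩)
      · linarith
      · exact ENNReal.ofReal_ne_top h1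
  have hlim : Tendsto (fun s : ℝ => ENNReal.ofReal c * ‖w‖ₑ ^ p * ENNReal.ofReal ρ ^ (-(p - θ)) *
      ENNReal.ofReal (s ^ (θ - 1))) atTop
      (𝓝 (ENNReal.ofReal c * ‖w‖ₑ ^ p * ENNReal.ofReal ρ ^ (-(p - θ)) * ⊤)) :=
    ENNReal.Tendsto.const_mul (ENNReal.tendsto_ofReal_atTop.comp
      (tendsto_rpow_atTop (by linarith))) (Or.inl ENNReal.top_ne_zero)
  rw [ENNReal.mul_top hb] at hlim
  rw [← top_le_iff]
  refine le_of_tendsto hlim ?_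
  filter_upwards [eventually_gt_atTop 0] with s hs
  refine le_trans ?_ (le_iSup₂_of_le s hs le_rfl)
  refine le_trans (le_of_eq ?_) (mul_le_mul_right (le_extDensity (b := 0) hp hc.le le_rfl
    (by simpa using h) (mul_nonneg hs.le hρ) (s • w)) _)
  have h1 : ENNReal.ofReal (s ^ (θ - 1)) =
      ENNReal.ofReal s⁻¹ * ENNReal.ofReal s ^ p * ENNReal.ofReal s ^ (-(p - θ)) := by
    rw [ENNReal.ofReal_rpow_of_pos hs, ENNReal.ofReal_rpow_of_pos hs,
      ← ENNReal.ofReal_mul (by positivity), ← ENNReal.ofReal_mul (by positivity),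
      ← Real.rpow_neg_one s, ← Real.rpow_add hs, ← Real.rpow_add hs]
    congr 2
    ring
  rw [h1, zero_add, ENNReal.ofReal_mul hs.le, ENNReal.mul_rpow_of_ne_top ENNReal.ofReal_ne_top
    ENNReal.ofReal_ne_top, enorm_smul, Real.enorm_of_nonneg hs.le,
    ENNReal.mul_rpow_of_nonneg _ _ hp]
  simp only [neg_sub]
  ring

/-! ### The flux bound -/

/-- Hölder's inequality in the form that fits a density bounded below by
`c |w| ^ p ρ ^ (-(p - θ))`. The three exponents are `1 / p`, `1 - θ / p` and `(θ - 1) / p`. -/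
lemma lintegral_flux_le {X : Type*} [MeasurableSpace X] {m : Measure X} {h k l ρ w F : X → ℝ≥0∞}
    {p θ c : ℝ} (hp : 1 < p) (hθ : 1 ≤ θ) (hθp : θ ≤ p) (hc : 0 < c) (hk : Measurable k)
    (hl : Measurable l) (hρ : Measurable ρ) (hw : Measurable w)
    (hF : ∀ᵐ x ∂m, ENNReal.ofReal c * w x ^ p * (ρ x) ^ (-(p - θ)) ≤ F x)
    (hfin : ∫⁻ x, F x ∂m ≠ ⊤) (hρt : ∀ᵐ x ∂m, ρ x < ⊤) (hwt : ∀ᵐ x ∂m, w x < ⊤)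
    (hh : ∀ x, h x ≤ k x ^ (1 - θ / p) * l x ^ ((θ - 1) / p)) :
    ∫⁻ x, h x * w x ∂m ≤ ENNReal.ofReal (c ^ (-(1 / p))) * ((∫⁻ x, F x ∂m) ^ (1 / p) *
      (∫⁻ x, k x * ρ x ∂m) ^ (1 - θ / p) * (∫⁻ x, l x ∂m) ^ ((θ - 1) / p)) := by
  have hp0 : 0 < p := by linarith
  have e1 : 0 ≤ 1 / p := by positivity
  have e2 : 0 ≤ 1 - θ / p := by rw [sub_nonneg, div_le_one hp0]; exact hθp
  have e3 : 0 ≤ (θ - 1) / p := div_nonneg (by linarith) hp0.le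
  set G : X → ℝ≥0∞ := fun x => ENNReal.ofReal c * w x ^ p * (ρ x) ^ (-(p - θ)) with hG
  have hGm : Measurable G := ((hw.pow_const p).const_mul _).mul (hρ.pow_const _)
  have hGF : ∫⁻ x, G x ∂m ≤ ∫⁻ x, F x ∂m := lintegral_mono_ae hF
  have hGt : ∀ᵐ x ∂m, G x < ⊤ := ae_lt_top hGm (ne_top_of_le_ne_top hfin hGF)
  have hpt : ∀ᵐ x ∂m, h x * w x ≤ ENNReal.ofReal (c ^ (-(1 / p))) *
      (G x ^ (1 / p) * (k x * ρ x) ^ (1 - θ / p) * l x ^ ((θ - 1) / p)) := by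
    filter_upwards [hGt, hρt, hwt] with x h1 h2 h3
    have hw' : w x ≤ ENNReal.ofReal (c ^ (-(1 / p))) * (G x ^ (1 / p) * (ρ x) ^ (1 - θ / p)) := by
      rcases eq_or_ne (w x) 0 with h0 | h0
      · simp [h0]
      have hc' : ENNReal.ofReal (c ^ (-(1 / p))) * ENNReal.ofReal c ^ (1 / p) = 1 := by
        rw [ENNReal.ofReal_rpow_of_pos hc, ← ENNReal.ofReal_mul (by positivity),
          ← Real.rpow_add hc]
        simp
      have hρ' : (ρ x ^ (-(p - θ))) ^ (1 / p) * ρ x ^ (1 - θ / p) = 1 := by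
        rw [← ENNReal.rpow_mul]
        have he : -(p - θ) * (1 / p) = -(1 - θ / p) := by field_simp
        rw [he]
        rcases eq_or_ne (ρ x) 0 with h4 | h4
        · -- here finiteness of the density leaves only the exponent `θ = p`
          rcases e2.eq_or_lt with h5 | h5
          · rw [← h5]; simp
          · exfalso
            have h6 : 0 < p - θ := by
              rw [sub_pos, div_lt_one hp0] at h5
              linarith
            refine h1.ne ?_
            simp only [hG]
            rw [h4, ENNReal.zero_rpow_of_neg (by linarith), ENNReal.mul_top]
            refine mul_ne_zero (by simpa using hc) ?_
            simp [ENNReal.rpow_eq_zero_iff, h0, h3.ne]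
        · rw [← ENNReal.rpow_add _ _ h4 h2.ne]
          simp
      refine le_of_eq ?_
      simp only [hG]
      rw [ENNReal.mul_rpow_of_nonneg _ _ e1, ENNReal.mul_rpow_of_nonneg _ _ e1,
        ← ENNReal.rpow_mul (w x), mul_one_div_cancel hp0.ne', ENNReal.rpow_one]
      calc w x = 1 * w x * 1 := by simp
        _ = (ENNReal.ofReal (c ^ (-(1 / p))) * ENNReal.ofReal c ^ (1 / p)) * w x *
            ((ρ x ^ (-(p - θ))) ^ (1 / p) * ρ x ^ (1 - θ / p)) := by rw [hc', hρ']
        _ = _ := by ring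
    rw [ENNReal.mul_rpow_of_nonneg _ _ e2]
    calc h x * w x ≤ (k x ^ (1 - θ / p) * l x ^ ((θ - 1) / p)) *
          (ENNReal.ofReal (c ^ (-(1 / p))) * (G x ^ (1 / p) * (ρ x) ^ (1 - θ / p))) :=
          mul_le_mul' (hh x) hw'
      _ = _ := by ring
  have hH := ENNReal.lintegral_prod_norm_pow_le (μ := m) (Finset.univ : Finset (Fin 3))
    (f := ![G, fun x => k x * ρ x, l]) (p := ![1 / p, 1 - θ / p, (θ - 1) / p])
    (by
      intro i _
      fin_cases i
      · exact hGm.aemeasurable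
      · exact (hk.mul hρ).aemeasurable
      · exact hl.aemeasurable)
    (by simp [Fin.sum_univ_three]; field_simp; ring)
    (by
      intro i _
      fin_cases i
      · exact e1
      · exact e2
      · exact e3)
  simp only [Fin.prod_univ_three, Matrix.cons_val_zero, Matrix.cons_val_one,
    Matrix.cons_val] at hH
  calc ∫⁻ x, h x * w x ∂m ≤ ∫⁻ x, ENNReal.ofReal (c ^ (-(1 / p))) *
      (G x ^ (1 / p) * (k x * ρ x) ^ (1 - θ / p) * l x ^ ((θ - 1) / p)) ∂m := lintegral_mono_ae hpt
    _ = ENNReal.ofReal (c ^ (-(1 / p))) *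
      ∫⁻ x, (G x ^ (1 / p) * (k x * ρ x) ^ (1 - θ / p) * l x ^ ((θ - 1) / p)) ∂m :=
        lintegral_const_mul' _ _ ENNReal.ofReal_ne_top
    _ ≤ ENNReal.ofReal (c ^ (-(1 / p))) * ((∫⁻ x, G x ∂m) ^ (1 / p) *
      (∫⁻ x, k x * ρ x ∂m) ^ (1 - θ / p) * (∫⁻ x, l x ∂m) ^ ((θ - 1) / p)) := by gcongr
    _ ≤ _ := by gcongr

/-- An integral against a measure splits along its Lebesgue decomposition, the singular part being
written through its density with respect to a dominating measure. -/
lemma lintegral_eq_rnDeriv_add {d : ℕ} (μ γ σ : Measure (E d)) [SigmaFinite μ] [SigmaFinite γ]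
    [SigmaFinite σ] (hσ : μ.singularPart γ ≤ σ) {h : E d → ℝ≥0∞} (hh : Measurable h) :
    ∫⁻ x, h x ∂μ = (∫⁻ x, h x * μ.rnDeriv γ x ∂γ) +
      ∫⁻ x, h x * (μ.singularPart γ).rnDeriv σ x ∂σ := by
  have h1 : ∫⁻ x, h x ∂(γ.withDensity (μ.rnDeriv γ)) = ∫⁻ x, h x * μ.rnDeriv γ x ∂γ := by
    rw [lintegral_withDensity_eq_lintegral_mul _ (Measure.measurable_rnDeriv _ _) hh]
    simp [mul_comm]
  have h2 : ∫⁻ x, h x ∂(μ.singularPart γ) =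
      ∫⁻ x, h x * (μ.singularPart γ).rnDeriv σ x ∂σ := by
    conv_lhs => rw [← Measure.withDensity_rnDeriv_eq _ _ (Measure.absolutelyContinuous_of_le hσ)]
    rw [lintegral_withDensity_eq_lintegral_mul _ (Measure.measurable_rnDeriv _ _) hh]
    simp [mul_comm]
  conv_lhs => rw [← Measure.singularPart_add_rnDeriv μ γ]
  rw [lintegral_add_measure, h1, h2, add_comm]

/-- Since `|direction| = 1` almost everywhere, the norm of the density of `𝛎` is the density of its
variation. -/
lemma VectorRadonMeasure.enorm_density {d : ℕ} (n : VectorRadonMeasure d) (κ m : Measure (E d))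
    [SigmaFinite m] [SigmaFinite κ] (hκ : κ ≪ n.variation) :
    ∀ᵐ x ∂m, ‖(κ.rnDeriv m x).toReal • n.direction x‖ₑ = κ.rnDeriv m x := by
  have h1 : ∀ᵐ x ∂(m.withDensity (κ.rnDeriv m)), ‖n.direction x‖ = 1 :=
    ((Measure.withDensity_rnDeriv_le κ m).absolutelyContinuous.trans hκ).ae_le n.norm_direction
  rw [ae_withDensity_iff (Measure.measurable_rnDeriv _ _)] at h1
  filter_upwards [h1, Measure.rnDeriv_lt_top κ m] with x h2 h3
  by_cases h0 : κ.rnDeriv m x = 0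
  · simp [h0]
  · rw [enorm_smul, ← ofReal_norm (n.direction x), h2 h0,
      Real.enorm_of_nonneg ENNReal.toReal_nonneg, ENNReal.ofReal_toReal h3.ne]
    simp

/-- The flux bound, for densities `c |w| ^ p (b + ρ) ^ (-(p - θ))` on the absolutely continuous part
and, on the singular part, either `c |w| ^ p ρ ^ (-(p - 1))` with `θ = 1`, or `∞`. -/
lemma lintegral_variation_le {d : ℕ} {p c θ b : ℝ} {φ : ℝ → E d → ℝ} (hp : 1 < p) (hc : 0 < c)
    (hθ : 1 ≤ θ) (hθp : θ ≤ p) (hb : 0 ≤ b)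
    (hext : ∀ ρ, 0 ≤ ρ → ∀ w : E d,
      ENNReal.ofReal c * ‖w‖ₑ ^ p * (ENNReal.ofReal (b + ρ)) ^ (-(p - θ)) ≤ extDensity φ ρ w)
    (hrec : ∀ ρ, 0 ≤ ρ → ∀ w : E d, (θ = 1 ∧
      ENNReal.ofReal c * ‖w‖ₑ ^ p * (ENNReal.ofReal ρ) ^ (-(p - θ)) ≤ recession φ ρ w) ∨
      ⊤ * ‖w‖ₑ ≤ recession φ ρ w)
    {μ γ : Measure (E d)} {n : VectorRadonMeasure d}
    [IsLocallyFiniteMeasure μ] [IsLocallyFiniteMeasure γ] (hA : action φ μ n γ ≠ ⊤)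
    {h k l : E d → ℝ≥0∞} (hhm : Measurable h) (hk : Measurable k) (hl : Measurable l)
    (hh : ∀ x, h x ≤ k x ^ (1 - θ / p) * l x ^ ((θ - 1) / p)) :
    ∫⁻ x, h x ∂n.variation ≤ ENNReal.ofReal (2 * c ^ (-(1 / p))) * ((action φ μ n γ) ^ (1 / p) *
      (∫⁻ x, k x ∂μ + ENNReal.ofReal b * ∫⁻ x, k x ∂γ) ^ (1 - θ / p) *
      (∫⁻ x, l x ∂γ) ^ ((θ - 1) / p)) := by
  have hp0 : 0 < p := by linarith
  have e1 : 0 ≤ 1 / p := by positivity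
  have e2 : 0 ≤ 1 - θ / p := by rw [sub_nonneg, div_le_one hp0]; exact hθp
  have := n.locallyFinite
  set A := action φ μ n γ with hAd
  unfold action at hAd
  split_ifs at hAd with hs
  swap
  · exact absurd hAd hA
  simp only at hAd
  set μs := μ.singularPart γ with hμs
  set ns := n.variation.singularPart γ with hns
  set σ := μs + ns with hσ
  set F1 := ∫⁻ x, extDensity φ (μ.rnDeriv γ x).toReal
    ((n.variation.rnDeriv γ x).toReal • n.direction x) ∂γ with hF1
  set F2 := ∫⁻ x, recession φ (μs.rnDeriv σ x).toReal
    ((ns.rnDeriv σ x).toReal • n.direction x) ∂σ with hF2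
  have hF1t : F1 ≠ ⊤ := fun h => hA (by rw [hAd, h, top_add])
  have hF2t : F2 ≠ ⊤ := fun h => hA (by rw [hAd, h, add_top])
  have hF1A : F1 ≤ A := by rw [hAd]; exact le_self_add
  have hF2A : F2 ≤ A := by rw [hAd]; exact le_add_self
  have hnsσ : ns ≤ σ := by rw [hσ]; exact Measure.le_add_left le_rfl
  have hμsσ : μs ≤ σ := by rw [hσ]; exact Measure.le_add_right le_rfl
  have : SigmaFinite σ := by rw [hσ]; infer_instance
  have hsplit := lintegral_eq_rnDeriv_add n.variation γ σ hnsσ hhm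
  have hsplitμ := lintegral_eq_rnDeriv_add μ γ σ hμsσ hk
  rw [← hμs] at hsplitμ
  rw [← hns] at hsplit
  set I := ∫⁻ x, k x ∂μ with hI
  set Y := I + ENNReal.ofReal b * ∫⁻ x, k x ∂γ with hY
  -- the absolutely continuous part
  have hac : ∫⁻ x, h x * n.variation.rnDeriv γ x ∂γ ≤ ENNReal.ofReal (c ^ (-(1 / p))) *
      (A ^ (1 / p) * Y ^ (1 - θ / p) * (∫⁻ x, l x ∂γ) ^ ((θ - 1) / p)) := by
    have hle := lintegral_flux_le (m := γ) (h := h) (k := k) (l := l)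
      (ρ := fun x => ENNReal.ofReal b + μ.rnDeriv γ x) (w := n.variation.rnDeriv γ)
      (F := fun x => extDensity φ (μ.rnDeriv γ x).toReal
        ((n.variation.rnDeriv γ x).toReal • n.direction x)) hp hθ hθp hc hk hl
      ((Measure.measurable_rnDeriv _ _).const_add _) (Measure.measurable_rnDeriv _ _)
      (by
        filter_upwards [n.enorm_density n.variation γ Measure.AbsolutelyContinuous.rfl,
          Measure.rnDeriv_lt_top μ γ] with x h1 h2
        have h3 := hext (μ.rnDeriv γ x).toReal ENNReal.toReal_nonneg
          ((n.variation.rnDeriv γ x).toReal • n.direction x)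
        rwa [h1, ENNReal.ofReal_add hb ENNReal.toReal_nonneg, ENNReal.ofReal_toReal h2.ne] at h3)
      hF1t
      (by
        filter_upwards [Measure.rnDeriv_lt_top μ γ] with x h2
        exact ENNReal.add_lt_top.2 ⟨ENNReal.ofReal_lt_top, h2⟩)
      (Measure.rnDeriv_lt_top _ _) hh
    refine hle.trans ?_
    have h4 : ∫⁻ x, k x * (ENNReal.ofReal b + μ.rnDeriv γ x) ∂γ ≤ Y := by
      simp only [mul_add]
      rw [lintegral_add_left (hk.mul_const _), lintegral_mul_const _ hk, hY, hsplitμ, mul_comm,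
        add_comm]
      gcongr
      exact le_self_add
    gcongr
  have hsing : ∫⁻ x, h x * ns.rnDeriv σ x ∂σ ≤ ENNReal.ofReal (c ^ (-(1 / p))) *
      (A ^ (1 / p) * Y ^ (1 - θ / p) * (∫⁻ x, l x ∂γ) ^ ((θ - 1) / p)) := by
    have hen := n.enorm_density ns σ ((Measure.singularPart_le _ _).absolutelyContinuous)
    by_cases hθ1 : θ = 1
    · have hrec' : ∀ ρ, 0 ≤ ρ → ∀ w : E d,
          ENNReal.ofReal c * ‖w‖ₑ ^ p * (ENNReal.ofReal ρ) ^ (-(p - θ)) ≤ recession φ ρ w := by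
        intro ρ hρ w
        rcases hrec ρ hρ w with h1 | h1
        · exact h1.2
        · rcases eq_or_ne w 0 with rfl | hw
          · simp [ENNReal.zero_rpow_of_pos hp0]
          · rw [ENNReal.top_mul (by simpa using hw)] at h1
            exact le_top.trans h1
      have hle := lintegral_flux_le (m := σ) (h := h) (k := k) (l := fun _ => 0)
        (ρ := μs.rnDeriv σ) (w := ns.rnDeriv σ)
        (F := fun x => recession φ (μs.rnDeriv σ x).toReal
          ((ns.rnDeriv σ x).toReal • n.direction x)) hp hθ hθp hc hk measurable_const
        (Measure.measurable_rnDeriv _ _) (Measure.measurable_rnDeriv _ _)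
        (by
          filter_upwards [hen, Measure.rnDeriv_lt_top μs σ] with x h1 h2
          have h3 := hrec' (μs.rnDeriv σ x).toReal ENNReal.toReal_nonneg
            ((ns.rnDeriv σ x).toReal • n.direction x)
          rwa [h1, ENNReal.ofReal_toReal h2.ne] at h3)
        hF2t (Measure.rnDeriv_lt_top _ _) (Measure.rnDeriv_lt_top _ _)
        (by intro x; simpa [hθ1] using hh x)
      refine hle.trans ?_
      have h4 : ∫⁻ x, k x * μs.rnDeriv σ x ∂σ ≤ Y := by
        rw [hY, hsplitμ]
        exact le_add_self.trans le_self_add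
      simp only [hθ1, sub_self, zero_div, ENNReal.rpow_zero]
      rw [hθ1] at e2
      gcongr
    · have h0 : ∫⁻ x, ⊤ * ns.rnDeriv σ x ∂σ ≠ ⊤ := by
        refine ne_top_of_le_ne_top hF2t (lintegral_mono_ae ?_)
        filter_upwards [hen] with x h1
        rcases hrec (μs.rnDeriv σ x).toReal ENNReal.toReal_nonneg
          ((ns.rnDeriv σ x).toReal • n.direction x) with h2 | h2
        · exact absurd h2.1 hθ1
        · rwa [h1] at h2
      have h1 := ae_lt_top ((Measure.measurable_rnDeriv ns σ).const_mul ⊤) h0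
      have h2 : ∫⁻ x, h x * ns.rnDeriv σ x ∂σ = 0 := by
        refine (lintegral_congr_ae (g := 0) ?_).trans lintegral_zero
        filter_upwards [h1] with x hx
        have : ns.rnDeriv σ x = 0 := by
          by_contra hne
          simp [ENNReal.top_mul hne] at hx
        simp [this]
      rw [h2]
      exact zero_le
  rw [hsplit, ENNReal.ofReal_mul zero_le_two, ENNReal.ofReal_ofNat, mul_assoc, two_mul]
  exact add_le_add hac hsing

/-! ### The flux bound with a polynomial weight -/

/-- The smooth weight `J(x) = √(1 + |x|²)`, comparable to `1 ∨ |x|`. -/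
noncomputable def japanese {d : ℕ} (x : E d) : ℝ := √(1 + ‖x‖ ^ 2)

section japanese
variable {d : ℕ} (x : E d)

lemma one_le_japanese : 1 ≤ japanese x := by
  unfold japanese
  rw [Real.one_le_sqrt]
  nlinarith [sq_nonneg ‖x‖]

lemma japanese_pos : 0 < japanese x := zero_lt_one.trans_le (one_le_japanese x)

lemma japanese_sq : japanese x ^ 2 = 1 + ‖x‖ ^ 2 := Real.sq_sqrt (by positivity)

lemma norm_le_japanese : ‖x‖ ≤ japanese x := by
  unfold japanese
  exact Real.le_sqrt_of_sq_le (by linarith)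

lemma max_le_japanese : max 1 ‖x‖ ≤ japanese x := max_le (one_le_japanese x) (norm_le_japanese x)

lemma japanese_le_max : japanese x ≤ 2 * max 1 ‖x‖ := by
  unfold japanese
  rw [Real.sqrt_le_left (by positivity)]
  have h1 := le_max_left 1 ‖x‖
  have h2 := le_max_right 1 ‖x‖
  nlinarith [norm_nonneg x]

lemma continuous_japanese : Continuous (japanese (d := d)) := by
  unfold japanese
  fun_prop

lemma japanese_rpow_eq (s : ℝ) : japanese x ^ s = (1 + ‖x‖ ^ 2) ^ (s / 2) := by
  rw [← japanese_sq, ← Real.rpow_natCast, ← Real.rpow_mul (japanese_pos x).le]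
  congr 1
  push_cast
  ring

lemma continuous_japanese_rpow (s : ℝ) : Continuous (fun x : E d => japanese x ^ s) :=
  continuous_japanese.rpow_const (fun x => Or.inl (japanese_pos x).ne')

lemma japanese_rpow_le (s : ℝ) : japanese x ^ s ≤ 2 ^ |s| * (max 1 ‖x‖) ^ s := by
  have hN : 0 < max 1 ‖x‖ := lt_max_of_lt_left one_pos
  rcases le_total 0 s with hs | hs
  · rw [abs_of_nonneg hs, ← Real.mul_rpow zero_le_two hN.le]
    exact Real.rpow_le_rpow (japanese_pos x).le (japanese_le_max x) hs
  · refine (Real.rpow_le_rpow_of_nonpos hN (max_le_japanese x) hs).trans ?_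
    exact le_mul_of_one_le_left (by positivity)
      (Real.one_le_rpow one_le_two (abs_nonneg s))

lemma max_rpow_le (s : ℝ) : (max 1 ‖x‖) ^ s ≤ 2 ^ |s| * japanese x ^ s := by
  have hN : 0 < max 1 ‖x‖ := lt_max_of_lt_left one_pos
  have hJ := japanese_pos x
  rcases le_total 0 s with hs | hs
  · refine (Real.rpow_le_rpow hN.le (max_le_japanese x) hs).trans ?_
    exact le_mul_of_one_le_left (by positivity)
      (Real.one_le_rpow one_le_two (abs_nonneg s))
  · have h1 : japanese x / 2 ≤ max 1 ‖x‖ := by linarith [japanese_le_max x]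
    refine (Real.rpow_le_rpow_of_nonpos (by positivity) h1 hs).trans (le_of_eq ?_)
    rw [Real.div_rpow hJ.le zero_le_two, abs_of_nonpos hs, Real.rpow_neg zero_le_two]
    field_simp

end japanese

/-- The moment `∫ J ^ s dμ` with the smooth weight. -/
noncomputable def smoothMoment {d : ℕ} (s : ℝ) (μ : Measure (E d)) : ℝ≥0∞ :=
  ∫⁻ x, ENNReal.ofReal (japanese x ^ s) ∂μ

lemma smoothMoment_le {d : ℕ} (s : ℝ) (μ : Measure (E d)) :
    smoothMoment s μ ≤ ENNReal.ofReal (2 ^ |s|) * moment s μ := by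
  unfold smoothMoment moment
  rw [← lintegral_const_mul' _ _ ENNReal.ofReal_ne_top]
  refine lintegral_mono fun x => ?_
  rw [← ENNReal.ofReal_mul (by positivity)]
  exact ENNReal.ofReal_le_ofReal (japanese_rpow_le x s)

lemma moment_le_smoothMoment {d : ℕ} (s : ℝ) (μ : Measure (E d)) :
    moment s μ ≤ ENNReal.ofReal (2 ^ |s|) * smoothMoment s μ := by
  unfold smoothMoment moment
  rw [← lintegral_const_mul' _ _ ENNReal.ofReal_ne_top]
  refine lintegral_mono fun x => ?_
  rw [← ENNReal.ofReal_mul (by positivity)]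
  exact ENNReal.ofReal_le_ofReal (max_rpow_le x s)

lemma moment_mono {d : ℕ} {s r : ℝ} (hsr : s ≤ r) (μ : Measure (E d)) :
    moment s μ ≤ moment r μ :=
  lintegral_mono fun _ => ENNReal.ofReal_le_ofReal
    (Real.rpow_le_rpow_of_exponent_le (le_max_left _ _) hsr)

/-- The flux bound `∫ J ^ (δ - 1) u ^ (1 - α) d|𝛎| ≤
a Φ(μ, 𝛎 | γ) ^ (1 / p) (∫ J ^ δ u dμ + L) ^ (1 - α)` for all cut-off
functions `0 ≤ u ≤ 1`. The two cases of the moment estimates only differ in the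
values of `α`, `a` and `L`. -/
def FluxBound {d : ℕ} (p : ℝ) (φ : ℝ → E d → ℝ) (γ : Measure (E d)) (δ α a : ℝ) (L : ℝ≥0∞) :
    Prop :=
  ∀ (μ : Measure (E d)) (n : VectorRadonMeasure d), IsLocallyFiniteMeasure μ →
    action φ μ n γ ≠ ⊤ → ∀ u : E d → ℝ, Measurable u → (∀ x, 0 ≤ u x) → (∀ x, u x ≤ 1) →
    ∫⁻ x, ENNReal.ofReal (japanese x ^ (δ - 1) * u x ^ (1 - α)) ∂n.variation ≤
      ENNReal.ofReal a * action φ μ n γ ^ (1 / p) *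
        (∫⁻ x, ENNReal.ofReal (japanese x ^ δ * u x) ∂μ + L) ^ (1 - α)

/-- For a general density, the weight `J ^ (q (δ - 1))` that comes out of Hölder's inequality is
dominated by `J ^ δ` with respect to `μ` and by `J ^ r` with respect to `γ`. -/
lemma fluxBound_general {d : ℕ} {p q c δ r : ℝ} (hpq : p.HolderConjugate q) {φ : ℝ → E d → ℝ}
    (hc : 0 < c) (h : ∀ ρ, 0 < ρ → ∀ w : E d, c * ‖w‖ ^ p * (1 + ρ) ^ (-(p - 1)) ≤ φ ρ w)
    (hδ : δ ≤ min (1 + r / q) p) (γ : Measure (E d)) [IsLocallyFiniteMeasure γ] :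
    FluxBound p φ γ δ (1 / p) (2 * c ^ (-(1 / p)))
      (ENNReal.ofReal (2 ^ |q * (δ - 1)|) * moment r γ) := by
  intro μ n hμ hA u hu hu0 hu1
  have hp := hpq.lt
  have hp0 : 0 < p := hpq.pos
  have hq0 : 0 < q := hpq.symm.pos
  have hq : 1 - 1 / p = 1 / q := by
    have := hpq.inv_add_inv_eq_one
    simp only [one_div]
    linarith
  have hδr : q * (δ - 1) ≤ r := by
    have h1 := hδ.trans (min_le_left _ _)
    have h2 : δ - 1 ≤ r / q := by linarith
    rw [le_div_iff₀ hq0] at h2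
    linarith
  have hδp : q * (δ - 1) ≤ δ := by
    have h1 := hδ.trans (min_le_right _ _)
    have h2 : q * (p - 1) = p := by
      have := hpq.sub_one_mul_conj
      linarith
    have h3 : 0 < p - 1 := by linarith
    nlinarith
  have hJm : ∀ s : ℝ, Measurable (fun x : E d => japanese x ^ s) :=
    fun s => (continuous_japanese_rpow s).measurable
  have key := lintegral_variation_le (b := 1) (θ := 1) hp hc le_rfl hp.le zero_le_one
    (fun ρ hρ w => le_extDensity hp0.le hc.le zero_le_one h hρ w)
    (fun ρ hρ w => Or.inl ⟨rfl, le_recession hp0.le hc.le h hρ w⟩) (μ := μ) (γ := γ) (n := n) hA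
    (h := fun x => ENNReal.ofReal (japanese x ^ (δ - 1) * u x ^ (1 - 1 / p)))
    (k := fun x => ENNReal.ofReal (japanese x ^ (q * (δ - 1)) * u x)) (l := fun _ => 0)
    ((hJm _).mul (hu.pow_const _)).ennreal_ofReal ((hJm _).mul hu).ennreal_ofReal measurable_const
    (by
      intro x
      have hJ := japanese_pos x
      have h1 : 0 ≤ 1 - 1 / p := by rw [hq]; positivity
      rw [ENNReal.ofReal_rpow_of_nonneg (mul_nonneg (by positivity) (hu0 x)) h1,
        Real.mul_rpow (by positivity) (hu0 x), ← Real.rpow_mul hJ.le, hq]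
      have h2 : q * (δ - 1) * (1 / q) = δ - 1 := by field_simp
      rw [h2]
      simp)
  simp only [sub_self, zero_div, ENNReal.rpow_zero, mul_one, ENNReal.ofReal_one, one_mul] at key
  rw [mul_assoc]
  refine key.trans ?_
  have e : 0 ≤ 1 - 1 / p := by rw [hq]; positivity
  gcongr ENNReal.ofReal _ * (_ * (?_ + ?_) ^ (_ : ℝ))
  · refine lintegral_mono fun x => ENNReal.ofReal_le_ofReal ?_
    have := hu0 x
    gcongr
    exact one_le_japanese x
  · calc ∫⁻ x, ENNReal.ofReal (japanese x ^ (q * (δ - 1)) * u x) ∂γ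
        ≤ smoothMoment (q * (δ - 1)) γ := by
          refine lintegral_mono fun x => ENNReal.ofReal_le_ofReal ?_
          have := japanese_pos x
          exact mul_le_of_le_one_right (by positivity) (hu1 x)
      _ ≤ ENNReal.ofReal (2 ^ |q * (δ - 1)|) * moment (q * (δ - 1)) γ := smoothMoment_le _ _
      _ ≤ _ := by
          gcongr
          exact moment_mono hδr γ

/-- For a `θ`-homogeneous density, the exponent `δ` is the one for which
`J ^ (δ - 1) ≲ (J ^ δ) ^ (1 - θ / p) (J ^ r) ^ ((θ - 1) / p)`. -/
lemma fluxBound_homogeneous {d : ℕ} {p c δ r θ : ℝ} (hp : 1 < p) {φ : ℝ → E d → ℝ}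
    (hc : 0 < c) (h : ∀ ρ, 0 < ρ → ∀ w : E d, c * ‖w‖ ^ p * (1 + ρ) ^ (-(p - 1)) ≤ φ ρ w)
    (hθ : 1 ≤ θ) (hθp : θ ≤ p)
    (hH : ∀ ρ, 0 < ρ → ∀ w : E d, c * ‖w‖ ^ p * ρ ^ (-(p - θ)) ≤ φ ρ w)
    (hδ : δ ≤ 1 / θ * p + (1 - 1 / θ) * r) (γ : Measure (E d)) [IsLocallyFiniteMeasure γ]
    {l : ℝ} (hl0 : 0 < l) (hl : moment r γ ≤ ENNReal.ofReal l) :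
    FluxBound p φ γ δ (θ / p) (2 ^ (|δ| + 1) * (2 * c ^ (-(1 / p))) * l ^ ((θ - 1) / p)) 0 := by
  intro μ n hμ hA u hu hu0 hu1
  have hp0 : 0 < p := by linarith
  have hθ0 : 0 < θ := by linarith
  have e2 : 0 ≤ 1 - θ / p := by rw [sub_nonneg, div_le_one hp0]; exact hθp
  have e3 : 0 ≤ (θ - 1) / p := div_nonneg (by linarith) hp0.le
  have hJm : ∀ s : ℝ, Measurable (fun x : E d => japanese x ^ s) :=
    fun s => (continuous_japanese_rpow s).measurable
  have hNm : Measurable (fun x : E d => (max 1 ‖x‖) ^ r) := by fun_prop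
  have key := lintegral_variation_le (b := 0) (θ := θ) hp hc hθ hθp le_rfl
    (fun ρ hρ w => le_extDensity hp0.le hc.le le_rfl (by simpa using hH) hρ w)
    (fun ρ hρ w => by
      rcases hθ.eq_or_lt with h1 | h1
      · subst h1
        exact Or.inl ⟨rfl, le_recession hp0.le hc.le h hρ w⟩
      · exact Or.inr (top_le_recession hp0.le hc h1 hθp hH hρ w)) (μ := μ) (γ := γ) (n := n) hA
    (h := fun x => ENNReal.ofReal (japanese x ^ δ * u x) ^ (1 - θ / p) *
      ENNReal.ofReal ((max 1 ‖x‖) ^ r) ^ ((θ - 1) / p))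
    (k := fun x => ENNReal.ofReal (japanese x ^ δ * u x))
    (l := fun x => ENNReal.ofReal ((max 1 ‖x‖) ^ r))
    ((((hJm _).mul hu).ennreal_ofReal.pow_const _).mul (hNm.ennreal_ofReal.pow_const _))
    ((hJm _).mul hu).ennreal_ofReal hNm.ennreal_ofReal (fun _ => le_rfl)
  simp only [ENNReal.ofReal_zero, zero_mul, add_zero] at key ⊢
  have hpt : ∀ x, ENNReal.ofReal (japanese x ^ (δ - 1) * u x ^ (1 - θ / p)) ≤
      ENNReal.ofReal (2 ^ (|δ| + 1)) * (ENNReal.ofReal (japanese x ^ δ * u x) ^ (1 - θ / p) *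
      ENNReal.ofReal ((max 1 ‖x‖) ^ r) ^ ((θ - 1) / p)) := by
    intro x
    have hJ := japanese_pos x
    have hN : 0 < max 1 ‖x‖ := lt_max_of_lt_left one_pos
    have hux := hu0 x
    rw [ENNReal.ofReal_rpow_of_nonneg (by positivity) e2,
      ENNReal.ofReal_rpow_of_nonneg (by positivity) e3, ← ENNReal.ofReal_mul (by positivity),
      ← ENNReal.ofReal_mul (by positivity)]
    refine ENNReal.ofReal_le_ofReal ?_
    rw [Real.mul_rpow (by positivity) hux, ← Real.rpow_mul hJ.le, ← Real.rpow_mul hN.le]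
    have h1 : japanese x ^ (δ - 1) = japanese x ^ (δ * (1 - θ / p)) *
        japanese x ^ (δ * θ / p - 1) := by
      rw [← Real.rpow_add hJ]
      congr 1
      ring
    have h2 : δ * θ / p - 1 ≤ r * ((θ - 1) / p) := by
      have h3 : δ * θ ≤ p + (θ - 1) * r := by
        calc δ * θ ≤ (1 / θ * p + (1 - 1 / θ) * r) * θ := by gcongr
          _ = p + (θ - 1) * r := by field_simp
      have h4 : δ * θ / p ≤ (p + (θ - 1) * r) / p := by gcongr
      have h5 : (p + (θ - 1) * r) / p = 1 + r * ((θ - 1) / p) := by field_simp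
      linarith
    have h3 : |δ * θ / p - 1| ≤ |δ| + 1 := by
      refine (abs_sub _ _).trans ?_
      rw [abs_one, mul_div_assoc, abs_mul]
      have h5 : |θ / p| ≤ 1 := by
        rw [abs_of_pos (by positivity), div_le_one hp0]; exact hθp
      have := mul_le_of_le_one_right (abs_nonneg δ) h5
      linarith
    have h4 : japanese x ^ (δ * θ / p - 1) ≤ 2 ^ (|δ| + 1) * (max 1 ‖x‖) ^ (r * ((θ - 1) / p)) := by
      refine (japanese_rpow_le x _).trans ?_
      gcongr
      · exact one_le_two
      · exact le_max_left _ _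
    rw [h1]
    calc japanese x ^ (δ * (1 - θ / p)) * japanese x ^ (δ * θ / p - 1) * u x ^ (1 - θ / p)
        ≤ japanese x ^ (δ * (1 - θ / p)) * (2 ^ (|δ| + 1) * (max 1 ‖x‖) ^ (r * ((θ - 1) / p))) *
          u x ^ (1 - θ / p) := by gcongr
      _ = _ := by ring
  calc ∫⁻ x, ENNReal.ofReal (japanese x ^ (δ - 1) * u x ^ (1 - θ / p)) ∂n.variation
      ≤ ENNReal.ofReal (2 ^ (|δ| + 1)) *
        ∫⁻ x, (ENNReal.ofReal (japanese x ^ δ * u x) ^ (1 - θ / p) *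
        ENNReal.ofReal ((max 1 ‖x‖) ^ r) ^ ((θ - 1) / p)) ∂n.variation := by
        rw [← lintegral_const_mul' _ _ ENNReal.ofReal_ne_top]
        exact lintegral_mono hpt
    _ ≤ ENNReal.ofReal (2 ^ (|δ| + 1)) * (ENNReal.ofReal (2 * c ^ (-(1 / p))) *
        (action φ μ n γ ^ (1 / p) * (∫⁻ x, ENNReal.ofReal (japanese x ^ δ * u x) ∂μ) ^ (1 - θ / p) *
          (ENNReal.ofReal l) ^ ((θ - 1) / p))) := by
        refine mul_le_mul_right (key.trans ?_) _
        gcongr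
        exact hl
    _ = _ := by
        rw [ENNReal.ofReal_rpow_of_pos hl0,
          ENNReal.ofReal_mul (p := 2 ^ (|δ| + 1) * (2 * c ^ (-(1 / p)))) (by positivity),
          ENNReal.ofReal_mul (p := 2 ^ (|δ| + 1)) (by positivity)]
        ring

/-! ### Functions of time with an integrable distributional derivative -/

/-- The smooth step that climbs from `0` to `1` on `[s, s + e]`. -/
noncomputable def smoothStep (s e τ : ℝ) : ℝ := Real.smoothTransition ((τ - s) / e)

section smoothStep
variable {s e : ℝ}

lemma contDiff_smoothStep : ContDiff ℝ 1 (smoothStep s e) := by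
  unfold smoothStep
  exact Real.smoothTransition.contDiff.comp (by fun_prop)

lemma smoothStep_of_le (he : 0 < e) {τ : ℝ} (h : τ ≤ s) : smoothStep s e τ = 0 :=
  Real.smoothTransition.zero_of_nonpos (div_nonpos_of_nonpos_of_nonneg (by linarith) he.le)

lemma smoothStep_of_ge (he : 0 < e) {τ : ℝ} (h : s + e ≤ τ) : smoothStep s e τ = 1 :=
  Real.smoothTransition.one_of_one_le (by rw [le_div_iff₀ he]; linarith)

lemma monotone_smoothStep (he : 0 < e) : Monotone (smoothStep s e) := fun a b hab =>
  Real.smoothTransition.monotone (by gcongr)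

lemma deriv_smoothStep_eq_zero (he : 0 < e) {τ : ℝ} (h : τ ∉ Icc s (s + e)) :
    deriv (smoothStep s e) τ = 0 := by
  rw [mem_Icc, not_and_or, not_le, not_le] at h
  rcases h with h | h
  · have : smoothStep s e =ᶠ[𝓝 τ] fun _ => 0 := by
      filter_upwards [gt_mem_nhds h] with y hy using smoothStep_of_le he hy.le
    rw [this.deriv_eq]; simp
  · have : smoothStep s e =ᶠ[𝓝 τ] fun _ => 1 := by
      filter_upwards [lt_mem_nhds h] with y hy using smoothStep_of_ge he hy.le
    rw [this.deriv_eq]; simp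

lemma abs_integral_deriv_smoothStep_sub_le {m : ℝ → ℝ} (hm : ContinuousOn m (Icc 0 1)) (hs : 0 < s)
    (he : 0 < e) (hse : s + e < 1) {κ : ℝ} (hκ : ∀ τ ∈ Icc s (s + e), |m τ - m s| ≤ κ) :
    |(∫ τ in Ioo (0 : ℝ) 1, deriv (smoothStep s e) τ * m τ) - m s| ≤ κ := by
  have hsub : Icc s (s + e) ⊆ Ioo (0 : ℝ) 1 := fun x hx => ⟨hs.trans_le hx.1, hx.2.trans_lt hse⟩
  have hle : s ≤ s + e := by linarith
  have hcd : Continuous (deriv (smoothStep s e)) := contDiff_smoothStep.continuous_deriv le_rfl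
  have hnn : ∀ τ, 0 ≤ deriv (smoothStep s e) τ := fun τ => (monotone_smoothStep he).deriv_nonneg
  have hmc : ContinuousOn m (Icc s (s + e)) := hm.mono (hsub.trans Ioo_subset_Icc_self)
  have h1 : ∫ τ in Ioo (0 : ℝ) 1, deriv (smoothStep s e) τ * m τ =
      ∫ τ in s..(s + e), deriv (smoothStep s e) τ * m τ := by
    rw [setIntegral_eq_of_subset_of_forall_sdiff_eq_zero measurableSet_Ioo hsub,
      integral_Icc_eq_integral_Ioc, intervalIntegral.integral_of_le hle]
    intro x hx
    rw [deriv_smoothStep_eq_zero he hx.2, zero_mul]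
  have h2 : ∫ τ in s..(s + e), deriv (smoothStep s e) τ = 1 := by
    rw [intervalIntegral.integral_deriv_eq_sub' _ rfl
      (fun x _ => (contDiff_smoothStep.differentiable one_ne_zero) x) hcd.continuousOn,
      smoothStep_of_ge he le_rfl, smoothStep_of_le he le_rfl, sub_zero]
  have hi1 : IntervalIntegrable (fun τ => deriv (smoothStep s e) τ * m τ) volume s (s + e) :=
    ContinuousOn.intervalIntegrable (by rw [uIcc_of_le hle]; exact hcd.continuousOn.mul hmc)
  have hi2 : IntervalIntegrable (fun τ => deriv (smoothStep s e) τ * m s) volume s (s + e) :=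
    (hcd.mul continuous_const).intervalIntegrable _ _
  have h3 : m s = ∫ τ in s..(s + e), deriv (smoothStep s e) τ * m s := by
    rw [intervalIntegral.integral_mul_const, h2, one_mul]
  rw [h1, h3, ← intervalIntegral.integral_sub hi1 hi2, ← Real.norm_eq_abs]
  calc ‖∫ τ in s..(s + e), (deriv (smoothStep s e) τ * m τ - deriv (smoothStep s e) τ * m s)‖
      ≤ ∫ τ in s..(s + e), deriv (smoothStep s e) τ * κ := by
        refine intervalIntegral.norm_integral_le_of_norm_le hle ?_
          ((hcd.mul continuous_const).intervalIntegrable _ _)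
        refine ae_of_all _ fun τ hτ => ?_
        rw [← mul_sub, norm_mul, Real.norm_of_nonneg (hnn τ), Real.norm_eq_abs]
        exact mul_le_mul_of_nonneg_left (hκ τ (Ioc_subset_Icc_self hτ)) (hnn τ)
    _ = κ := by rw [intervalIntegral.integral_mul_const, h2, one_mul]

end smoothStep

/-- If `v` is the distributional derivative of the continuous function `m` on `(0, 1)`, the
oscillation of `m` is at most the integral of `|v|`: test with smooth approximations, valued in
`[0, 1]`, of the indicator function of `[s, t]`. -/
lemma abs_sub_le_of_distributional_deriv {m v : ℝ → ℝ} (hm : ContinuousOn m (Icc 0 1))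
    (hv : IntegrableOn v (Ioo 0 1))
    (h : ∀ f : ℝ → ℝ, ContDiff ℝ 1 f → HasCompactSupport f → tsupport f ⊆ Ioo 0 1 →
      (∫ τ in Ioo (0 : ℝ) 1, deriv f τ * m τ) + ∫ τ in Ioo (0 : ℝ) 1, f τ * v τ = 0)
    {s t : ℝ} (hs : s ∈ Icc (0 : ℝ) 1) (ht : t ∈ Icc (0 : ℝ) 1) :
    |m t - m s| ≤ ∫ τ in Ioo (0 : ℝ) 1, |v τ| := by
  have main : ∀ s t : ℝ, 0 < s → s < t → t < 1 → |m t - m s| ≤ ∫ τ in Ioo (0 : ℝ) 1, |v τ| := by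
    intro s t hs hst ht
    refine le_of_forall_pos_le_add fun κ hκ => ?_
    have hκ2 : 0 < κ / 2 := by linarith
    have hcont : ∀ s, 0 < s → s < 1 → ∃ e > 0, ∀ τ ∈ Icc s (s + e), |m τ - m s| ≤ κ / 2 := by
      intro s h0 h1
      have hca : ContinuousAt m s := hm.continuousAt (Icc_mem_nhds h0 h1)
      obtain ⟨e, he, hb⟩ := Metric.continuousAt_iff.1 hca (κ / 2) hκ2
      refine ⟨e / 2, by linarith, fun τ hτ => (hb ?_).le⟩
      rw [Real.dist_eq, abs_of_nonneg (by linarith [hτ.1])]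
      linarith [hτ.2]
    obtain ⟨e₁, he₁, hb₁⟩ := hcont s hs (hst.trans ht)
    obtain ⟨e₂, he₂, hb₂⟩ := hcont t (hs.trans hst) ht
    set e := min (min e₁ e₂) ((1 - t) / 2) with hed
    have he : 0 < e := lt_min (lt_min he₁ he₂) (by linarith)
    have hee₁ : e ≤ e₁ := (min_le_left _ _).trans (min_le_left _ _)
    have hee₂ : e ≤ e₂ := (min_le_left _ _).trans (min_le_right _ _)
    have hee₃ : e ≤ (1 - t) / 2 := min_le_right _ _
    have hte : t + e < 1 := by linarith
    have b₁ := abs_integral_deriv_smoothStep_sub_le hm hs he (by linarith)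
      (fun τ hτ => hb₁ τ ⟨hτ.1, hτ.2.trans (by linarith)⟩)
    have b₂ := abs_integral_deriv_smoothStep_sub_le hm (hs.trans hst) he hte
      (fun τ hτ => hb₂ τ ⟨hτ.1, hτ.2.trans (by linarith)⟩)
    set f : ℝ → ℝ := fun τ => smoothStep s e τ - smoothStep t e τ with hf
    have hfc : ContDiff ℝ 1 f := contDiff_smoothStep.sub contDiff_smoothStep
    have hsupp : Function.support f ⊆ Icc s (t + e) := by
      intro τ hτ
      by_contra hn
      rw [mem_Icc, not_and_or, not_le, not_le] at hn
      apply hτ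
      rcases hn with hn | hn
      · simp [hf, smoothStep_of_le he hn.le, smoothStep_of_le he (hn.le.trans hst.le)]
      · simp [hf, smoothStep_of_ge he hn.le, smoothStep_of_ge he (s := s) (by linarith : s + e ≤ τ)]
    have hts : tsupport f ⊆ Icc s (t + e) := closure_minimal hsupp isClosed_Icc
    have heq := h f hfc (isCompact_Icc.of_isClosed_subset (isClosed_tsupport f) hts)
      (hts.trans fun x hx => ⟨hs.trans_le hx.1, hx.2.trans_lt hte⟩)
    have hf1 : ∀ τ, |f τ| ≤ 1 := by
      intro τ
      rw [abs_le]
      have a1 := Real.smoothTransition.nonneg ((τ - s) / e)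
      have a2 := Real.smoothTransition.le_one ((τ - s) / e)
      have a3 := Real.smoothTransition.nonneg ((τ - t) / e)
      have a4 := Real.smoothTransition.le_one ((τ - t) / e)
      simp only [hf, smoothStep]
      constructor <;> linarith
    have hint : ∀ s, IntegrableOn (fun τ => deriv (smoothStep s e) τ * m τ) (Ioo 0 1) := by
      intro s
      refine IntegrableOn.mono_set ?_ Ioo_subset_Icc_self
      exact ((contDiff_smoothStep.continuous_deriv le_rfl).continuousOn.mul hm).integrableOn_compact
        isCompact_Icc
    have hd : ∫ τ in Ioo (0 : ℝ) 1, deriv f τ * m τ =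
        (∫ τ in Ioo (0 : ℝ) 1, deriv (smoothStep s e) τ * m τ) -
          ∫ τ in Ioo (0 : ℝ) 1, deriv (smoothStep t e) τ * m τ := by
      rw [← integral_sub (hint s) (hint t)]
      congr 1
      ext τ
      rw [hf, deriv_fun_sub (contDiff_smoothStep.differentiable one_ne_zero _)
        (contDiff_smoothStep.differentiable one_ne_zero _)]
      ring
    have hfv : |∫ τ in Ioo (0 : ℝ) 1, f τ * v τ| ≤ ∫ τ in Ioo (0 : ℝ) 1, |v τ| := by
      rw [← Real.norm_eq_abs]
      refine norm_integral_le_of_norm_le hv.abs (ae_of_all _ fun τ => ?_)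
      rw [norm_mul, Real.norm_eq_abs, Real.norm_eq_abs]
      exact mul_le_of_le_one_left (abs_nonneg _) (hf1 τ)
    rw [hd] at heq
    rw [abs_le] at *
    constructor <;> linarith [b₁.1, b₁.2, b₂.1, b₂.2, hfv.1, hfv.2]
  have main' : ∀ s ∈ Ioo (0 : ℝ) 1, ∀ t ∈ Ioo (0 : ℝ) 1,
      |m t - m s| ≤ ∫ τ in Ioo (0 : ℝ) 1, |v τ| := by
    intro s hs t ht
    rcases lt_trichotomy s t with hst | hst | hst
    · exact main s t hs.1 hst ht.2
    · rw [hst, sub_self, abs_zero]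
      exact integral_nonneg fun _ => abs_nonneg _
    · rw [abs_sub_comm]
      exact main t s ht.1 hst hs.2
  have hcl : closure (Ioo (0 : ℝ) 1) = Icc 0 1 := closure_Ioo zero_ne_one
  have main'' : ∀ s ∈ Ioo (0 : ℝ) 1, ∀ t ∈ Icc (0 : ℝ) 1,
      |m t - m s| ≤ ∫ τ in Ioo (0 : ℝ) 1, |v τ| := by
    intro s hs t ht
    rw [← hcl] at ht
    refine le_on_closure (main' s hs) ?_ continuousOn_const ht
    rw [hcl]
    exact (hm.sub continuousOn_const).abs
  rw [← hcl] at hs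
  refine le_on_closure (fun s hs => main'' s hs t ht) ?_ continuousOn_const hs
  rw [hcl]
  exact (continuousOn_const.sub hm).abs

/-! ### Testing the continuity equation -/

/-- The pairing `∫ ⟨F, d𝛎ₜ⟩` of a Borel family with a continuous covector field of compact support
depends measurably on `t`: approximate `F` by simple functions with bounded support. -/
lemma measurable_integral_direction {d : ℕ} {n : ℝ → VectorRadonMeasure d}
    (hn : ∀ B : Set (E d), MeasurableSet B → Bornology.IsBounded B →
      Measurable (fun t : Ioo (0 : ℝ) 1 => (n t).value B))
    {F : E d → (E d →L[ℝ] ℝ)} (hF : Continuous F) (hFc : HasCompactSupport F) :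
    Measurable (fun t : Ioo (0 : ℝ) 1 => ∫ x, F x ((n t).direction x) ∂(n t).variation) := by
  set S : ℕ → SimpleFunc (E d) (E d →L[ℝ] ℝ) :=
    fun k => SimpleFunc.approxOn F hF.measurable univ 0 (mem_univ _) k with hS
  have hbd : ∀ k x, ‖S k x‖ ≤ 2 * ‖F x‖ := by
    intro k x
    rw [two_mul]
    exact SimpleFunc.norm_approxOn_zero_le hF.measurable (mem_univ _) x k
  have hloc : ∀ t, IsLocallyFiniteMeasure (n t).variation := fun t => (n t).locallyFinite
  refine measurable_of_tendsto_metrizable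
    (f := fun k (t : Ioo (0 : ℝ) 1) => ∫ x, S k x ((n t).direction x) ∂(n t).variation) ?_ ?_
  · intro k
    classical
    have hbound : ∀ c ∈ (S k).range.filter (· ≠ 0), Bornology.IsBounded (S k ⁻¹' {c}) := by
      intro c hc
      refine hFc.isBounded.subset fun x hx => subset_tsupport _ ?_
      intro h0
      have h1 := hbd k x
      rw [h0, norm_zero, mul_zero] at h1
      rw [mem_preimage, mem_singleton_iff] at hx
      rw [Finset.mem_filter, ← hx] at hc
      exact hc.2 (norm_le_zero_iff.1 h1)
    have heq : ∀ t, ∫ x, S k x ((n t).direction x) ∂(n t).variation =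
        ∑ c ∈ (S k).range.filter (· ≠ 0), c ((n t).value (S k ⁻¹' {c})) := by
      intro t
      have hpt : ∀ x, S k x ((n t).direction x) = ∑ c ∈ (S k).range.filter (· ≠ 0),
          (S k ⁻¹' {c}).indicator (fun x => c ((n t).direction x)) x := by
        intro x
        rcases eq_or_ne (S k x) 0 with h0 | h0
        · rw [h0, Finset.sum_eq_zero]
          · simp
          · intro c hc
            refine indicator_of_notMem ?_ _
            rw [mem_preimage, mem_singleton_iff, h0]
            exact fun h => (Finset.mem_filter.1 hc).2 h.symm
        · rw [Finset.sum_eq_single (S k x)]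
          · rw [indicator_of_mem (by simp)]
          · intro c _ hc
            refine indicator_of_notMem ?_ _
            rw [mem_preimage, mem_singleton_iff]
            exact fun h => hc h.symm
          · intro h
            exact absurd (Finset.mem_filter.2 ⟨(S k).mem_range_self x, h0⟩) h
      have hdi : ∀ c ∈ (S k).range.filter (· ≠ 0),
          IntegrableOn (n t).direction (S k ⁻¹' {c}) (n t).variation := by
        intro c hc
        have : IsFiniteMeasure ((n t).variation.restrict (S k ⁻¹' {c})) :=
          ⟨by rw [Measure.restrict_apply_univ]; exact (hbound c hc).measure_lt_top⟩
        refine Integrable.of_bound (n t).measurable_direction.aestronglyMeasurable 1 ?_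
        filter_upwards [ae_restrict_of_ae (n t).norm_direction] with x hx using hx.le
      simp_rw [hpt]
      rw [integral_finsetSum]
      · refine Finset.sum_congr rfl fun c hc => ?_
        rw [integral_indicator ((S k).measurableSet_fiber c), VectorRadonMeasure.value,
          ContinuousLinearMap.integral_comp_comm _ (hdi c hc)]
      · intro c hc
        rw [integrable_indicator_iff ((S k).measurableSet_fiber c)]
        exact c.integrable_comp (hdi c hc)
    simp_rw [heq]
    refine Finset.measurable_fun_sum _ fun c hc => ?_
    exact c.continuous.measurable.comp (hn _ ((S k).measurableSet_fiber c) (hbound c hc))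
  · rw [tendsto_pi_nhds]
    intro t
    refine tendsto_integral_of_dominated_convergence (fun x => 2 * ‖F x‖) ?_ ?_ ?_ ?_
    · intro k
      have hc : Continuous (fun z : (E d →L[ℝ] ℝ) × E d => z.1 z.2) := by fun_prop
      exact (hc.measurable.comp
        ((S k).measurable.prodMk (n t).measurable_direction)).aestronglyMeasurable
    · exact ((hF.norm).integrable_of_hasCompactSupport hFc.norm).const_mul 2
    · intro k
      filter_upwards [(n t).norm_direction] with x hx
      refine ((S k x).le_opNorm _).trans ?_
      rw [hx, mul_one]
      exact hbd k x
    · refine ae_of_all _ fun x => ?_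
      have h1 := SimpleFunc.tendsto_approxOn hF.measurable (mem_univ 0) (x := x)
        (by rw [closure_univ]; exact mem_univ _)
      exact ((ContinuousLinearMap.apply ℝ ℝ ((n t).direction x)).continuous.tendsto _).comp h1

lemma enorm_integral_direction_le {d : ℕ} (n : VectorRadonMeasure d) (F : E d → (E d →L[ℝ] ℝ)) :
    ‖∫ x, F x (n.direction x) ∂n.variation‖ₑ ≤ ∫⁻ x, ENNReal.ofReal ‖F x‖ ∂n.variation := by
  refine (enorm_integral_le_lintegral_enorm _).trans (lintegral_mono_ae ?_)
  filter_upwards [n.norm_direction] with x hx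
  rw [← ofReal_norm]
  refine ENNReal.ofReal_le_ofReal (((F x).le_opNorm _).trans ?_)
  rw [hx, mul_one]

/-- Along a solution of the continuity equation, the integral of a test function varies by at most
the time integral of its pairing with the flux. -/
lemma SolvesContinuity.ofReal_abs_sub_le {d : ℕ} {μ : ℝ → Measure (E d)}
    {n : ℝ → VectorRadonMeasure d} {σ η : Measure (E d)} (h : SolvesContinuity μ n σ η)
    {g : E d → ℝ} (hg : ContDiff ℝ 1 g) (hgc : HasCompactSupport g) {s t : ℝ}
    (hs : s ∈ Icc (0 : ℝ) 1) (ht : t ∈ Icc (0 : ℝ) 1) :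
    AEMeasurable (fun τ => ∫ x, fderiv ℝ g x ((n τ).direction x) ∂(n τ).variation)
      (volume.restrict (Ioo (0 : ℝ) 1)) ∧
    ENNReal.ofReal |(∫ x, g x ∂(μ t)) - ∫ x, g x ∂(μ s)| ≤
      ∫⁻ τ in Ioo (0 : ℝ) 1, ‖∫ x, fderiv ℝ g x ((n τ).direction x) ∂(n τ).variation‖ₑ := by
  set v : ℝ → ℝ := fun τ => ∫ x, fderiv ℝ g x ((n τ).direction x) ∂(n τ).variation with hv
  have hFc : Continuous (fderiv ℝ g) := hg.continuous_fderiv one_ne_zero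
  have hFs : HasCompactSupport (fderiv ℝ g) := hgc.fderiv ℝ
  have hvm : AEMeasurable v (volume.restrict (Ioo (0 : ℝ) 1)) :=
    aemeasurable_restrict_of_measurable_subtype measurableSet_Ioo
      (measurable_integral_direction h.borel_family hFc hFs)
  refine ⟨hvm, ?_⟩
  obtain ⟨K, hK⟩ := hFs.exists_bound_of_continuous hFc
  obtain ⟨R, hR0, hR⟩ := hFs.isBounded.subset_ball_lt 0 0
  have hvb : ∀ τ, ‖v τ‖ₑ ≤ ENNReal.ofReal K * (n τ).variation (Metric.ball 0 R) := by
    intro τ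
    refine (enorm_integral_direction_le _ _).trans ?_
    rw [← lintegral_indicator_const measurableSet_ball]
    refine lintegral_mono fun x => ?_
    by_cases hx : x ∈ Metric.ball (0 : E d) R
    · rw [indicator_of_mem hx]
      exact ENNReal.ofReal_le_ofReal (hK x)
    · have h0 : fderiv ℝ g x = 0 := image_eq_zero_of_notMem_tsupport fun hx' => hx (hR hx')
      simp [h0]
  have hvi : IntegrableOn v (Ioo 0 1) := by
    refine ⟨hvm.aestronglyMeasurable, ?_⟩
    refine (lintegral_mono hvb).trans_lt ?_
    rw [lintegral_const_mul' _ _ ENNReal.ofReal_ne_top]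
    exact ENNReal.mul_lt_top ENNReal.ofReal_lt_top (h.integrable_variation R hR0)
  have hle := abs_sub_le_of_distributional_deriv (m := fun τ => ∫ x, g x ∂(μ τ)) (v := v)
    (h.weakStar_continuous g hg.continuous hgc) hvi ?_ hs ht
  · refine (ENNReal.ofReal_le_ofReal hle).trans (le_of_eq ?_)
    rw [ofReal_integral_eq_lintegral_ofReal hvi.abs (ae_of_all _ fun _ => abs_nonneg _)]
    simp only [← Real.norm_eq_abs, ofReal_norm, hv]
  · intro f hf hfc hfs
    have hfd : ∀ τ, HasFDerivAt f ((1 : ℝ →L[ℝ] ℝ).smulRight (deriv f τ)) τ := fun τ =>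
      ((hf.differentiable one_ne_zero) τ).hasDerivAt.hasFDerivAt
    have hgd : ∀ x, HasFDerivAt g (fderiv ℝ g x) x := fun x =>
      ((hg.differentiable one_ne_zero) x).hasFDerivAt
    have hder : ∀ τ x a w, fderiv ℝ (fun z : ℝ × E d => f z.1 * g z.2) (τ, x) (a, w) =
        f τ * fderiv ℝ g x w + g x * (a * deriv f τ) := by
      intro τ x a w
      have h1 : HasFDerivAt (fun z : ℝ × E d => f z.1)
          (((1 : ℝ →L[ℝ] ℝ).smulRight (deriv f τ)).comp (ContinuousLinearMap.fst ℝ ℝ (E d)))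
          (τ, x) := HasFDerivAt.comp (τ, x) (hfd τ) hasFDerivAt_fst
      have h2 : HasFDerivAt (fun z : ℝ × E d => g z.2)
          ((fderiv ℝ g x).comp (ContinuousLinearMap.snd ℝ ℝ (E d))) (τ, x) :=
        HasFDerivAt.comp (τ, x) (hgd x) hasFDerivAt_snd
      have h3 : HasFDerivAt (fun z : ℝ × E d => f z.1 * g z.2) _ (τ, x) := h1.mul h2
      rw [h3.fderiv]
      simp
    have hsup : tsupport (fun z : ℝ × E d => f z.1 * g z.2) ⊆ tsupport f ×ˢ tsupport g := by
      refine closure_minimal ?_ ((isClosed_tsupport f).prod (isClosed_tsupport g))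
      intro z hz
      have hz' : f z.1 * g z.2 ≠ 0 := hz
      exact ⟨subset_tsupport _ (left_ne_zero_of_mul hz'),
        subset_tsupport _ (right_ne_zero_of_mul hz')⟩
    have heq := h.equation (fun z => f z.1 * g z.2)
      ((hf.comp contDiff_fst).mul (hg.comp contDiff_snd))
      ((hfc.isCompact.prod hgc.isCompact).of_isClosed_subset (isClosed_tsupport _) hsup)
      (hsup.trans (prod_mono hfs (subset_univ _)))
    simp only [hder, map_zero, mul_zero, zero_mul, add_zero, zero_add, one_mul] at heq
    simp only [integral_mul_const, integral_const_mul] at heq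
    simpa only [mul_comm (deriv f _)] using heq

lemma lintegral_enorm_le_rpow {v : ℝ → ℝ} (hv : AEMeasurable v (volume.restrict (Ioo (0 : ℝ) 1)))
    {p : ℝ} (hp : 1 < p) :
    ∫⁻ τ in Ioo (0 : ℝ) 1, ‖v τ‖ₑ ≤ (∫⁻ τ in Ioo (0 : ℝ) 1, ‖v τ‖ₑ ^ p) ^ (1 / p) := by
  have hp0 : 0 < p := by linarith
  have h := ENNReal.lintegral_mul_norm_pow_le (μ := volume.restrict (Ioo (0 : ℝ) 1))
    (f := fun τ => ‖v τ‖ₑ ^ p) (g := fun _ => 1) (hv.enorm.pow_const p) aemeasurable_const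
    (p := 1 / p) (q := 1 - 1 / p) (by positivity)
    (by rw [sub_nonneg, div_le_one hp0]; exact hp.le) (by ring)
  simpa [← ENNReal.rpow_mul, hp0.ne'] using h

/-- The flux bound integrated along a curve of action `A`, for a test function `g` whose gradient is
controlled by `J ^ (δ - 1) u ^ (1 - α)`. The bound on `∫ J ^ δ u dμₜ` being uniform in `t`, no
measurability of the action in `t` is needed. -/
lemma SolvesContinuity.abs_sub_le_of_fluxBound {d : ℕ} {p δ α a : ℝ} {L : ℝ≥0∞} {φ : ℝ → E d → ℝ}
    {γ : Measure (E d)} (hF : FluxBound p φ γ δ α a L) (hp : 1 < p) (hα : α ≤ 1) (ha : 0 < a)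
    {μ : ℝ → Measure (E d)} {n : ℝ → VectorRadonMeasure d} {σ η : Measure (E d)}
    (h : SolvesContinuity μ n σ η)
    (hA : ∫⁻ t in Ioo (0 : ℝ) 1, action φ (μ t) (n t) γ ≠ ⊤)
    {u : E d → ℝ} (hu : Measurable u) (hu0 : ∀ x, 0 ≤ u x) (hu1 : ∀ x, u x ≤ 1)
    {X : ℝ} (hX : 0 < X) (hXb : ∀ t ∈ Ioo (0 : ℝ) 1,
      ∫⁻ x, ENNReal.ofReal (japanese x ^ δ * u x) ∂(μ t) + L ≤ ENNReal.ofReal X)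
    {g : E d → ℝ} (hg : ContDiff ℝ 1 g) (hgc : HasCompactSupport g) {G : ℝ} (hG : 0 < G)
    (hgG : ∀ x, ‖fderiv ℝ g x‖ ≤ G * (japanese x ^ (δ - 1) * u x ^ (1 - α)))
    {s t : ℝ} (hs : s ∈ Icc (0 : ℝ) 1) (ht : t ∈ Icc (0 : ℝ) 1) :
    |(∫ x, g x ∂(μ t)) - ∫ x, g x ∂(μ s)| ≤ G * a * X ^ (1 - α) *
      (∫⁻ t in Ioo (0 : ℝ) 1, action φ (μ t) (n t) γ).toReal ^ (1 / p) := by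
  have hp0 : 0 < p := by linarith
  obtain ⟨hvm, hle⟩ := h.ofReal_abs_sub_le hg hgc hs ht
  set A := ∫⁻ t in Ioo (0 : ℝ) 1, action φ (μ t) (n t) γ with hAd
  set v : ℝ → ℝ := fun τ => ∫ x, fderiv ℝ g x ((n τ).direction x) ∂(n τ).variation with hv
  set k : ℝ := G * a * X ^ (1 - α) with hk
  have hk0 : 0 < k := by positivity
  have hpt : ∀ τ ∈ Ioo (0 : ℝ) 1, ‖v τ‖ₑ ^ p ≤ ENNReal.ofReal k ^ p * action φ (μ τ) (n τ) γ := by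
    intro τ hτ
    by_cases hAτ : action φ (μ τ) (n τ) γ = ⊤
    · -- the constant is positive, so that `0 * ∞ = 0` does not interfere
      rw [hAτ, ENNReal.mul_top]
      · exact le_top
      · simp [ENNReal.rpow_eq_zero_iff, hk0]
    · have := h.locallyFinite τ (Ioo_subset_Icc_self hτ)
      have h1 : ‖v τ‖ₑ ≤ ENNReal.ofReal k * action φ (μ τ) (n τ) γ ^ (1 / p) := by
        calc ‖v τ‖ₑ ≤ ∫⁻ x, ENNReal.ofReal ‖fderiv ℝ g x‖ ∂(n τ).variation :=
              enorm_integral_direction_le _ _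
          _ ≤ ∫⁻ x, ENNReal.ofReal G * ENNReal.ofReal (japanese x ^ (δ - 1) * u x ^ (1 - α))
                ∂(n τ).variation := by
              refine lintegral_mono fun x => ?_
              rw [← ENNReal.ofReal_mul hG.le]
              exact ENNReal.ofReal_le_ofReal (hgG x)
          _ = ENNReal.ofReal G * ∫⁻ x, ENNReal.ofReal (japanese x ^ (δ - 1) * u x ^ (1 - α))
                ∂(n τ).variation := lintegral_const_mul' _ _ ENNReal.ofReal_ne_top
          _ ≤ ENNReal.ofReal G * (ENNReal.ofReal a * action φ (μ τ) (n τ) γ ^ (1 / p) *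
                (ENNReal.ofReal X) ^ (1 - α)) := by
              gcongr
              refine (hF (μ τ) (n τ) this hAτ u hu hu0 hu1).trans ?_
              have : 0 ≤ 1 - α := by linarith
              gcongr
              exact hXb τ hτ
          _ = _ := by
              rw [ENNReal.ofReal_rpow_of_pos hX, hk, ENNReal.ofReal_mul (by positivity),
                ENNReal.ofReal_mul hG.le]
              ring
      calc ‖v τ‖ₑ ^ p ≤ (ENNReal.ofReal k * action φ (μ τ) (n τ) γ ^ (1 / p)) ^ p := by gcongr
        _ = _ := by
          rw [ENNReal.mul_rpow_of_nonneg _ _ hp0.le, ← ENNReal.rpow_mul, one_div_mul_cancel hp0.ne',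
            ENNReal.rpow_one]
  have h2 : ∫⁻ τ in Ioo (0 : ℝ) 1, ‖v τ‖ₑ ^ p ≤ ENNReal.ofReal k ^ p * A := by
    rw [hAd, ← lintegral_const_mul' _ _
      (ENNReal.rpow_ne_top_of_nonneg hp0.le ENNReal.ofReal_ne_top)]
    exact setLIntegral_mono' measurableSet_Ioo hpt
  have h3 : ENNReal.ofReal |(∫ x, g x ∂(μ t)) - ∫ x, g x ∂(μ s)| ≤
      ENNReal.ofReal (k * A.toReal ^ (1 / p)) := by
    calc _ ≤ ∫⁻ τ in Ioo (0 : ℝ) 1, ‖v τ‖ₑ := hle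
      _ ≤ (∫⁻ τ in Ioo (0 : ℝ) 1, ‖v τ‖ₑ ^ p) ^ (1 / p) := lintegral_enorm_le_rpow hvm hp
      _ ≤ (ENNReal.ofReal k ^ p * A) ^ (1 / p) := by gcongr
      _ = _ := by
        rw [ENNReal.mul_rpow_of_nonneg _ _ (by positivity), ← ENNReal.rpow_mul,
          mul_one_div_cancel hp0.ne', ENNReal.rpow_one, ENNReal.ofReal_mul hk0.le,
          ← ENNReal.ofReal_rpow_of_nonneg ENNReal.toReal_nonneg (by positivity),
          ENNReal.ofReal_toReal hA]
  exact (ENNReal.ofReal_le_ofReal_iff (by positivity)).1 h3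

/-! ### Cut-off functions -/

lemma hasDerivAt_max_zero_pow (k : ℕ) (y : ℝ) :
    HasDerivAt (fun y : ℝ => (max 0 y) ^ (k + 2)) ((k + 2) * (max 0 y) ^ (k + 1)) y := by
  rcases lt_trichotomy y 0 with hy | rfl | hy
  · have h1 : (fun y : ℝ => (max 0 y) ^ (k + 2)) =ᶠ[𝓝 y] fun _ => 0 := by
      filter_upwards [gt_mem_nhds hy] with z hz
      rw [max_eq_left hz.le]
      simp
    rw [max_eq_left hy.le]
    simpa using (hasDerivAt_const y (0 : ℝ)).congr_of_eventuallyEq h1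
  · rw [hasDerivAt_iff_isLittleO_nhds_zero]
    simp only [zero_add, max_self, ne_eq, Nat.add_eq_zero_iff, OfNat.ofNat_ne_zero, and_false,
      not_false_eq_true, zero_pow, sub_zero, one_ne_zero, mul_zero, smul_zero]
    have h1 : (fun h : ℝ => (max 0 h) ^ (k + 2)) =O[𝓝 0] fun h : ℝ => h ^ (k + 2) := by
      refine Asymptotics.IsBigO.of_bound 1 (Eventually.of_forall fun h => ?_)
      rw [one_mul, norm_pow, norm_pow]
      refine pow_le_pow_left₀ (norm_nonneg _) ?_ _
      rw [Real.norm_eq_abs, Real.norm_eq_abs, abs_of_nonneg (le_max_left _ _)]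
      exact max_le (abs_nonneg _) (le_abs_self _)
    exact h1.trans_isLittleO (Asymptotics.isLittleO_pow_id (by omega))
  · have h1 : (fun y : ℝ => (max 0 y) ^ (k + 2)) =ᶠ[𝓝 y] fun y => y ^ (k + 2) := by
      filter_upwards [lt_mem_nhds hy] with z hz
      rw [max_eq_right hz.le]
    rw [max_eq_right hy.le]
    simpa using (hasDerivAt_pow (k + 2) y).congr_of_eventuallyEq h1

lemma contDiff_max_zero_pow (k : ℕ) : ContDiff ℝ 1 (fun y : ℝ => (max 0 y) ^ (k + 2)) := by
  rw [contDiff_one_iff_deriv]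
  refine ⟨fun y => (hasDerivAt_max_zero_pow k y).differentiableAt, ?_⟩
  have : deriv (fun y : ℝ => (max 0 y) ^ (k + 2)) =
      fun y : ℝ => ((k : ℝ) + 2) * (max 0 y) ^ (k + 1) :=
    funext fun y => (hasDerivAt_max_zero_pow k y).deriv
  rw [this]
  fun_prop

/-- The profile `(1 - J² / N²)₊`, `N = k + 1`; it vanishes where `J ≥ N`. -/
noncomputable def cutoffBase {d : ℕ} (k : ℕ) (x : E d) : ℝ :=
  max 0 (1 - (1 + ‖x‖ ^ 2) / ((k : ℝ) + 1) ^ 2)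

/-- The cut-off function `(1 - J² / N²)₊ ^ (m + 2)`, `N = k + 1`, of class `C¹`. A large power
`m + 2` makes its gradient comparable to a power of the cut-off function itself. -/
noncomputable def cutoff {d : ℕ} (m k : ℕ) (x : E d) : ℝ := cutoffBase k x ^ (m + 2)

section cutoff
variable {d : ℕ} (m k : ℕ) (x : E d)

lemma cutoffBase_nonneg : 0 ≤ cutoffBase k x := le_max_left _ _

lemma cutoffBase_le_one : cutoffBase k x ≤ 1 := by
  refine max_le zero_le_one ?_
  have : 0 ≤ (1 + ‖x‖ ^ 2) / ((k : ℝ) + 1) ^ 2 := by positivity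
  linarith

lemma cutoff_nonneg : 0 ≤ cutoff m k x := pow_nonneg (cutoffBase_nonneg k x) _

lemma cutoff_le_one : cutoff m k x ≤ 1 :=
  pow_le_one₀ (cutoffBase_nonneg k x) (cutoffBase_le_one k x)

lemma japanese_lt_of_cutoffBase_ne_zero (h : cutoffBase k x ≠ 0) : japanese x < k + 1 := by
  have h1 : 0 < 1 - (1 + ‖x‖ ^ 2) / ((k : ℝ) + 1) ^ 2 := by
    by_contra hn
    exact h (max_eq_left (not_lt.1 hn))
  rw [sub_pos, div_lt_one (by positivity), ← japanese_sq] at h1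
  exact lt_of_pow_lt_pow_left₀ 2 (by positivity) h1

lemma monotone_cutoff : Monotone (fun k : ℕ => cutoff m k x) := by
  intro a b hab
  refine pow_le_pow_left₀ (cutoffBase_nonneg a x) (max_le_max_left _ ?_) _
  gcongr

lemma tendsto_cutoff : Tendsto (fun k : ℕ => cutoff m k x) atTop (𝓝 1) := by
  have h1 : Tendsto (fun k : ℕ => (k : ℝ) + 1) atTop atTop :=
    tendsto_atTop_add_const_right _ _ tendsto_natCast_atTop_atTop
  have h2 : Tendsto (fun k : ℕ => (1 + ‖x‖ ^ 2) / ((k : ℝ) + 1) ^ 2) atTop (𝓝 0) :=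
    tendsto_const_nhds.div_atTop ((tendsto_pow_atTop two_ne_zero).comp h1)
  have h3 := (tendsto_const_nhds (x := (0 : ℝ))).max ((tendsto_const_nhds (x := (1 : ℝ))).sub h2)
  simpa [cutoff, cutoffBase] using h3.pow (m + 2)

lemma contDiff_cutoff : ContDiff ℝ 1 (cutoff (d := d) m k) := by
  have h1 : ContDiff ℝ 1 (fun x : E d => 1 - (1 + ‖x‖ ^ 2) / ((k : ℝ) + 1) ^ 2) :=
    contDiff_const.sub ((contDiff_const.add (contDiff_norm_sq ℝ)).div_const _)
  exact (contDiff_max_zero_pow m).comp h1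

lemma hasCompactSupport_cutoff : HasCompactSupport (cutoff (d := d) m k) := by
  refine HasCompactSupport.intro (isCompact_closedBall (0 : E d) (k + 1)) fun x hx => ?_
  by_contra h
  have h1 : cutoffBase k x ≠ 0 := fun h0 => h (by simp [cutoff, h0])
  refine hx ?_
  rw [mem_closedBall_zero_iff]
  exact (norm_le_japanese x).trans (japanese_lt_of_cutoffBase_ne_zero k x h1).le

lemma contDiff_japanese_rpow (s : ℝ) : ContDiff ℝ 1 (fun x : E d => japanese x ^ s) := by
  simp_rw [japanese_rpow_eq]
  exact (contDiff_const.add (contDiff_norm_sq ℝ)).rpow_const_of_ne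
    (fun x => (by positivity : (0 : ℝ) < 1 + ‖x‖ ^ 2).ne')

lemma norm_fderiv_cutoff_le :
    ‖fderiv ℝ (cutoff (d := d) m k) x‖ ≤
      (m + 2) * cutoffBase k x ^ (m + 1) * (2 * ‖x‖ / ((k : ℝ) + 1) ^ 2) := by
  have h1 : HasFDerivAt (fun x : E d => 1 - (1 + ‖x‖ ^ 2) * (((k : ℝ) + 1) ^ 2)⁻¹) _ x :=
    ((((hasStrictFDerivAt_norm_sq x).hasFDerivAt.const_add 1).mul_const
      (((k : ℝ) + 1) ^ 2)⁻¹).const_sub 1)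
  have h2 := (hasDerivAt_max_zero_pow m (1 - (1 + ‖x‖ ^ 2) * (((k : ℝ) + 1) ^ 2)⁻¹)
    ).comp_hasFDerivAt x h1
  have h3 : cutoff (d := d) m k = (fun y : ℝ => (max 0 y) ^ (m + 2)) ∘
      (fun x : E d => 1 - (1 + ‖x‖ ^ 2) * (((k : ℝ) + 1) ^ 2)⁻¹) := by
    funext y
    simp [cutoff, cutoffBase, div_eq_mul_inv]
  rw [h3, h2.fderiv, norm_smul, norm_neg, norm_smul, ← Nat.cast_smul_eq_nsmul ℝ 2, norm_smul,
    innerSL_apply_norm, ← div_eq_mul_inv]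
  refine le_of_eq ?_
  change ‖_ * cutoffBase k x ^ (m + 1)‖ * _ = _
  have h5 := cutoffBase_nonneg k x
  rw [Real.norm_of_nonneg (by positivity), Real.norm_of_nonneg (by positivity), Nat.cast_ofNat,
    Real.norm_ofNat]
  ring

lemma norm_fderiv_japanese_rpow_le (s : ℝ) :
    ‖fderiv ℝ (fun x : E d => japanese x ^ s) x‖ ≤ |s| * japanese x ^ (s - 1) := by
  have hJ := japanese_pos x
  have hpos : (0 : ℝ) < 1 + ‖x‖ ^ 2 := by positivity
  have h1 : HasFDerivAt (fun x : E d => 1 + ‖x‖ ^ 2) _ x :=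
    (hasStrictFDerivAt_norm_sq x).hasFDerivAt.const_add 1
  have h2 := h1.rpow_const (p := s / 2) (Or.inl hpos.ne')
  simp_rw [japanese_rpow_eq]
  rw [h2.fderiv, norm_smul, ← Nat.cast_smul_eq_nsmul ℝ 2, norm_smul, innerSL_apply_norm]
  have h3 : (1 + ‖x‖ ^ 2) ^ (s / 2 - 1) = japanese x ^ (s - 2) := by
    rw [japanese_rpow_eq]
    congr 1
    ring
  have h4 : (1 + ‖x‖ ^ 2) ^ ((s - 1) / 2) = japanese x ^ (s - 2) * japanese x := by
    rw [← japanese_rpow_eq, ← Real.rpow_add_one hJ.ne']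
    congr 1
    ring
  rw [h3, h4, norm_mul, Real.norm_of_nonneg (Real.rpow_nonneg hJ.le _), Real.norm_eq_abs,
    abs_div, abs_two, Nat.cast_ofNat, Real.norm_ofNat]
  calc |s| / 2 * japanese x ^ (s - 2) * (2 * ‖x‖) = |s| * (japanese x ^ (s - 2) * ‖x‖) := by ring
    _ ≤ _ := by
      gcongr
      exact norm_le_japanese x

lemma norm_fderiv_cutoff_le_div :
    ‖fderiv ℝ (cutoff (d := d) m k) x‖ ≤ 2 * (m + 2) / ((k : ℝ) + 1) := by
  refine (norm_fderiv_cutoff_le m k x).trans ?_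
  by_cases h0 : cutoffBase k x = 0
  · rw [h0]
    simp
    positivity
  · have h1 := (norm_le_japanese x).trans (japanese_lt_of_cutoffBase_ne_zero k x h0).le
    have h2 : cutoffBase k x ^ (m + 1) ≤ 1 :=
      pow_le_one₀ (cutoffBase_nonneg k x) (cutoffBase_le_one k x)
    calc (m + 2) * cutoffBase k x ^ (m + 1) * (2 * ‖x‖ / ((k : ℝ) + 1) ^ 2)
        ≤ (m + 2) * 1 * (2 * ((k : ℝ) + 1) / ((k : ℝ) + 1) ^ 2) := by gcongr
      _ = _ := by field_simp

/-- The gradient of the truncated weight `J ^ s χ` is controlled by `J ^ (s - 1)` and a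
power of `χ`. -/
lemma norm_fderiv_japanese_mul_cutoff_le (s : ℝ) :
    ‖fderiv ℝ (fun x : E d => japanese x ^ s * cutoff m k x) x‖ ≤
      (|s| + 2 * (m + 2)) * (japanese x ^ (s - 1) * cutoffBase k x ^ (m + 1)) := by
  have hJ := japanese_pos x
  have hb0 := cutoffBase_nonneg k x
  have hb1 := cutoffBase_le_one k x
  rw [fderiv_fun_mul ((contDiff_japanese_rpow s).differentiable one_ne_zero x)
    ((contDiff_cutoff m k).differentiable one_ne_zero x)]
  refine (norm_add_le _ _).trans ?_
  rw [norm_smul, norm_smul, Real.norm_of_nonneg (by positivity),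
    Real.norm_of_nonneg (cutoff_nonneg m k x)]
  have h1 : japanese x ^ s * ‖fderiv ℝ (cutoff (d := d) m k) x‖ ≤
      2 * (m + 2) * (japanese x ^ (s - 1) * cutoffBase k x ^ (m + 1)) := by
    by_cases h0 : cutoffBase k x = 0
    · have := norm_fderiv_cutoff_le m k x
      rw [h0] at this
      simp only [ne_eq, Nat.add_eq_zero_iff, one_ne_zero, and_false, not_false_eq_true, zero_pow,
        mul_zero, zero_mul] at this
      rw [le_antisymm this (norm_nonneg _), mul_zero]
      positivity
    · have hJk := (japanese_lt_of_cutoffBase_ne_zero k x h0).le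
      have h2 : japanese x * (2 * ‖x‖ / ((k : ℝ) + 1) ^ 2) ≤ 2 := by
        have h3 := (norm_le_japanese x).trans hJk
        calc japanese x * (2 * ‖x‖ / ((k : ℝ) + 1) ^ 2)
            ≤ ((k : ℝ) + 1) * (2 * ((k : ℝ) + 1) / ((k : ℝ) + 1) ^ 2) := by gcongr
          _ = 2 := by field_simp
      have h3 : japanese x ^ s = japanese x ^ (s - 1) * japanese x := by
        rw [← Real.rpow_add_one hJ.ne']
        congr 1
        ring
      calc japanese x ^ s * ‖fderiv ℝ (cutoff (d := d) m k) x‖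
          ≤ japanese x ^ s *
            ((m + 2) * cutoffBase k x ^ (m + 1) * (2 * ‖x‖ / ((k : ℝ) + 1) ^ 2)) := by
            gcongr
            exact norm_fderiv_cutoff_le m k x
        _ = (m + 2) * (japanese x ^ (s - 1) * cutoffBase k x ^ (m + 1)) *
            (japanese x * (2 * ‖x‖ / ((k : ℝ) + 1) ^ 2)) := by rw [h3]; ring
        _ ≤ (m + 2) * (japanese x ^ (s - 1) * cutoffBase k x ^ (m + 1)) * 2 := by gcongr
        _ = _ := by ring
  have h2 : cutoff m k x * ‖fderiv ℝ (fun x : E d => japanese x ^ s) x‖ ≤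
      |s| * (japanese x ^ (s - 1) * cutoffBase k x ^ (m + 1)) := by
    have h3 : cutoff m k x ≤ cutoffBase k x ^ (m + 1) :=
      pow_le_pow_of_le_one hb0 hb1 (by omega)
    calc _ ≤ cutoffBase k x ^ (m + 1) * (|s| * japanese x ^ (s - 1)) := by
          gcongr
          exact norm_fderiv_japanese_rpow_le x s
      _ = _ := by ring
  linarith

lemma continuous_cutoff : Continuous (cutoff (d := d) m k) := (contDiff_cutoff m k).continuous

lemma contDiff_japanese_mul_cutoff (s : ℝ) :
    ContDiff ℝ 1 (fun x : E d => japanese x ^ s * cutoff m k x) :=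
  (contDiff_japanese_rpow s).mul (contDiff_cutoff m k)

lemma hasCompactSupport_japanese_mul_cutoff (s : ℝ) :
    HasCompactSupport (fun x : E d => japanese x ^ s * cutoff m k x) :=
  (hasCompactSupport_cutoff m k).mul_left

/-- The truncated moments increase to the full moment. -/
lemma tendsto_lintegral_japanese_mul_cutoff (s : ℝ) (μ : Measure (E d)) :
    Tendsto (fun k : ℕ => ∫⁻ x, ENNReal.ofReal (japanese x ^ s * cutoff m k x) ∂μ) atTop
      (𝓝 (smoothMoment s μ)) := by
  refine lintegral_tendsto_of_tendsto_of_monotone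
    (fun k => ((continuous_japanese_rpow s).mul
      (continuous_cutoff m k)).measurable.ennreal_ofReal.aemeasurable)
    (ae_of_all _ fun x => ?_) (ae_of_all _ fun x => ?_)
  · intro a b hab
    refine ENNReal.ofReal_le_ofReal ?_
    exact mul_le_mul_of_nonneg_left (monotone_cutoff m x hab)
      (Real.rpow_nonneg (japanese_pos x).le _)
  · refine (ENNReal.continuous_ofReal.tendsto _).comp ?_
    simpa using (tendsto_cutoff m x).const_mul (japanese x ^ s)

end cutoff

/-! ### Moments along a solution of the continuity equation -/

/-- A sublinear self-bound absorbs: either `M ≤ 2 y`, or `M ≤ 2 k M ^ (1 - α)`. -/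
lemma le_of_le_add_mul_rpow {M y k α : ℝ} (hM : 0 < M) (hy : 0 ≤ y) (hk : 0 ≤ k) (hα : 0 < α)
    (h : M ≤ y + k * M ^ (1 - α)) : M ≤ 2 * y + (2 * k) ^ (1 / α) := by
  have hpos : 0 ≤ (2 * k) ^ (1 / α) := by positivity
  rcases le_total M (2 * y) with h1 | h1
  · linarith
  · -- here `k M ^ (1 - α)` accounts for at least half of `M`
    have h2 : M ≤ 2 * k * M ^ (1 - α) := by linarith
    have h3 : M ^ α ≤ 2 * k := by
      have h4 : M = M ^ α * M ^ (1 - α) := by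
        rw [← Real.rpow_add hM]
        simp
      have h5 : 0 < M ^ (1 - α) := by positivity
      nth_rewrite 1 [h4] at h2
      exact le_of_mul_le_mul_right h2 h5
    have h6 : M ≤ (2 * k) ^ (1 / α) := by
      calc M = (M ^ α) ^ (1 / α) := by rw [← Real.rpow_mul hM.le, mul_one_div_cancel hα.ne',
            Real.rpow_one]
        _ ≤ _ := by gcongr
    linarith

/-- The exponent of the cut-off functions, large compared with `p`. -/
noncomputable def cutoffExponent (p : ℝ) : ℕ := ⌈p⌉₊

/-- The constant in the gradient bound for the truncated weights. -/
noncomputable def gradientConst (p δ : ℝ) : ℝ := |δ| + 2 * (cutoffExponent p + 2)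

lemma gradientConst_pos (p δ : ℝ) : 0 < gradientConst p δ := by
  unfold gradientConst
  positivity

lemma norm_fderiv_japanese_mul_cutoff_le_rpow {d : ℕ} {p α : ℝ} (hp : 1 < p) (hα : 1 / p ≤ α)
    (δ : ℝ) (k : ℕ) (x : E d) :
    ‖fderiv ℝ (fun x : E d => japanese x ^ δ * cutoff (cutoffExponent p) k x) x‖ ≤
      gradientConst p δ * (japanese x ^ (δ - 1) * cutoff (cutoffExponent p) k x ^ (1 - α)) := by
  refine (norm_fderiv_japanese_mul_cutoff_le (cutoffExponent p) k x δ).trans ?_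
  have hJ := japanese_pos x
  have hG := gradientConst_pos p δ
  have hb0 := cutoffBase_nonneg k x
  set m := cutoffExponent p with hm
  have hmp : p ≤ m := Nat.le_ceil p
  have h1 : cutoffBase k x ^ (m + 1) ≤ cutoff m k x ^ (1 - α) := by
    rcases hb0.eq_or_lt with h0 | h0
    · rw [← h0, zero_pow (by omega)]
      exact Real.rpow_nonneg (cutoff_nonneg m k x) _
    · rw [cutoff, ← Real.rpow_natCast, ← Real.rpow_natCast, ← Real.rpow_mul hb0]
      refine Real.rpow_le_rpow_of_exponent_ge h0 (cutoffBase_le_one k x) ?_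
      push_cast
      have h2 : 1 ≤ p * α := by
        rw [div_le_iff₀ (by linarith)] at hα
        linarith
      have h3 : 0 ≤ α := le_trans (by positivity) hα
      nlinarith
  change gradientConst p δ * _ ≤ _
  gcongr

/-- Along a curve of action `A`, the moments at any two times control each other. -/
lemma SolvesContinuity.smoothMoment_add_le {d : ℕ} {p δ α a : ℝ} {L : ℝ≥0∞} {φ : ℝ → E d → ℝ}
    {γ : Measure (E d)} (hF : FluxBound p φ γ δ α a L) (hp : 1 < p) (hα : 1 / p ≤ α) (hα1 : α ≤ 1)
    (ha : 0 < a) (hL : L ≠ ⊤)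
    {μ : ℝ → Measure (E d)} {n : ℝ → VectorRadonMeasure d} {σ η : Measure (E d)}
    (h : SolvesContinuity μ n σ η)
    (hA : ∫⁻ t in Ioo (0 : ℝ) 1, action φ (μ t) (n t) γ ≠ ⊤)
    {s t : ℝ} (hs : s ∈ Icc (0 : ℝ) 1) (ht : t ∈ Icc (0 : ℝ) 1) :
    smoothMoment δ (μ t) + L ≤ 2 * (smoothMoment δ (μ s) + L) +
      ENNReal.ofReal ((2 * (gradientConst p δ * a *
        (∫⁻ t in Ioo (0 : ℝ) 1, action φ (μ t) (n t) γ).toReal ^ (1 / p))) ^ (1 / α)) := by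
  set A := ∫⁻ t in Ioo (0 : ℝ) 1, action φ (μ t) (n t) γ with hAd
  set m := cutoffExponent p with hm
  set b : ℝ := (2 * (gradientConst p δ * a * A.toReal ^ (1 / p))) ^ (1 / α) with hb
  have hG := gradientConst_pos p δ
  have hα0 : 0 < α := lt_of_lt_of_le (by positivity) hα
  have hk : 0 ≤ gradientConst p δ * a * A.toReal ^ (1 / p) := by positivity
  have hb0 : 0 ≤ b := by positivity
  refine le_of_tendsto ((tendsto_lintegral_japanese_mul_cutoff m δ (μ t)).add_const L)
    (Eventually.of_forall fun k => ?_)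
  set g : E d → ℝ := fun x => japanese x ^ δ * cutoff m k x with hg
  have hgC : ContDiff ℝ 1 g := contDiff_japanese_mul_cutoff m k δ
  have hgc : HasCompactSupport g := hasCompactSupport_japanese_mul_cutoff m k δ
  have hg0 : ∀ x, 0 ≤ g x := fun x =>
    mul_nonneg (Real.rpow_nonneg (japanese_pos x).le _) (cutoff_nonneg m k x)
  -- truncated moments, as real numbers
  set y : ℝ → ℝ := fun τ => (∫ x, g x ∂(μ τ)) + L.toReal with hy
  have hyE : ∀ τ ∈ Icc (0 : ℝ) 1,
      ∫⁻ x, ENNReal.ofReal (g x) ∂(μ τ) + L = ENNReal.ofReal (y τ) := by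
    intro τ hτ
    have := h.locallyFinite τ hτ
    rw [hy, ENNReal.ofReal_add (integral_nonneg hg0) ENNReal.toReal_nonneg,
      ENNReal.ofReal_toReal hL, ofReal_integral_eq_lintegral_ofReal
        (hgC.continuous.integrable_of_hasCompactSupport hgc) (ae_of_all _ hg0)]
  have hy0 : ∀ τ, 0 ≤ y τ := fun τ => add_nonneg (integral_nonneg hg0) ENNReal.toReal_nonneg
  have hyc : ContinuousOn y (Icc 0 1) :=
    (h.weakStar_continuous g hgC.continuous hgc).add continuousOn_const
  obtain ⟨τm, hτm, hmax⟩ := isCompact_Icc.exists_isMaxOn ⟨s, hs⟩ hyc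
  have hMle : y τm ≤ 2 * y s + b := by
    rcases (hy0 τm).eq_or_lt with h0 | h0
    · rw [← h0]
      have := hy0 s
      positivity
    · refine le_of_le_add_mul_rpow h0 (hy0 s) hk hα0 ?_
      have h1 := h.abs_sub_le_of_fluxBound hF hp hα1 ha hA
        (continuous_cutoff m k).measurable (cutoff_nonneg m k) (cutoff_le_one m k) h0
        (fun τ hτ => by
          have hτ' := Ioo_subset_Icc_self hτ
          change ∫⁻ x, ENNReal.ofReal (g x) ∂(μ τ) + L ≤ _
          rw [hyE τ hτ']
          exact ENNReal.ofReal_le_ofReal (hmax hτ'))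
        hgC hgc hG (norm_fderiv_japanese_mul_cutoff_le_rpow hp hα δ k) hs hτm
      have h2 := (abs_le.1 h1).2
      have h3 : y τm - y s = (∫ x, g x ∂(μ τm)) - ∫ x, g x ∂(μ s) := by simp [hy]
      rw [← hAd] at h2
      linarith
  calc ∫⁻ x, ENNReal.ofReal (g x) ∂(μ t) + L = ENNReal.ofReal (y t) := hyE t ht
    _ ≤ ENNReal.ofReal (2 * y s + b) := ENNReal.ofReal_le_ofReal ((hmax ht).trans hMle)
    _ = 2 * (∫⁻ x, ENNReal.ofReal (g x) ∂(μ s) + L) + ENNReal.ofReal b := by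
      have := hy0 s
      rw [ENNReal.ofReal_add (by positivity) hb0, ENNReal.ofReal_mul zero_le_two, hyE s hs,
        ENNReal.ofReal_ofNat]
    _ ≤ _ := by
      gcongr
      unfold smoothMoment
      gcongr with x
      exact mul_le_of_le_one_right (Real.rpow_nonneg (japanese_pos x).le _) (cutoff_le_one m k x)

/-- Test functions whose gradient grows like `J ^ (δ - 1)` have, along a curve of small action,
integrals that vary little; the constant only depends on a bound for the moment at one time. -/
lemma exists_const_test_le {d : ℕ} {p δ α a : ℝ} {L : ℝ≥0∞} {φ : ℝ → E d → ℝ}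
    {γ : Measure (E d)} (hF : FluxBound p φ γ δ α a L) (hp : 1 < p) (hα : 1 / p ≤ α) (hα1 : α ≤ 1)
    (ha : 0 < a) (hL : L ≠ ⊤) {b : ℝ≥0∞} (hb : b ≠ ⊤) (B : ℝ) :
    ∃ C : ℝ, 0 < C ∧ ∀ (μ : ℝ → Measure (E d)) (n : ℝ → VectorRadonMeasure d) (σ η : Measure (E d)),
      SolvesContinuity μ n σ η → ∫⁻ t in Ioo (0 : ℝ) 1, action φ (μ t) (n t) γ ≠ ⊤ →
      (∫⁻ t in Ioo (0 : ℝ) 1, action φ (μ t) (n t) γ).toReal ^ (1 / p) ≤ B →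
      ∀ s ∈ Icc (0 : ℝ) 1, ∀ t ∈ Icc (0 : ℝ) 1, smoothMoment δ (μ s) ≤ b →
      smoothMoment δ (μ t) ≠ ⊤ ∧
      ∀ g : E d → ℝ, ContDiff ℝ 1 g → HasCompactSupport g → ∀ G : ℝ, 0 < G →
        (∀ x, ‖fderiv ℝ g x‖ ≤ G * japanese x ^ (δ - 1)) →
        |(∫ x, g x ∂(μ t)) - ∫ x, g x ∂(μ s)| ≤
          G * C * (∫⁻ t in Ioo (0 : ℝ) 1, action φ (μ t) (n t) γ).toReal ^ (1 / p) := by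
  have hG := gradientConst_pos p δ
  have hα0 : 0 < α := lt_of_lt_of_le (by positivity) hα
  set c : ℝ := (2 * (gradientConst p δ * a * max B 0)) ^ (1 / α) with hc
  have hc0 : 0 ≤ c := by positivity
  set X : ℝ := (2 * (b + L)).toReal + c + 1 with hX
  have hX0 : 0 < X := by positivity
  refine ⟨a * X ^ (1 - α), by positivity, fun μ n σ η h hA hB s hs t ht hsb => ?_⟩
  have hXb : ∀ τ ∈ Icc (0 : ℝ) 1, smoothMoment δ (μ τ) + L ≤ ENNReal.ofReal X := by
    intro τ hτ
    refine (h.smoothMoment_add_le hF hp hα hα1 ha hL hA hs hτ).trans ?_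
    have h1 : 2 * (b + L) ≠ ⊤ :=
      ENNReal.mul_ne_top ENNReal.ofNat_ne_top (ENNReal.add_ne_top.2 ⟨hb, hL⟩)
    have h2 : (2 * (gradientConst p δ * a * (∫⁻ t in Ioo (0 : ℝ) 1,
        action φ (μ t) (n t) γ).toReal ^ (1 / p))) ^ (1 / α) ≤ c := by
      rw [hc]
      gcongr
      exact hB.trans (le_max_left _ _)
    calc _ ≤ 2 * (b + L) + ENNReal.ofReal c := by gcongr
      _ = ENNReal.ofReal ((2 * (b + L)).toReal + c) := by
          rw [ENNReal.ofReal_add ENNReal.toReal_nonneg hc0, ENNReal.ofReal_toReal h1]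
      _ ≤ _ := ENNReal.ofReal_le_ofReal (by linarith)
  refine ⟨ne_top_of_le_ne_top ENNReal.ofReal_ne_top (le_self_add.trans (hXb t ht)), ?_⟩
  intro g hgC hgc G hG0 hgG
  have h1 := h.abs_sub_le_of_fluxBound hF hp hα1 ha hA (u := fun _ => 1) measurable_const
    (fun _ => zero_le_one) (fun _ => le_rfl) hX0
    (fun τ hτ => by simpa [smoothMoment] using hXb τ (Ioo_subset_Icc_self hτ))
    hgC hgc hG0 (by simpa using hgG) hs ht
  refine h1.trans (le_of_eq ?_)
  ring

/-! ### Couplings -/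

/-- The optimal transport cost `inf ∫ |x - y| ^ s dπ` over the couplings `π`, that is, the
`s`-th power of the Wasserstein distance of order `s`. -/
noncomputable def transportCost {d : ℕ} (s : ℝ) (μ η : Measure (E d)) : ℝ≥0∞ :=
  ⨅ (π : Measure (E d × E d)) (_ : π.map Prod.fst = μ ∧ π.map Prod.snd = η),
    ∫⁻ z, edist z.1 z.2 ^ s ∂π

lemma wassersteinDist_eq {d : ℕ} {s : ℝ} (hs : 0 < s) (μ η : Measure (E d)) :
    wassersteinDist s μ η = transportCost s μ η ^ (1 / s) := by
  simp only [transportCost, wassersteinDist,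
    ← ENNReal.orderIsoRpow_apply (1 / s) (one_div_pos.2 hs), OrderIso.map_iInf]

lemma wassersteinDist_comm {d : ℕ} (s : ℝ) (μ η : Measure (E d)) :
    wassersteinDist s μ η = wassersteinDist s η μ := by
  have h : ∀ μ η : Measure (E d), wassersteinDist s μ η ≤ wassersteinDist s η μ := by
    intro μ η
    refine le_iInf₂ fun π hπ => iInf₂_le_of_le (π.map Prod.swap) ⟨?_, ?_⟩ ?_
    · rw [Measure.map_map measurable_fst measurable_swap]
      exact hπ.2
    · rw [Measure.map_map measurable_snd measurable_swap]
      exact hπ.1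
    · rw [lintegral_map (by fun_prop) measurable_swap]
      simp [edist_comm]
  exact le_antisymm (h μ η) (h η μ)

lemma transportCost_add_le {d : ℕ} (s : ℝ) (μ₁ η₁ μ₂ η₂ : Measure (E d)) :
    transportCost s (μ₁ + μ₂) (η₁ + η₂) ≤ transportCost s μ₁ η₁ + transportCost s μ₂ η₂ := by
  simp only [transportCost, ENNReal.iInf_add, ENNReal.add_iInf]
  refine le_iInf₂ fun π₂ h₂ => le_iInf₂ fun π₁ h₁ => iInf₂_le_of_le (π₁ + π₂) ⟨?_, ?_⟩ ?_
  · rw [Measure.map_add _ _ measurable_fst, h₁.1, h₂.1]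
  · rw [Measure.map_add _ _ measurable_snd, h₁.2, h₂.2]
  · rw [lintegral_add_measure]

lemma transportCost_sum_le {d : ℕ} (s : ℝ) {ι : Type*} (t : Finset ι) (μ η : ι → Measure (E d)) :
    transportCost s (∑ i ∈ t, μ i) (∑ i ∈ t, η i) ≤ ∑ i ∈ t, transportCost s (μ i) (η i) := by
  classical
  induction t using Finset.induction with
  | empty =>
    simp only [Finset.sum_empty]
    exact iInf₂_le_of_le 0 (by simp) (by simp)
  | insert i t hi ih =>
    rw [Finset.sum_insert hi, Finset.sum_insert hi, Finset.sum_insert hi]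
    exact (transportCost_add_le _ _ _ _ _).trans (by gcongr)

lemma exists_coupling {d : ℕ} (μ η : Measure (E d)) [IsFiniteMeasure μ] [IsFiniteMeasure η]
    (h : μ univ = η univ) :
    ∃ π : Measure (E d × E d), π.map Prod.fst = μ ∧ π.map Prod.snd = η := by
  by_cases h0 : μ univ = 0
  · have hη : η = 0 := Measure.measure_univ_eq_zero.1 (by rw [← h, h0])
    have hμ : μ = 0 := Measure.measure_univ_eq_zero.1 h0
    exact ⟨0, by simp [hμ, hη]⟩
  · refine ⟨(μ univ)⁻¹ • μ.prod η, ?_, ?_⟩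
    · rw [Measure.map_smul, Measure.map_fst_prod, smul_smul, ← h,
        ENNReal.inv_mul_cancel h0 (measure_ne_top _ _), one_smul]
    · rw [Measure.map_smul, Measure.map_snd_prod, smul_smul,
        ENNReal.inv_mul_cancel h0 (measure_ne_top _ _), one_smul]

/-- The part of two measures that is not matched locally costs at most their moments. -/
lemma transportCost_le_smoothMoment {d : ℕ} {s : ℝ} (hs : 0 ≤ s) (μ η : Measure (E d))
    [IsFiniteMeasure μ] [IsFiniteMeasure η] (h : μ univ = η univ) :
    transportCost s μ η ≤ 2 ^ s * (smoothMoment s μ + smoothMoment s η) := by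
  obtain ⟨π, h1, h2⟩ := exists_coupling μ η h
  have hm : Measurable (fun x : E d => ENNReal.ofReal (japanese x ^ s)) :=
    (continuous_japanese_rpow s).measurable.ennreal_ofReal
  refine iInf₂_le_of_le π ⟨h1, h2⟩ ?_
  have hpt : ∀ x y : E d, edist x y ^ s ≤
      2 ^ s * (ENNReal.ofReal (japanese x ^ s) + ENNReal.ofReal (japanese y ^ s)) := by
    intro x y
    have hx := japanese_pos x
    have hy := japanese_pos y
    have h3 : edist x y ≤ ENNReal.ofReal (2 * max (japanese x) (japanese y)) := by
      rw [edist_dist]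
      refine ENNReal.ofReal_le_ofReal ?_
      have h4 := norm_le_japanese x
      have h5 := norm_le_japanese y
      have h6 := le_max_left (japanese x) (japanese y)
      have h7 := le_max_right (japanese x) (japanese y)
      have h8 : dist x y ≤ ‖x‖ + ‖y‖ := dist_le_norm_add_norm x y
      linarith
    calc edist x y ^ s ≤ ENNReal.ofReal (2 * max (japanese x) (japanese y)) ^ s := by gcongr
      _ = 2 ^ s * ENNReal.ofReal ((max (japanese x) (japanese y)) ^ s) := by
        rw [ENNReal.ofReal_mul zero_le_two, ENNReal.mul_rpow_of_nonneg _ _ hs,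
          ENNReal.ofReal_ofNat, ENNReal.ofReal_rpow_of_nonneg (by positivity) hs]
      _ ≤ _ := by
        gcongr
        rcases max_choice (japanese x) (japanese y) with h4 | h4 <;> rw [h4]
        · exact le_self_add
        · exact le_add_self
  calc ∫⁻ z, edist z.1 z.2 ^ s ∂π
      ≤ ∫⁻ z, 2 ^ s * (ENNReal.ofReal (japanese z.1 ^ s) + ENNReal.ofReal (japanese z.2 ^ s)) ∂π :=
        lintegral_mono fun z => hpt z.1 z.2
    _ = 2 ^ s * (∫⁻ z, ENNReal.ofReal (japanese z.1 ^ s) ∂π +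
          ∫⁻ z, ENNReal.ofReal (japanese z.2 ^ s) ∂π) := by
        rw [lintegral_const_mul' _ _ (ENNReal.rpow_ne_top_of_nonneg hs ENNReal.ofNat_ne_top),
          lintegral_add_left (f := fun z : E d × E d => ENNReal.ofReal (japanese z.1 ^ s))
            (hm.comp measurable_fst)]
    _ = _ := by
        rw [smoothMoment, smoothMoment, ← h1, ← h2, lintegral_map hm measurable_fst,
          lintegral_map hm measurable_snd]

lemma transportCost_le_of_subset {d : ℕ} {s : ℝ} (hs : 0 ≤ s) (μ η : Measure (E d))
    [IsFiniteMeasure μ] [IsFiniteMeasure η] (h : μ univ = η univ) {S : Set (E d)}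
    (hμS : μ Sᶜ = 0) (hηS : η Sᶜ = 0) {e : ℝ≥0∞}
    (he : ∀ x ∈ S, ∀ y ∈ S, edist x y ≤ e) : transportCost s μ η ≤ e ^ s * μ univ := by
  obtain ⟨π, h1, h2⟩ := exists_coupling μ η h
  refine iInf₂_le_of_le π ⟨h1, h2⟩ ?_
  have e1 : ∀ᵐ z ∂π, z.1 ∈ S := by
    rw [← h1] at hμS
    exact ae_of_ae_map measurable_fst.aemeasurable hμS
  have e2 : ∀ᵐ z ∂π, z.2 ∈ S := by
    rw [← h2] at hηS
    exact ae_of_ae_map measurable_snd.aemeasurable hηS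
  calc ∫⁻ z, edist z.1 z.2 ^ s ∂π ≤ ∫⁻ _, e ^ s ∂π := by
        refine lintegral_mono_ae ?_
        filter_upwards [e1, e2] with z h3 h4
        exact ENNReal.rpow_le_rpow (he _ h3 _ h4) hs
    _ = e ^ s * μ univ := by
        rw [lintegral_const, ← h1, Measure.map_apply measurable_fst MeasurableSet.univ,
          preimage_univ]

/-- Splitting off from `η` submeasures of prescribed masses `m i`, proportional to `f i η`. The
moment of the rest is controlled by the tail and by the masses that were left behind. -/
lemma exists_split {d : ℕ} {s R : ℝ} (hs : 0 ≤ s) (η : Measure (E d))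
    [IsFiniteMeasure η] {ι : Type*}
    [Fintype ι] {f : ι → E d → ℝ≥0∞} (hf : ∀ i, Measurable (f i)) (hf1 : ∀ x, ∑ i, f i x ≤ 1)
    (hfR : ∀ i x, f i x ≠ 0 → japanese x ≤ R) {m : ι → ℝ≥0∞} (hm : ∀ i, m i ≤ ∫⁻ x, f i x ∂η) :
    ∃ (α : ι → Measure (E d)) (α₀ : Measure (E d)), (∑ i, α i) + α₀ = η ∧ (∀ i, α i univ = m i) ∧
      (∀ i, α i {x | f i x = 0} = 0) ∧
      smoothMoment s α₀ ≤ ∫⁻ x, ENNReal.ofReal (japanese x ^ s) * (1 - ∑ i, f i x) ∂η +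
        ENNReal.ofReal (R ^ s) * ∑ i, (∫⁻ x, f i x ∂η - m i) := by
  set a : ι → ℝ≥0∞ := fun i => ∫⁻ x, f i x ∂η with ha
  have hfle : ∀ i x, f i x ≤ 1 := fun i x =>
    (Finset.single_le_sum (f := fun i => f i x) (fun _ _ => zero_le) (Finset.mem_univ i)).trans
      (hf1 x)
  have hat : ∀ i, a i ≠ ⊤ := by
    intro i
    refine ne_top_of_le_ne_top (measure_ne_top η univ) ?_
    calc a i ≤ ∫⁻ _, 1 ∂η := lintegral_mono (hfle i)
      _ = η univ := by simp
  set c : ι → ℝ≥0∞ := fun i => m i / a i with hc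
  have hc1 : ∀ i, c i ≤ 1 := fun i => ENNReal.div_le_of_le_mul (by simpa using hm i)
  have hca : ∀ i, c i * a i = m i := by
    intro i
    by_cases h0 : a i = 0
    · have : m i = 0 := le_antisymm (h0 ▸ hm i) zero_le
      simp [h0, this]
    · exact ENNReal.div_mul_cancel h0 (hat i)
  have hcm : ∀ i, Measurable (fun x => c i * f i x) := fun i => (hf i).const_mul _
  have hsum : ∀ x, ∑ i, c i * f i x ≤ ∑ i, f i x := fun x =>
    Finset.sum_le_sum fun i _ => mul_le_of_le_one_left zero_le (hc1 i)
  refine ⟨fun i => η.withDensity (fun x => c i * f i x),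
    η.withDensity (fun x => 1 - ∑ i, c i * f i x), ?_, ?_, ?_, ?_⟩
  · have h1 : ∑ i, η.withDensity (fun x => c i * f i x) =
        η.withDensity (fun x => ∑ i, c i * f i x) := by
      refine Measure.ext fun S hS => ?_
      rw [Measure.finsetSum_apply, withDensity_apply _ hS, lintegral_finsetSum _ fun i _ => hcm i]
      exact Finset.sum_congr rfl fun i _ => withDensity_apply _ hS
    rw [h1, ← withDensity_add_left (Finset.measurable_fun_sum _ fun i _ => hcm i)]
    conv_rhs => rw [← withDensity_one (μ := η)]
    congr 1
    ext x
    exact add_tsub_cancel_of_le ((hsum x).trans (hf1 x))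
  · intro i
    rw [withDensity_apply _ MeasurableSet.univ, setLIntegral_univ, lintegral_const_mul _ (hf i)]
    exact hca i
  · intro i
    have hS : MeasurableSet {x | f i x = 0} := hf i (measurableSet_singleton 0)
    rw [withDensity_apply _ hS]
    refine (setLIntegral_congr_fun (g := fun _ => 0) hS fun x hx => ?_).trans (by simp)
    have : f i x = 0 := hx
    simp [this]
  · have hJ : Measurable (fun x : E d => ENNReal.ofReal (japanese x ^ s)) :=
      (continuous_japanese_rpow s).measurable.ennreal_ofReal
    have hpt : ∀ x, 1 - ∑ i, c i * f i x ≤ (1 - ∑ i, f i x) + ∑ i, (1 - c i) * f i x := by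
      intro x
      rw [tsub_le_iff_right, add_assoc, ← Finset.sum_add_distrib]
      simp_rw [← add_mul, fun i => tsub_add_cancel_of_le (hc1 i), one_mul]
      exact (tsub_add_cancel_of_le (hf1 x)).ge
    have hfm : ∀ i, ∫⁻ x, ENNReal.ofReal (japanese x ^ s) * ((1 - c i) * f i x) ∂η ≤
        ENNReal.ofReal (R ^ s) * (a i - m i) := by
      intro i
      calc ∫⁻ x, ENNReal.ofReal (japanese x ^ s) * ((1 - c i) * f i x) ∂η
          ≤ ∫⁻ x, ENNReal.ofReal (R ^ s) * ((1 - c i) * f i x) ∂η := by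
            refine lintegral_mono fun x => ?_
            by_cases h0 : f i x = 0
            · simp [h0]
            · have := japanese_pos x
              dsimp only
              gcongr
              exact hfR i x h0
        _ = ENNReal.ofReal (R ^ s) * ((1 - c i) * a i) := by
            rw [lintegral_const_mul' _ _ ENNReal.ofReal_ne_top, lintegral_const_mul _ (hf i)]
        _ = _ := by
            rw [ENNReal.sub_mul fun _ _ => hat i, one_mul, hca]
    have hden : Measurable (fun x => 1 - ∑ i, c i * f i x) :=
      measurable_const.sub (Finset.measurable_fun_sum _ fun i _ => hcm i)
    calc smoothMoment s (η.withDensity (fun x => 1 - ∑ i, c i * f i x))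
        = ∫⁻ x, ENNReal.ofReal (japanese x ^ s) * (1 - ∑ i, c i * f i x) ∂η := by
          rw [smoothMoment, lintegral_withDensity_eq_lintegral_mul _ hden hJ]
          simp [mul_comm]
      _ ≤ ∫⁻ x, (ENNReal.ofReal (japanese x ^ s) * (1 - ∑ i, f i x) +
            ∑ i, ENNReal.ofReal (japanese x ^ s) * ((1 - c i) * f i x)) ∂η := by
          refine lintegral_mono fun x => ?_
          rw [← Finset.mul_sum, ← mul_add]
          exact mul_le_mul_right (hpt x) _
      _ = ∫⁻ x, ENNReal.ofReal (japanese x ^ s) * (1 - ∑ i, f i x) ∂η +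
            ∑ i, ∫⁻ x, ENNReal.ofReal (japanese x ^ s) * ((1 - c i) * f i x) ∂η := by
          rw [lintegral_add_left
            (f := fun x => ENNReal.ofReal (japanese x ^ s) * (1 - ∑ i, f i x))
            (hJ.mul (measurable_const.sub (Finset.measurable_fun_sum _ fun i _ => hf i))),
            lintegral_finsetSum (f := fun i x => ENNReal.ofReal (japanese x ^ s) *
              ((1 - c i) * f i x)) _ fun i _ => hJ.mul ((hf i).const_mul _)]
      _ ≤ _ := by
          rw [Finset.mul_sum]
          gcongr with i
          exact hfm i

/-- The cost of the coupling that matches as much mass as possible inside the small sets `S i`, and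
the rest arbitrarily. -/
lemma transportCost_le_of_partition {d : ℕ} {s R : ℝ} (hs : 0 ≤ s)
    (η η' : Measure (E d)) [IsFiniteMeasure η] [IsFiniteMeasure η'] (hm : η univ = η' univ)
    {ι : Type*} [Fintype ι] {f : ι → E d → ℝ≥0∞} (hf : ∀ i, Measurable (f i))
    (hf1 : ∀ x, ∑ i, f i x ≤ 1) (hfR : ∀ i x, f i x ≠ 0 → japanese x ≤ R) {S : ι → Set (E d)}
    (hfS : ∀ i x, x ∉ S i → f i x = 0) {e : ℝ≥0∞}
    (he : ∀ i, ∀ x ∈ S i, ∀ y ∈ S i, edist x y ≤ e) :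
    transportCost s η η' ≤ e ^ s * η univ + 2 ^ s *
      ((∫⁻ x, ENNReal.ofReal (japanese x ^ s) * (1 - ∑ i, f i x) ∂η +
        ENNReal.ofReal (R ^ s) * ∑ i, (∫⁻ x, f i x ∂η - ∫⁻ x, f i x ∂η')) +
      (∫⁻ x, ENNReal.ofReal (japanese x ^ s) * (1 - ∑ i, f i x) ∂η' +
        ENNReal.ofReal (R ^ s) * ∑ i, (∫⁻ x, f i x ∂η' - ∫⁻ x, f i x ∂η))) := by
  set m : ι → ℝ≥0∞ := fun i => min (∫⁻ x, f i x ∂η) (∫⁻ x, f i x ∂η') with hmd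
  obtain ⟨α, α₀, hα, hαm, hαS, hα₀⟩ := exists_split hs η hf hf1 hfR
    (m := m) (fun i => min_le_left _ _)
  obtain ⟨β, β₀, hβ, hβm, hβS, hβ₀⟩ := exists_split hs η' hf hf1 hfR
    (m := m) (fun i => min_le_right _ _)
  have hmass : ∀ (κ : ι → Measure (E d)) (κ₀ ζ : Measure (E d)), (∑ i, κ i) + κ₀ = ζ →
      (∀ i, κ i univ = m i) → ∑ i, m i + κ₀ univ = ζ univ := by
    intro κ κ₀ ζ h1 h2
    rw [← h1, Measure.add_apply, Measure.finsetSum_apply]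
    simp_rw [h2]
  have h1 := hmass α α₀ η hα hαm
  have h2 := hmass β β₀ η' hβ hβm
  have hmle : ∑ i, m i ≤ η univ := by rw [← h1]; exact le_self_add
  have hmt : ∑ i, m i ≠ ⊤ := ne_top_of_le_ne_top (measure_ne_top _ _) hmle
  have hmit : ∀ i, m i ≠ ⊤ := fun i =>
    ne_top_of_le_ne_top hmt (Finset.single_le_sum (fun _ _ => zero_le) (Finset.mem_univ i))
  have hfin : ∀ i, IsFiniteMeasure (α i) ∧ IsFiniteMeasure (β i) := fun i =>
    ⟨⟨by rw [hαm]; exact (hmit i).lt_top⟩, ⟨by rw [hβm]; exact (hmit i).lt_top⟩⟩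
  have : IsFiniteMeasure α₀ := ⟨by
    refine lt_of_le_of_lt ?_ (measure_lt_top η univ)
    rw [← h1]; exact le_add_self⟩
  have : IsFiniteMeasure β₀ := ⟨by
    refine lt_of_le_of_lt ?_ (measure_lt_top η' univ)
    rw [← h2]; exact le_add_self⟩
  have h0 : α₀ univ = β₀ univ := by
    have h3 : ∑ i, m i + α₀ univ = ∑ i, m i + β₀ univ := by rw [h1, h2, hm]
    exact (ENNReal.add_right_inj hmt).1 h3
  have hnull : ∀ (κ : Measure (E d)) i, κ {x | f i x = 0} = 0 → κ (S i)ᶜ = 0 := fun κ i hκ =>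
    measure_mono_null (fun x hx => hfS i x hx) hκ
  have hloc : ∀ i, transportCost s (α i) (β i) ≤ e ^ s * m i := by
    intro i
    have := (hfin i).1
    have := (hfin i).2
    rw [← hαm i]
    exact transportCost_le_of_subset hs (α i) (β i) (by rw [hαm, hβm])
      (hnull _ i (hαS i)) (hnull _ i (hβS i)) (he i)
  have hsub1 : ∀ i, ∫⁻ x, f i x ∂η - m i = ∫⁻ x, f i x ∂η - ∫⁻ x, f i x ∂η' := fun i => tsub_min
  have hsub2 : ∀ i, ∫⁻ x, f i x ∂η' - m i = ∫⁻ x, f i x ∂η' - ∫⁻ x, f i x ∂η := fun i => by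
    rw [hmd]
    dsimp only
    rw [min_comm]
    exact tsub_min
  simp_rw [hsub1] at hα₀
  simp_rw [hsub2] at hβ₀
  conv_lhs => rw [← hα, ← hβ]
  refine (transportCost_add_le _ _ _ _ _).trans (add_le_add ?_ ?_)
  · refine (transportCost_sum_le _ _ _ _).trans ((Finset.sum_le_sum fun i _ => hloc i).trans ?_)
    rw [← Finset.mul_sum]
    gcongr
  · refine (transportCost_le_smoothMoment hs α₀ β₀ h0).trans ?_
    gcongr

/-! ### From weak convergence to convergence in the Wasserstein distance -/

open scoped Manifold ContDiff in
/-- A cut-off function is a finite sum of nonnegative test functions with small supports: multiply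
it by a smooth partition of unity of a ball that contains its support. -/
lemma exists_smooth_decomposition {d : ℕ} (m k : ℕ) {e : ℝ} (he : 0 < e) :
    ∃ (ι : Type) (_ : Fintype ι) (ψ : ι → E d → ℝ) (c : ι → E d), (∀ i, ContDiff ℝ 1 (ψ i)) ∧
      (∀ i, HasCompactSupport (ψ i)) ∧ (∀ i x, 0 ≤ ψ i x) ∧
      (∀ x, ∑ i, ψ i x = cutoff m k x) ∧ ∀ i x, x ∉ Metric.ball (c i) e → ψ i x = 0 := by
  classical
  obtain ⟨t, -, htf, ht⟩ :=
    (isCompact_closedBall (0 : E d) (k + 1)).finite_cover_balls he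
  have : Fintype t := htf.fintype
  obtain ⟨ρ, hρ⟩ := SmoothPartitionOfUnity.exists_isSubordinate 𝓘(ℝ, E d)
    (Metric.isClosed_closedBall (x := (0 : E d)) (ε := (k : ℝ) + 1))
    (fun i : t => Metric.ball (i : E d) e) (fun i => Metric.isOpen_ball)
    (by
      intro x hx
      obtain ⟨y, hy, hxy⟩ := mem_iUnion₂.1 (ht hx)
      exact mem_iUnion.2 ⟨⟨y, hy⟩, hxy⟩)
  let eq : Fin (Fintype.card t) ≃ t := (Fintype.equivFin t).symm
  refine ⟨Fin (Fintype.card t), inferInstance, fun i x => ρ (eq i) x * cutoff m k x,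
    fun i => (eq i : E d), fun i => ?_, fun i => (hasCompactSupport_cutoff m k).mul_left,
    fun i x => mul_nonneg (ρ.nonneg _ x) (cutoff_nonneg m k x), fun x => ?_, fun i x hx => ?_⟩
  · have h1 : ContDiff ℝ ∞ (ρ (eq i)) := (ρ (eq i)).contMDiff.contDiff
    exact (h1.of_le (by norm_cast)).mul (contDiff_cutoff m k)
  · rw [← Finset.sum_mul]
    by_cases h0 : cutoffBase k x = 0
    · simp [cutoff, h0]
    · have hx : x ∈ Metric.closedBall (0 : E d) (k + 1) := by
        rw [mem_closedBall_zero_iff]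
        exact (norm_le_japanese x).trans (japanese_lt_of_cutoffBase_ne_zero k x h0).le
      have h1 := ρ.sum_eq_one hx
      rw [finsum_eq_sum_of_fintype] at h1
      rw [Equiv.sum_comp eq (fun i => ρ i x), h1, one_mul]
  · have h1 : ρ (eq i) x = 0 := image_eq_zero_of_notMem_tsupport fun h => hx (hρ (eq i) h)
    simp [h1]

lemma lintegral_ofReal_eq_ofReal_integral {d : ℕ} {μ : Measure (E d)} [IsLocallyFiniteMeasure μ]
    {g : E d → ℝ} (hg : Continuous g) (hgc : HasCompactSupport g) (hg0 : ∀ x, 0 ≤ g x) :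
    ∫⁻ x, ENNReal.ofReal (g x) ∂μ = ENNReal.ofReal (∫ x, g x ∂μ) :=
  (ofReal_integral_eq_lintegral_ofReal (hg.integrable_of_hasCompactSupport hgc)
    (ae_of_all _ hg0)).symm

lemma lintegral_tail_eq {d : ℕ} (m k : ℕ) (s : ℝ) (μ : Measure (E d)) [IsLocallyFiniteMeasure μ] :
    ∫⁻ x, ENNReal.ofReal (japanese x ^ s) * (1 - ENNReal.ofReal (cutoff m k x)) ∂μ =
      smoothMoment s μ - ENNReal.ofReal (∫ x, japanese x ^ s * cutoff m k x ∂μ) := by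
  have h0 : ∀ x : E d, 0 ≤ japanese x ^ s := fun x => Real.rpow_nonneg (japanese_pos x).le _
  have hm : Measurable (fun x : E d => ENNReal.ofReal (japanese x ^ s * cutoff m k x)) :=
    ((continuous_japanese_rpow s).mul (continuous_cutoff m k)).measurable.ennreal_ofReal
  have h1 := lintegral_ofReal_eq_ofReal_integral (μ := μ)
    (g := fun x => japanese x ^ s * cutoff m k x)
    ((continuous_japanese_rpow s).mul (continuous_cutoff m k))
    (hasCompactSupport_japanese_mul_cutoff m k s)
    (fun x => mul_nonneg (h0 x) (cutoff_nonneg m k x))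
  rw [← h1, smoothMoment, ← lintegral_sub hm (by rw [h1]; exact ENNReal.ofReal_ne_top)]
  · refine lintegral_congr fun x => ?_
    rw [← ENNReal.ofReal_one, ← ENNReal.ofReal_sub _ (cutoff_nonneg m k x),
      ← ENNReal.ofReal_sub _ (mul_nonneg (h0 x) (cutoff_nonneg m k x)), ← ENNReal.ofReal_mul (h0 x)]
    congr 1
    ring
  · exact ae_of_all _ fun x => ENNReal.ofReal_le_ofReal
      (mul_le_of_le_one_right (h0 x) (cutoff_le_one m k x))

lemma tendsto_ofReal_integral_cutoff {d : ℕ} (m : ℕ) (s : ℝ) (μ : Measure (E d))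
    [IsLocallyFiniteMeasure μ] :
    Tendsto (fun k : ℕ => ENNReal.ofReal (∫ x, japanese x ^ s * cutoff m k x ∂μ)) atTop
      (𝓝 (smoothMoment s μ)) := by
  refine (tendsto_lintegral_japanese_mul_cutoff m s μ).congr fun k => ?_
  exact lintegral_ofReal_eq_ofReal_integral
    ((continuous_japanese_rpow s).mul (continuous_cutoff m k))
    (hasCompactSupport_japanese_mul_cutoff m k s)
    (fun x => mul_nonneg (Real.rpow_nonneg (japanese_pos x).le _) (cutoff_nonneg m k x))

/-- Convergence of the integrals of test functions and of the moments of order `s`, for measures of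
equal mass, implies convergence in the Wasserstein distance of order `s`. -/
lemma tendsto_wassersteinDist {d : ℕ} {s : ℝ} (hs : 0 < s) {X : Type*} {l : Filter X}
    {η : X → Measure (E d)} {η' : Measure (E d)} [∀ k, IsFiniteMeasure (η k)] [IsFiniteMeasure η']
    (hmass : ∀ k, η k univ = η' univ) (hfin : smoothMoment s η' ≠ ⊤)
    (hmom : Tendsto (fun k => smoothMoment s (η k)) l (𝓝 (smoothMoment s η')))
    (htest : ∀ g : E d → ℝ, ContDiff ℝ 1 g → HasCompactSupport g →
      Tendsto (fun k => ∫ x, g x ∂(η k)) l (𝓝 (∫ x, g x ∂η'))) :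
    Tendsto (fun k => wassersteinDist s (η k) η') l (𝓝 0) := by
  have main : Tendsto (fun k => transportCost s (η k) η') l (𝓝 0) := by
    rw [ENNReal.tendsto_nhds_zero]
    intro ε hε
    -- any exponent of the cut-off functions does
    set m := 0
    have h2s : (2 : ℝ≥0∞) ^ s ≠ ⊤ := ENNReal.rpow_ne_top_of_nonneg hs.le ENNReal.ofNat_ne_top
    set tail : ℕ → ℝ≥0∞ := fun N =>
      smoothMoment s η' - ENNReal.ofReal (∫ x, japanese x ^ s * cutoff m N x ∂η') with htail
    -- the tail of the limit measure and the diameter of the pieces are chosen first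
    have h1 : Tendsto (fun N => (2 : ℝ≥0∞) ^ s * (tail N + tail N)) atTop (𝓝 0) := by
      have h2 : Tendsto tail atTop (𝓝 0) := by
        have := ENNReal.Tendsto.sub (tendsto_const_nhds (x := smoothMoment s η'))
          (tendsto_ofReal_integral_cutoff m s η') (Or.inl hfin)
        rwa [tsub_self] at this
      have h3 := ENNReal.Tendsto.const_mul (h2.add h2) (Or.inr h2s)
      simpa using h3
    have hε2 : 0 < ε / 2 := ENNReal.half_pos hε.ne'
    obtain ⟨N, hN⟩ := (h1.eventually (gt_mem_nhds hε2)).exists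
    have h4 : Tendsto (fun e : ℝ => ENNReal.ofReal (2 * e) ^ s * η' univ) (𝓝[>] 0) (𝓝 0) := by
      have h5 : Continuous (fun e : ℝ => ENNReal.ofReal (2 * e) ^ s) :=
        ENNReal.continuous_rpow_const.comp (ENNReal.continuous_ofReal.comp (by fun_prop))
      have h6 := ENNReal.Tendsto.mul_const ((h5.tendsto 0).mono_left
        (nhdsWithin_le_nhds (s := Ioi 0))) (b := η' univ) (Or.inr (measure_ne_top _ _))
      simpa [ENNReal.zero_rpow_of_pos hs] using h6
    obtain ⟨e, heε, he⟩ := ((h4.eventually (gt_mem_nhds hε2)).and self_mem_nhdsWithin).exists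
    obtain ⟨ι, _, ψ, c, hψ, hψc, hψ0, hψs, hψb⟩ := exists_smooth_decomposition (d := d) m N he
    set R : ℝ := N + 1 with hR
    have hsumE : ∀ x, ∑ i, ENNReal.ofReal (ψ i x) = ENNReal.ofReal (cutoff m N x) := by
      intro x
      rw [← ENNReal.ofReal_sum_of_nonneg fun i _ => hψ0 i x, hψs]
    have hcost : ∀ k, transportCost s (η k) η' ≤ ENNReal.ofReal (2 * e) ^ s * η' univ + 2 ^ s *
        ((smoothMoment s (η k) - ENNReal.ofReal (∫ x, japanese x ^ s * cutoff m N x ∂(η k)) +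
          ENNReal.ofReal (R ^ s) * ∑ i, (ENNReal.ofReal (∫ x, ψ i x ∂(η k)) -
            ENNReal.ofReal (∫ x, ψ i x ∂η'))) +
        (tail N + ENNReal.ofReal (R ^ s) * ∑ i, (ENNReal.ofReal (∫ x, ψ i x ∂η') -
            ENNReal.ofReal (∫ x, ψ i x ∂(η k))))) := by
      intro k
      have h6 := transportCost_le_of_partition (R := R) hs.le (η k) η' (hmass k)
        (f := fun i x => ENNReal.ofReal (ψ i x)) (S := fun i => Metric.ball (c i) e)
        (e := ENNReal.ofReal (2 * e))
        (fun i => (hψ i).continuous.measurable.ennreal_ofReal)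
        (fun x => by
          rw [hsumE, ← ENNReal.ofReal_one]
          exact ENNReal.ofReal_le_ofReal (cutoff_le_one m N x))
        (fun i x hx => by
          have h7 : cutoffBase N x ≠ 0 := by
            intro h0
            have h8 : ψ i x ≤ cutoff m N x := by
              rw [← hψs]
              exact Finset.single_le_sum (f := fun i => ψ i x) (fun i _ => hψ0 i x)
                (Finset.mem_univ i)
            rw [cutoff, h0, zero_pow (by omega)] at h8
            exact hx (ENNReal.ofReal_of_nonpos h8)
          exact (japanese_lt_of_cutoffBase_ne_zero N x h7).le)
        (fun i x hx => by rw [hψb i x hx, ENNReal.ofReal_zero])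
        (fun i x hx y hy => by
          rw [edist_dist]
          refine ENNReal.ofReal_le_ofReal ?_
          have h8 := dist_triangle_right x y (c i)
          rw [Metric.mem_ball] at hx hy
          linarith)
      simp_rw [hsumE, lintegral_tail_eq] at h6
      simp_rw [fun i (μ : Measure (E d)) [IsFiniteMeasure μ] =>
        lintegral_ofReal_eq_ofReal_integral (μ := μ) (hψ i).continuous (hψc i) (hψ0 i)] at h6
      rwa [hmass k] at h6
    have hψt : ∀ i, Tendsto (fun k => ENNReal.ofReal (∫ x, ψ i x ∂(η k))) l
        (𝓝 (ENNReal.ofReal (∫ x, ψ i x ∂η'))) := fun i =>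
      (ENNReal.continuous_ofReal.tendsto _).comp (htest _ (hψ i) (hψc i))
    have hlim : Tendsto (fun k => ENNReal.ofReal (2 * e) ^ s * η' univ + 2 ^ s *
        ((smoothMoment s (η k) - ENNReal.ofReal (∫ x, japanese x ^ s * cutoff m N x ∂(η k)) +
          ENNReal.ofReal (R ^ s) * ∑ i, (ENNReal.ofReal (∫ x, ψ i x ∂(η k)) -
            ENNReal.ofReal (∫ x, ψ i x ∂η'))) +
        (tail N + ENNReal.ofReal (R ^ s) * ∑ i, (ENNReal.ofReal (∫ x, ψ i x ∂η') -
            ENNReal.ofReal (∫ x, ψ i x ∂(η k)))))) l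
        (𝓝 (ENNReal.ofReal (2 * e) ^ s * η' univ + 2 ^ s *
          ((tail N + ENNReal.ofReal (R ^ s) * ∑ i : ι, 0) +
            (tail N + ENNReal.ofReal (R ^ s) * ∑ i : ι, 0)))) := by
      refine tendsto_const_nhds.add (ENNReal.Tendsto.const_mul (Tendsto.add (Tendsto.add ?_ ?_)
        (tendsto_const_nhds.add ?_)) (Or.inr h2s))
      · refine ENNReal.Tendsto.sub hmom ?_ (Or.inl hfin)
        exact (ENNReal.continuous_ofReal.tendsto _).comp (htest _
          (contDiff_japanese_mul_cutoff m N s) (hasCompactSupport_japanese_mul_cutoff m N s))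
      · refine ENNReal.Tendsto.const_mul (tendsto_finsetSum _ fun i _ => ?_)
          (Or.inr ENNReal.ofReal_ne_top)
        have := ENNReal.Tendsto.sub (hψt i) (tendsto_const_nhds
          (x := ENNReal.ofReal (∫ x, ψ i x ∂η'))) (Or.inl ENNReal.ofReal_ne_top)
        rwa [tsub_self] at this
      · refine ENNReal.Tendsto.const_mul (tendsto_finsetSum _ fun i _ => ?_)
          (Or.inr ENNReal.ofReal_ne_top)
        have := ENNReal.Tendsto.sub (tendsto_const_nhds
          (x := ENNReal.ofReal (∫ x, ψ i x ∂η'))) (hψt i) (Or.inl ENNReal.ofReal_ne_top)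
        rwa [tsub_self] at this
    have hlt : ENNReal.ofReal (2 * e) ^ s * η' univ + 2 ^ s *
          ((tail N + ENNReal.ofReal (R ^ s) * ∑ i : ι, 0) +
            (tail N + ENNReal.ofReal (R ^ s) * ∑ i : ι, 0)) < ε := by
      simp only [Finset.sum_const_zero, mul_zero, add_zero]
      calc _ < ε / 2 + ε / 2 := ENNReal.add_lt_add heε hN
        _ = ε := ENNReal.add_halves ε
    filter_upwards [hlim.eventually (gt_mem_nhds hlt)] with k hk
    exact (hcost k).trans hk.le
  have h7 := ((ENNReal.continuous_rpow_const (y := 1 / s)).tendsto 0).comp main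
  rw [ENNReal.zero_rpow_of_pos (by positivity)] at h7
  exact h7.congr fun k => (wassersteinDist_eq hs _ _).symm

/-! ### Comparison of the weighted distance with the Wasserstein distance -/

/-- `η` and `η'` lie on a common curve of action at most `ε ^ p`, in either order. -/
def Linked {d : ℕ} (p : ℝ) (φ : ℝ → E d → ℝ) (γ : Measure (E d)) (ε : ℝ)
    (η' η : Measure (E d)) : Prop :=
  ∃ (μ : ℝ → Measure (E d)) (n : ℝ → VectorRadonMeasure d), SolvesContinuity μ n (μ 0) (μ 1) ∧
    ∫⁻ t in Ioo (0 : ℝ) 1, action φ (μ t) (n t) γ ≠ ⊤ ∧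
    (∫⁻ t in Ioo (0 : ℝ) 1, action φ (μ t) (n t) γ).toReal ^ (1 / p) ≤ ε ∧
    ∃ s ∈ Icc (0 : ℝ) 1, ∃ t ∈ Icc (0 : ℝ) 1, μ s = η' ∧ μ t = η

lemma exists_curve_of_weightedDist_lt {d : ℕ} {p : ℝ} (hp : 0 < p) {φ : ℝ → E d → ℝ}
    {γ σ η : Measure (E d)} {ε : ℝ≥0∞} (h : weightedDist p φ γ σ η < ε) :
    ∃ (μ : ℝ → Measure (E d)) (n : ℝ → VectorRadonMeasure d), SolvesContinuity μ n σ η ∧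
      ∫⁻ t in Ioo (0 : ℝ) 1, action φ (μ t) (n t) γ < ε ^ p := by
  rw [weightedDist, one_div, ENNReal.rpow_inv_lt_iff hp] at h
  simpa only [iInf_lt_iff, exists_prop] using h

lemma linked_of_weightedDist_lt {d : ℕ} {p : ℝ} (hp : 0 < p) {φ : ℝ → E d → ℝ}
    {γ σ η : Measure (E d)} {ε : ℝ} (hε : 0 < ε)
    (h : weightedDist p φ γ σ η < ENNReal.ofReal ε) :
    Linked p φ γ ε σ η ∧ Linked p φ γ ε η σ := by
  obtain ⟨μ, n, hμ, hA⟩ := exists_curve_of_weightedDist_lt hp h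
  have h0 := hμ.initial
  have h1 := hμ.final
  have hs : SolvesContinuity μ n (μ 0) (μ 1) := by rwa [h0, h1]
  have hA' : (∫⁻ t in Ioo (0 : ℝ) 1, action φ (μ t) (n t) γ).toReal ^ (1 / p) ≤ ε := by
    rw [ENNReal.ofReal_rpow_of_pos hε] at hA
    have h2 := ENNReal.toReal_mono ENNReal.ofReal_ne_top hA.le
    rw [ENNReal.toReal_ofReal (by positivity)] at h2
    calc _ ≤ (ε ^ p) ^ (1 / p) := by gcongr
      _ = ε := by rw [← Real.rpow_mul hε.le, mul_one_div_cancel hp.ne', Real.rpow_one]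
  have z : (0 : ℝ) ∈ Icc (0 : ℝ) 1 := ⟨le_rfl, zero_le_one⟩
  have o : (1 : ℝ) ∈ Icc (0 : ℝ) 1 := ⟨zero_le_one, le_rfl⟩
  exact ⟨⟨μ, n, hs, hA.ne_top, hA', 0, z, 1, o, h0, h1⟩,
    ⟨μ, n, hs, hA.ne_top, hA', 1, o, 0, z, h1, h0⟩⟩

lemma exists_linked_of_weightedDist_lt_top {d : ℕ} {p : ℝ} (hp : 0 < p) {φ : ℝ → E d → ℝ}
    {γ σ η : Measure (E d)} (h : weightedDist p φ γ σ η < ⊤) : ∃ ε, Linked p φ γ ε σ η := by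
  refine ⟨(weightedDist p φ γ σ η).toReal + 1, (linked_of_weightedDist_lt hp (by positivity) ?_).1⟩
  rw [ENNReal.lt_ofReal_iff_toReal_lt h.ne]
  linarith

lemma smoothMoment_zero {d : ℕ} (μ : Measure (E d)) : smoothMoment 0 μ = μ univ := by
  simp [smoothMoment]

lemma isFiniteMeasure_of_smoothMoment {d : ℕ} {s : ℝ} (hs : 0 ≤ s) {μ : Measure (E d)}
    (h : smoothMoment s μ ≠ ⊤) : IsFiniteMeasure μ := by
  refine ⟨lt_of_le_of_lt ?_ h.lt_top⟩
  rw [← smoothMoment_zero]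
  exact lintegral_mono fun x => ENNReal.ofReal_le_ofReal
    (Real.rpow_le_rpow_of_exponent_le (one_le_japanese x) hs)

lemma tendsto_integral_cutoff {d : ℕ} (m : ℕ) (s : ℝ) {μ : Measure (E d)}
    [IsLocallyFiniteMeasure μ] (h : smoothMoment s μ ≠ ⊤) :
    Tendsto (fun k : ℕ => ∫ x, japanese x ^ s * cutoff m k x ∂μ) atTop
      (𝓝 (smoothMoment s μ).toReal) := by
  refine ((ENNReal.tendsto_toReal h).comp (tendsto_ofReal_integral_cutoff m s μ)).congr fun k => ?_
  exact ENNReal.toReal_ofReal (integral_nonneg fun x =>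
    mul_nonneg (Real.rpow_nonneg (japanese_pos x).le _) (cutoff_nonneg m k x))

/-- For `δ ≥ 1`, linked measures have the same mass, and the integrals of test functions as well as
the moments of order `δ` depend continuously on the distance. -/
lemma exists_const_linked {d : ℕ} {p δ α a : ℝ} {L : ℝ≥0∞} {φ : ℝ → E d → ℝ}
    {γ : Measure (E d)} (hF : FluxBound p φ γ δ α a L) (hp : 1 < p) (hα : 1 / p ≤ α) (hα1 : α ≤ 1)
    (ha : 0 < a) (hL : L ≠ ⊤) (hδ : 1 ≤ δ) {η' : Measure (E d)} (hη' : smoothMoment δ η' ≠ ⊤)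
    (B : ℝ) :
    ∃ C : ℝ, 0 < C ∧ (∀ ε ≤ B, ∀ η, Linked p φ γ ε η' η → smoothMoment δ η ≠ ⊤ ∧
      η univ = η' univ ∧
      |(smoothMoment δ η).toReal - (smoothMoment δ η').toReal| ≤ gradientConst p δ * C * ε) ∧
      ∀ g : E d → ℝ, ContDiff ℝ 1 g → HasCompactSupport g → ∃ G : ℝ, 0 < G ∧
        ∀ ε ≤ B, ∀ η, Linked p φ γ ε η' η →
          |(∫ x, g x ∂η) - ∫ x, g x ∂η'| ≤ G * C * ε := by
  obtain ⟨C, hC, hCb⟩ := exists_const_test_le hF hp hα hα1 ha hL hη' B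
  have key : ∀ ε ≤ B, ∀ η, Linked p φ γ ε η' η → smoothMoment δ η ≠ ⊤ ∧
      IsLocallyFiniteMeasure η ∧ IsLocallyFiniteMeasure η' ∧
      ∀ g : E d → ℝ, ContDiff ℝ 1 g → HasCompactSupport g → ∀ G : ℝ, 0 < G →
        (∀ x, ‖fderiv ℝ g x‖ ≤ G * japanese x ^ (δ - 1)) →
        |(∫ x, g x ∂η) - ∫ x, g x ∂η'| ≤ G * C * ε := by
    rintro ε hε η ⟨μ, n, hμ, hA, hAε, s, hs, t, ht, rfl, rfl⟩
    obtain ⟨h1, h2⟩ := hCb μ n _ _ hμ hA (hAε.trans hε) s hs t ht le_rfl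
    refine ⟨h1, hμ.locallyFinite t ht, hμ.locallyFinite s hs, fun g hg hgc G hG hgG => ?_⟩
    refine (h2 g hg hgc G hG hgG).trans ?_
    gcongr
  have hJ1 : ∀ x : E d, 1 ≤ japanese x ^ (δ - 1) := fun x =>
    Real.one_le_rpow (one_le_japanese x) (by linarith)
  refine ⟨C, hC, fun ε hε η hη => ?_, fun g hg hgc => ?_⟩
  · obtain ⟨h1, h2, h3, h4⟩ := key ε hε η hη
    refine ⟨h1, ?_, ?_⟩
    · have hfin := isFiniteMeasure_of_smoothMoment (by linarith) h1
      have hfin' := isFiniteMeasure_of_smoothMoment (by linarith) hη'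
      have hz : ∀ μ : Measure (E d), IsFiniteMeasure μ → smoothMoment 0 μ ≠ ⊤ := fun μ _ => by
        rw [smoothMoment_zero]; exact measure_ne_top _ _
      have t1 := tendsto_integral_cutoff 0 0 (hz η hfin)
      have t2 := tendsto_integral_cutoff 0 0 (hz η' hfin')
      simp only [Real.rpow_zero, one_mul, smoothMoment_zero] at t1 t2
      have t3 : Tendsto (fun k : ℕ => 2 * ((0 : ℕ) + 2) / ((k : ℝ) + 1) * C * ε) atTop (𝓝 0) := by
        have t4 : Tendsto (fun k : ℕ => (k : ℝ) + 1) atTop atTop :=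
          tendsto_atTop_add_const_right _ _ tendsto_natCast_atTop_atTop
        simpa using (((tendsto_const_nhds (x := (2 * ((0 : ℕ) + 2) : ℝ))).div_atTop t4).mul_const
          C).mul_const ε
      have hle := le_of_tendsto_of_tendsto (t1.sub t2).abs t3 (Eventually.of_forall fun k => by
        refine h4 _ (contDiff_cutoff 0 k) (hasCompactSupport_cutoff 0 k) _ (by positivity)
          fun x => ?_
        exact (norm_fderiv_cutoff_le_div 0 k x).trans
          (le_mul_of_one_le_right (by positivity) (hJ1 x)))
      have h5 : (η univ).toReal = (η' univ).toReal :=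
        sub_eq_zero.1 (abs_eq_zero.1 (le_antisymm hle (abs_nonneg _)))
      exact (ENNReal.toReal_eq_toReal_iff' (measure_ne_top _ _) (measure_ne_top _ _)).1 h5
    · have t1 := tendsto_integral_cutoff (cutoffExponent p) δ h1
      have t2 := tendsto_integral_cutoff (cutoffExponent p) δ hη'
      refine le_of_tendsto (t1.sub t2).abs (Eventually.of_forall fun k => ?_)
      refine h4 _ (contDiff_japanese_mul_cutoff _ k δ)
        (hasCompactSupport_japanese_mul_cutoff _ k δ) _
        (gradientConst_pos p δ) fun x => ?_
      simpa using norm_fderiv_japanese_mul_cutoff_le_rpow hp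
        (α := 1) (by rw [div_le_one (by linarith)]; exact hp.le) δ k x
  · obtain ⟨G, hG⟩ := (hgc.fderiv ℝ).exists_bound_of_continuous (hg.continuous_fderiv one_ne_zero)
    refine ⟨max G 1, by positivity, fun ε hε η hη => ?_⟩
    refine (key ε hε η hη).2.2.2 g hg hgc _ (by positivity) fun x => ?_
    exact ((hG x).trans (le_max_left _ _)).trans (le_mul_of_one_le_right (by positivity) (hJ1 x))

/-- Measures that are linked to `η'` through curves of vanishing action converge to `η'` in the
Wasserstein distance. -/
lemma tendsto_wassersteinDist_of_linked {d : ℕ} {p δ α a : ℝ} {L : ℝ≥0∞} {φ : ℝ → E d → ℝ}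
    {γ : Measure (E d)} (hF : FluxBound p φ γ δ α a L) (hp : 1 < p) (hα : 1 / p ≤ α) (hα1 : α ≤ 1)
    (ha : 0 < a) (hL : L ≠ ⊤) (hδ : 1 ≤ δ) {X : Type*} {l : Filter X} {η : X → Measure (E d)}
    {η' : Measure (E d)} (hη' : smoothMoment δ η' ≠ ⊤) (hη : ∀ k, IsFiniteMeasure (η k))
    (hmass : ∀ k, η k univ = η' univ)
    (hl : ∀ ε, 0 < ε → ∀ᶠ k in l, Linked p φ γ ε η' (η k)) :
    Tendsto (fun k => wassersteinDist δ (η k) η') l (𝓝 0) := by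
  obtain ⟨C, hC, hCb, hCg⟩ := exists_const_linked hF hp hα hα1 ha hL hδ hη' 1
  have := isFiniteMeasure_of_smoothMoment (by linarith) hη'
  have hG := gradientConst_pos p δ
  -- a bound by a multiple of every small `ε` forces convergence
  have lim : ∀ (f : X → ℝ) (b K : ℝ), 0 < K →
      (∀ ε, 0 < ε → ε ≤ 1 → ∀ k, Linked p φ γ ε η' (η k) → |f k - b| ≤ K * ε) →
      Tendsto f l (𝓝 b) := by
    intro f b K hK hf
    rw [Metric.tendsto_nhds]
    intro e he
    set ε := min 1 (e / (2 * K)) with hε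
    have hε0 : 0 < ε := by positivity
    filter_upwards [hl ε hε0] with k hk
    have h1 := hf ε hε0 (min_le_left _ _) k hk
    rw [Real.dist_eq]
    refine h1.trans_lt ?_
    calc K * ε ≤ K * (e / (2 * K)) := by gcongr; exact min_le_right _ _
      _ = e / 2 := by field_simp
      _ < e := by linarith
  refine tendsto_wassersteinDist (by linarith) hmass hη' ?_ ?_
  · have h1 : Tendsto (fun k => (smoothMoment δ (η k)).toReal) l (𝓝 (smoothMoment δ η').toReal) :=
      lim _ _ (gradientConst p δ * C) (by positivity)
        fun ε _ hε k hk => (hCb ε hε (η k) hk).2.2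
    have h2 := (ENNReal.continuous_ofReal.tendsto _).comp h1
    rw [ENNReal.ofReal_toReal hη'] at h2
    refine h2.congr' ?_
    filter_upwards [hl 1 one_pos] with k hk
    exact ENNReal.ofReal_toReal (hCb 1 le_rfl (η k) hk).1
  · intro g hg hgc
    obtain ⟨G, hG0, hGb⟩ := hCg g hg hgc
    exact lim _ _ (G * C) (by positivity) fun ε _ hε k hk => hGb ε hε (η k) hk

/-- A flux bound with `δ ≥ 1` makes the weighted distance topologically stronger than `W_δ`. -/
lemma weightedStrongerThanWasserstein_of_fluxBound {d : ℕ} {p δ α a : ℝ} {L : ℝ≥0∞}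
    {φ : ℝ → E d → ℝ} {γ : Measure (E d)} (hF : FluxBound p φ γ δ α a L) (hp : 1 < p)
    (hα : 1 / p ≤ α) (hα1 : α ≤ 1) (ha : 0 < a) (hL : L ≠ ⊤) (hδ : 1 ≤ δ) {σ : Measure (E d)}
    (hσ : smoothMoment δ σ ≠ ⊤) : WeightedStrongerThanWasserstein p φ γ σ δ := by
  have hp0 : 0 < p := by linarith
  have hδ0 : 0 < δ := by linarith
  have hcl : ∀ η ∈ finiteDistClass p φ γ σ, smoothMoment δ η ≠ ⊤ ∧ η univ = σ univ := by
    intro η hη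
    obtain ⟨ε, hε⟩ := exists_linked_of_weightedDist_lt_top hp0 hη.2
    obtain ⟨C, -, hC, -⟩ := exists_const_linked hF hp hα hα1 ha hL hδ hσ ε
    exact ⟨(hC ε le_rfl η hε).1, (hC ε le_rfl η hε).2.1⟩
  have hfin : ∀ η ∈ finiteDistClass p φ γ σ, IsFiniteMeasure η := fun η hη =>
    isFiniteMeasure_of_smoothMoment hδ0.le (hcl η hη).1
  refine ⟨fun η hη η' hη' => ?_, fun U hU x hx => ?_, fun η η' hη hη' hlim => ?_⟩
  · have := hfin η hη
    have := hfin η' hη'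
    rw [wassersteinDist_eq hδ0]
    refine ENNReal.rpow_lt_top_of_nonneg (by positivity) (ne_top_of_le_ne_top ?_
      (transportCost_le_smoothMoment hδ0.le η η' ((hcl η hη).2.trans (hcl η' hη').2.symm)))
    exact ENNReal.mul_ne_top (ENNReal.rpow_ne_top_of_nonneg hδ0.le ENNReal.ofNat_ne_top)
      (ENNReal.add_ne_top.2 ⟨(hcl η hη).1, (hcl η' hη').1⟩)
  · obtain ⟨e, he, heU⟩ := hU x hx
    -- neighbourhoods of `x` for the weighted distance
    have hT := tendsto_wassersteinDist_of_linked hF hp hα hα1 ha hL hδ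
      (l := comap (fun y : finiteDistClass p φ γ σ => weightedDist p φ γ x.1 y.1) (𝓝 0))
      (η := fun y => y.1) (hcl x.1 x.2).1 (fun y => hfin y.1 y.2)
      (fun y => (hcl y.1 y.2).2.trans (hcl x.1 x.2).2.symm)
      (fun ε hε => by
        have h1 := tendsto_comap.eventually (f := fun y : finiteDistClass p φ γ σ =>
          weightedDist p φ γ x.1 y.1) (gt_mem_nhds (ENNReal.ofReal_pos.2 hε))
        filter_upwards [h1] with y hy
        exact (linked_of_weightedDist_lt hp0 hε hy).1)
    have h2 := hT.eventually (gt_mem_nhds he)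
    rw [eventually_comap] at h2
    obtain ⟨e', he', hb⟩ := ENNReal.nhds_zero_basis.mem_iff.1 h2
    refine ⟨e', he', fun y hy => heU y ?_⟩
    change wassersteinDist δ x.1 y.1 < e
    rw [wassersteinDist_comm]
    exact hb hy y rfl
  · refine tendsto_wassersteinDist_of_linked hF hp hα hα1 ha hL hδ (hcl η' hη').1
      (fun k => hfin _ (hη k)) (fun k => (hcl _ (hη k)).2.trans (hcl η' hη').2.symm) fun ε hε => ?_
    filter_upwards [hlim.eventually (gt_mem_nhds (ENNReal.ofReal_pos.2 hε))] with k hk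
    exact (linked_of_weightedDist_lt hp0 hε hk).2

/-! ### The moment estimates -/

lemma le_of_forall_gt_le_continuous {f : ℝ≥0∞ → ℝ≥0∞} (hf : Continuous f) {w x : ℝ≥0∞}
    (hw : w ≠ ⊤) (h : ∀ ε, w < ε → x ≤ f ε) : x ≤ f w := by
  have : (𝓝[>] w).NeBot := nhdsGT_neBot_of_exists_gt ⟨⊤, hw.lt_top⟩
  refine ge_of_tendsto (b := x) (f := f) (x := 𝓝[>] w)
    ((hf.tendsto w).mono_left nhdsWithin_le_nhds) ?_
  filter_upwards [self_mem_nhdsWithin] with ε hε using h ε hε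

lemma continuous_ofReal_mul_add_mul_rpow (C : ℝ) (S b : ℝ≥0∞) (hb : b ≠ ⊤) (s : ℝ) :
    Continuous (fun ε : ℝ≥0∞ => ENNReal.ofReal C * (S + b * ε ^ s)) :=
  (ENNReal.continuous_const_mul ENNReal.ofReal_ne_top).comp
    (continuous_const.add ((ENNReal.continuous_const_mul hb).comp ENNReal.continuous_rpow_const))

/-- The endpoint moment in terms of a curve, with the constant of the flux bound separated from the
action. -/
lemma moment_le_of_curve {d : ℕ} {p δ α a : ℝ} {L : ℝ≥0∞} {φ : ℝ → E d → ℝ}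
    {γ : Measure (E d)} (hF : FluxBound p φ γ δ α a L) (hp : 1 < p) (hα : 1 / p ≤ α) (hα1 : α ≤ 1)
    (ha : 0 < a) (hL : L ≠ ⊤) {σ η : Measure (E d)} {ε : ℝ≥0∞}
    (h : weightedDist p φ γ σ η < ε) :
    moment δ η ≤ ENNReal.ofReal (2 ^ |δ|) * (2 * (ENNReal.ofReal (2 ^ |δ|) * moment δ σ + L) +
      ENNReal.ofReal ((2 * gradientConst p δ * a) ^ (1 / α)) * ε ^ (1 / α)) := by
  have hp0 : 0 < p := by linarith
  have hα0 : 0 < α := lt_of_lt_of_le (by positivity) hα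
  have hG := gradientConst_pos p δ
  obtain ⟨μ, n, hμ, hA⟩ := exists_curve_of_weightedDist_lt hp0 h
  have h1 := hμ.smoothMoment_add_le hF hp hα hα1 ha hL hA.ne_top
    (s := 0) (t := 1) ⟨le_rfl, zero_le_one⟩ ⟨zero_le_one, le_rfl⟩
  rw [hμ.initial, hμ.final] at h1
  set A := ∫⁻ t in Ioo (0 : ℝ) 1, action φ (μ t) (n t) γ with hAd
  have h2 : ENNReal.ofReal ((2 * (gradientConst p δ * a * A.toReal ^ (1 / p))) ^ (1 / α)) ≤
      ENNReal.ofReal ((2 * gradientConst p δ * a) ^ (1 / α)) * ε ^ (1 / α) := by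
    have h3 : 2 * (gradientConst p δ * a * A.toReal ^ (1 / p)) =
        2 * gradientConst p δ * a * A.toReal ^ (1 / p) := by ring
    rw [h3, Real.mul_rpow (by positivity) (by positivity), ENNReal.ofReal_mul (by positivity),
      ← ENNReal.ofReal_rpow_of_nonneg (x := A.toReal ^ (1 / p)) (by positivity) (by positivity),
      ← ENNReal.ofReal_rpow_of_nonneg ENNReal.toReal_nonneg (by positivity),
      ENNReal.ofReal_toReal hA.ne_top]
    gcongr
    calc A ^ (1 / p) ≤ (ε ^ p) ^ (1 / p) := by gcongr
      _ = ε := by rw [← ENNReal.rpow_mul, mul_one_div_cancel hp0.ne', ENNReal.rpow_one]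
  refine (moment_le_smoothMoment δ η).trans ?_
  gcongr
  refine (le_self_add.trans h1).trans ?_
  gcongr
  exact smoothMoment_le δ σ

end WeightedTransport

theorem mainTheorem9 (d : ℕ) (p q : ℝ) (hpq : p.HolderConjugate q)
    (φ : ℝ → WeightedTransport.E d → ℝ) (hφ : WeightedTransport.IsActionDensity p φ) (δ : ℝ) :
    ∃ C : ℝ, 0 < C ∧
      ∀ (r : ℝ) (γ σ : Measure (WeightedTransport.E d)),
        IsLocallyFiniteMeasure γ → IsLocallyFiniteMeasure σ →
        WeightedTransport.moment r γ < ⊤ → WeightedTransport.moment δ σ < ⊤ →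
        -- the case of a general action density
        (δ ≤ min (1 + r / q) p →
          (∀ η ∈ WeightedTransport.finiteDistClass p φ γ σ,
            WeightedTransport.moment δ η < ⊤ ∧
            WeightedTransport.moment δ η ≤
              ENNReal.ofReal C * (WeightedTransport.moment δ σ + WeightedTransport.moment r γ +
                WeightedTransport.weightedDist p φ γ σ η ^ p)) ∧
          (1 ≤ δ → WeightedTransport.WeightedStrongerThanWasserstein p φ γ σ δ)) ∧
        -- the case of a jointly homogeneous action density
        (∀ θ : ℝ, 1 ≤ θ → θ ≤ p → WeightedTransport.IsJointlyHomogeneous θ φ →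
          δ ≤ 1 / θ * p + (1 - 1 / θ) * r →
          (∀ η ∈ WeightedTransport.finiteDistClass p φ γ σ,
            WeightedTransport.moment δ η < ⊤ ∧
            WeightedTransport.moment δ η ≤
              ENNReal.ofReal C * (WeightedTransport.moment δ σ + WeightedTransport.moment r γ +
                WeightedTransport.weightedDist p φ γ σ η ^ p) ∧
            WeightedTransport.moment δ η ≤
              ENNReal.ofReal C * (WeightedTransport.moment δ σ +
                WeightedTransport.moment r γ ^ (1 - 1 / θ) *
                  WeightedTransport.weightedDist p φ γ σ η ^ (p / θ))) ∧
          (1 ≤ δ → WeightedTransport.WeightedStrongerThanWasserstein p φ γ σ δ)) := by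
  open WeightedTransport in
  have hp : 1 < p := hpq.lt
  have hp0 : 0 < p := hpq.pos
  obtain ⟨c, hc, hgen, hhom⟩ := hφ.exists_lower_bound hp
  have hG := gradientConst_pos p δ
  set a₁ : ℝ := 2 * c ^ (-(1 / p)) with ha₁
  have ha₁0 : 0 < a₁ := by positivity
  set a₂ : ℝ := 2 ^ (|δ| + 1) * a₁ with ha₂
  have ha₂0 : 0 < a₂ := by positivity
  have ha₁₂ : a₁ ≤ a₂ :=
    le_mul_of_one_le_left ha₁0.le (Real.one_le_rpow one_le_two (by positivity))
  -- the lower bound `1 ≤ D` makes `D ^ (p / θ) ≤ D ^ p` for all `θ ≥ 1`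
  set D : ℝ := max 1 (2 * gradientConst p δ * a₂) with hD
  have hD1 : 1 ≤ D := le_max_left _ _
  have hD2 : 2 * gradientConst p δ * a₂ ≤ D := le_max_right _ _
  set k : ℝ := 2 ^ |q * (δ - 1)| with hk
  set C₁ : ℝ := 2 * 2 ^ |δ| + 2 * k + D ^ p with hC₁
  have hC₁a : 2 * 2 ^ |δ| ≤ C₁ := by
    have : 0 ≤ 2 * k + D ^ p := by positivity
    linarith
  have hC₁b : 2 * k ≤ C₁ := by
    have : 0 ≤ 2 * 2 ^ |δ| + D ^ p := by positivity
    linarith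
  have hC₁c : D ^ p ≤ C₁ := by
    have : 0 ≤ 2 * (2 : ℝ) ^ |δ| + 2 * k := by positivity
    linarith
  have hC₁0 : 0 < C₁ := by positivity
  refine ⟨2 ^ |δ| * C₁, by positivity, fun r γ σ hγ hσ hrγ hδσ => ⟨fun hδ => ?_,
    fun θ hθ hθp hθφ hδ => ?_⟩⟩
  · have hF := fluxBound_general hpq hc hgen hδ γ
    have hL : ENNReal.ofReal k * moment r γ ≠ ⊤ :=
      ENNReal.mul_ne_top ENNReal.ofReal_ne_top hrγ.ne
    have hα1 : 1 / p ≤ 1 := by rw [div_le_one hp0]; exact hp.le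
    refine ⟨fun η hη => ?_, fun hδ1 => weightedStrongerThanWasserstein_of_fluxBound hF hp le_rfl hα1
      ha₁0 hL hδ1 (ne_top_of_le_ne_top (ENNReal.mul_ne_top ENNReal.ofReal_ne_top hδσ.ne)
        (smoothMoment_le δ σ))⟩
    have hle : moment δ η ≤ ENNReal.ofReal (2 ^ |δ| * C₁) * (moment δ σ + moment r γ +
        weightedDist p φ γ σ η ^ p) := by
      have hcont := continuous_ofReal_mul_add_mul_rpow (2 ^ |δ| * C₁) (moment δ σ + moment r γ) 1
        ENNReal.one_ne_top p
      simp only [one_mul] at hcont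
      refine le_of_forall_gt_le_continuous hcont hη.2.ne fun ε hε => ?_
      refine (moment_le_of_curve hF hp le_rfl hα1 ha₁0 hL hε).trans ?_
      rw [ENNReal.ofReal_mul (p := 2 ^ |δ|) (by positivity),
        mul_assoc (ENNReal.ofReal (2 ^ |δ|)) (ENNReal.ofReal C₁), one_div_one_div]
      refine mul_le_mul_right ?_ _
      have e1 : 2 * (ENNReal.ofReal (2 ^ |δ|) * moment δ σ) ≤ ENNReal.ofReal C₁ * moment δ σ := by
        rw [← mul_assoc, ← ENNReal.ofReal_ofNat, ← ENNReal.ofReal_mul zero_le_two]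
        gcongr
      have e2 : 2 * (ENNReal.ofReal k * moment r γ) ≤ ENNReal.ofReal C₁ * moment r γ := by
        rw [← mul_assoc, ← ENNReal.ofReal_ofNat, ← ENNReal.ofReal_mul zero_le_two]
        gcongr
      have e3 : ENNReal.ofReal ((2 * gradientConst p δ * a₁) ^ p) ≤ ENNReal.ofReal C₁ := by
        refine ENNReal.ofReal_le_ofReal (le_trans ?_ hC₁c)
        refine Real.rpow_le_rpow (by positivity) (le_trans ?_ hD2) hp0.le
        gcongr
      rw [mul_add, mul_add, mul_add]
      gcongr
    refine ⟨hle.trans_lt ?_, hle⟩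
    refine ENNReal.mul_lt_top ENNReal.ofReal_lt_top (ENNReal.add_lt_top.2
      ⟨ENNReal.add_lt_top.2 ⟨hδσ, hrγ⟩, ENNReal.rpow_lt_top_of_nonneg hp0.le hη.2.ne⟩)
  · have hθ0 : 0 < θ := by linarith
    have hF := fun (l : ℝ) (hl0 : 0 < l) (hl : moment r γ ≤ ENNReal.ofReal l) =>
      fluxBound_homogeneous hp hc hgen hθ hθp (hhom θ hθφ) hδ γ hl0 hl
    have hα : 1 / p ≤ θ / p := by gcongr
    have hα1 : θ / p ≤ 1 := by rw [div_le_one hp0]; exact hθp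
    have e0 : 0 ≤ 1 - 1 / θ := by rw [sub_nonneg, div_le_one hθ0]; exact hθ
    have hpθ : p / θ ≤ p := div_le_self hp0.le hθ
    have hpθ0 : 0 ≤ p / θ := by positivity
    have hrt : ∀ b : ℝ≥0∞, b ≠ ⊤ → b ^ (1 - 1 / θ) ≠ ⊤ := fun b hb =>
      ENNReal.rpow_ne_top_of_nonneg e0 hb
    refine ⟨fun η hη => ?_, fun hδ1 => ?_⟩
    · have hW : weightedDist p φ γ σ η ≠ ⊤ := hη.2.ne
      -- the weight of `γ` enters through a positive upper bound `l`, which then decreases to it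
      have hl : ∀ l : ℝ, 0 < l → moment r γ ≤ ENNReal.ofReal l → moment δ η ≤
          ENNReal.ofReal (2 ^ |δ| * C₁) * (moment δ σ + ENNReal.ofReal l ^ (1 - 1 / θ) *
            weightedDist p φ γ σ η ^ (p / θ)) := by
        intro l hl0 hl
        refine le_of_forall_gt_le_continuous (continuous_ofReal_mul_add_mul_rpow _ _ _
          (hrt _ ENNReal.ofReal_ne_top) _) hW fun ε hε => ?_
        refine (moment_le_of_curve (hF l hl0 hl) hp hα hα1 (by positivity) ENNReal.zero_ne_top
          hε).trans ?_
        rw [ENNReal.ofReal_mul (p := 2 ^ |δ|) (by positivity),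
        mul_assoc (ENNReal.ofReal (2 ^ |δ|)) (ENNReal.ofReal C₁), one_div_div, add_zero]
        refine mul_le_mul_right ?_ _
        have e1 : 2 * (ENNReal.ofReal (2 ^ |δ|) * moment δ σ) ≤ ENNReal.ofReal C₁ * moment δ σ := by
          rw [← mul_assoc, ← ENNReal.ofReal_ofNat, ← ENNReal.ofReal_mul zero_le_two]
          gcongr
        have e3 : ENNReal.ofReal ((2 * gradientConst p δ * (a₂ * l ^ ((θ - 1) / p))) ^ (p / θ)) ≤
            ENNReal.ofReal C₁ * ENNReal.ofReal l ^ (1 - 1 / θ) := by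
          rw [ENNReal.ofReal_rpow_of_pos hl0, ← ENNReal.ofReal_mul hC₁0.le]
          refine ENNReal.ofReal_le_ofReal ?_
          rw [← mul_assoc, Real.mul_rpow (by positivity) (by positivity), ← Real.rpow_mul hl0.le]
          have e4 : (θ - 1) / p * (p / θ) = 1 - 1 / θ := by field_simp
          rw [e4]
          gcongr
          calc (2 * gradientConst p δ * a₂) ^ (p / θ) ≤ D ^ (p / θ) := by gcongr
            _ ≤ D ^ p := Real.rpow_le_rpow_of_exponent_le hD1 hpθ
            _ ≤ C₁ := hC₁c
        rw [mul_add, ← mul_assoc (ENNReal.ofReal C₁) (ENNReal.ofReal l ^ (1 - 1 / θ))]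
        gcongr
      have hle2 : moment δ η ≤ ENNReal.ofReal (2 ^ |δ| * C₁) * (moment δ σ +
          moment r γ ^ (1 - 1 / θ) * weightedDist p φ γ σ η ^ (p / θ)) := by
        have hcont := continuous_ofReal_mul_add_mul_rpow (2 ^ |δ| * C₁) (moment δ σ)
          (weightedDist p φ γ σ η ^ (p / θ)) (ENNReal.rpow_ne_top_of_nonneg hpθ0 hW) (1 - 1 / θ)
        rw [mul_comm (moment r γ ^ (1 - 1 / θ))]
        refine le_of_forall_gt_le_continuous hcont hrγ.ne fun x hx => ?_
        obtain ⟨l, hl0, hl1, hl2⟩ := ENNReal.lt_iff_exists_real_btwn.1 hx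
        have hlpos : 0 < l := ENNReal.ofReal_pos.1 (zero_le.trans_lt hl1)
        refine (hl l hlpos hl1.le).trans ?_
        rw [mul_comm (ENNReal.ofReal l ^ (1 - 1 / θ))]
        gcongr
      have hle1 : moment δ η ≤ ENNReal.ofReal (2 ^ |δ| * C₁) * (moment δ σ + moment r γ +
          weightedDist p φ γ σ η ^ p) := by
        refine hle2.trans ?_
        rw [add_assoc]
        gcongr
        set w := weightedDist p φ γ σ η ^ p with hw
        have h1 : weightedDist p φ γ σ η ^ (p / θ) = w ^ (1 / θ) := by
          rw [hw, ← ENNReal.rpow_mul, mul_one_div]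
        have h2 : moment r γ ≤ moment r γ + w := le_self_add
        have h3 : w ≤ moment r γ + w := le_add_self
        have h4 : 0 ≤ 1 / θ := by positivity
        calc moment r γ ^ (1 - 1 / θ) * weightedDist p φ γ σ η ^ (p / θ)
            ≤ (moment r γ + w) ^ (1 - 1 / θ) * (moment r γ + w) ^ (1 / θ) := by
              rw [h1]
              gcongr
          _ = moment r γ + w := by
              rw [← ENNReal.rpow_add_of_nonneg _ _ e0 h4, sub_add_cancel, ENNReal.rpow_one]
      refine ⟨hle2.trans_lt ?_, hle1, hle2⟩
      refine ENNReal.mul_lt_top ENNReal.ofReal_lt_top (ENNReal.add_lt_top.2 ⟨hδσ,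
        ENNReal.mul_lt_top (hrt _ hrγ.ne).lt_top (ENNReal.rpow_lt_top_of_nonneg hpθ0 hW)⟩)
    · have hlpos : 0 < (moment r γ).toReal + 1 := by positivity
      refine weightedStrongerThanWasserstein_of_fluxBound (hF _ hlpos ?_) hp hα hα1
        (by positivity) ENNReal.zero_ne_top hδ1
        (ne_top_of_le_ne_top (ENNReal.mul_ne_top ENNReal.ofReal_ne_top hδσ.ne)
          (smoothMoment_le δ σ))
      exact (ENNReal.le_ofReal_iff_toReal_le hrγ.ne hlpos.le).2 (by linarith)
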